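/- **Rectangulations.** A generic rectangulation is a partition of an axis-aligned rectangle into finitely many interior-disjoint axis-aligned rectangles, no four of which have a point in common. A rectangle $r$ is left of $s$ if the right side of $r$ meets the left side of $s$ in a segment, and $r$ is below $s$ if the top side of $r$ meets the bottom side of $s$ in a segment. Rectangulations are considered up to bijections of their rectangles that preserve the left/right and below/above relations; $\mathcal R_n$ is the set of rectangulations with $n\ge 1$ rectangles. $R$ is bottom-based (right-based) if some rectangle of $R$ has the entire bottom (right) boundary of $R$ as its bottom (right) side. Let $\mathrm{id}_n\in\mathcal R_n$ be the rectangulation that consists of $n$ side-by-side vertical strips. **Deletion.** For $R\in\mathcal R_n$, $n\ge 2$, let $r$ be the rectangle in the bottom-right corner. If the T-joint at the top-left corner of $r$ has the shape $\vdash$, slide the top side of $r$ down onto its bottom side; if it has the shape $\top$, slide the left side of $r$ to the right onto its right side. The result is $p(R)\in\mathcal R_{n-1}$. Put $R^{[j]}=p^{\,n-j}(R)$; $r_j$ denotes the rectangle in the bottom-right corner of $R^{[j]}$. **Insertion.** The insertion points of $P\in\mathcal R_{n}$ are obtained by choosing one interior point (vertical insertion point) on every edge on the left side of a rectangle touching the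 bottom boundary, and one interior point (horizontal insertion point) on every edge on the top side of a rectangle touching the right boundary, where an edge is a segment between two consecutive rectangle corners. They are ordered $q_1,\dots,q_{\nu(P)}$: first the vertical ones lexicographically by $(x,y)$, then the horizontal ones lexicographically by $(y,x)$. For a vertical $q_i$, $c_i(P)\in\mathcal R_{n+1}$ is obtained by inserting a new rectangle in the bottom-right corner that has above it exactly the rectangles of $P$ that lie to the right of $q_i$ and touch the bottom boundary, and to its left exactly the rectangles of $P$ that touch, from the left, the vertical wall through $q_i$ below $q_i$. For a horizontal $q_i$, the new rectangle has to its left exactly the rectangles that lie below $q_i$ and touch the right boundary, and above it exactly the rectangles that touch, from above, the horizontal wall through $q_i$ to the right of $q_i$. **Zigzag sets.** $\mathcal C_n\subseteq\mathcal R_n$ is zigzag if either $n=1$ and $\mathcal C_1=\mathcal R_1=\{\mathrm{id}_1\}$, or $n\ge 2$, the set $\mathcal C_{n-1}=\{p(R): R\in\mathcal C_n\}$ is zigzag, and $c_1(P),c_{\nu(P)}(P)\in\mathcal C_n$ for every $P\in\mathcal C_{n-1}$. **Jumps.** For $2\le j\le n$ and $d>0$, $R'\in\mathcal R_n$ differs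 from $R\in\mathcal R_n$ by a right (left) jump of $r_j$ by $d$ steps if either $j=n$, $p(R)=p(R')=P$, $R=c_k(P)$ and $R'=c_{k+d}(P)$ (respectively $R'=c_{k-d}(P)$) for some $k$; or $j<n$, $R$ and $R'$ are both bottom-based or both right-based, and $p(R')$ differs from $p(R)$ by a right (left) jump of $r_j$ by $d$ steps. A jump from $R$ to $R'\in\mathcal C_n$ is minimal with respect to $\mathcal C_n$ if no jump of the same rectangle in the same direction by fewer steps leads from $R$ to an element of $\mathcal C_n$. **Algorithm J.** Visit $\mathrm{id}_n$. Then repeat: among all minimal jumps with respect to $\mathcal C_n$ from the most recently visited rectangulation to an unvisited element of $\mathcal C_n$, take one of a rectangle with the largest index; if none exists, or if for that index such jumps exist in both directions, terminate; otherwise visit the rectangulation reached. The visited sequence is denoted $J(\mathcal C_n)$. **Algorithm M.** It maintains $R\in\mathcal R_n$ and arrays $o=(o_1,\dots,o_n)$, $s=(s_1,\dots,s_n)$. M1. Set $R\gets\mathrm{id}_n$, and $o_j\gets$ left, $s_j\gets j$ for $j=1,\dots,n$. M2. Visit $R$. M3. Set $j\gets s_n$; terminate if $j=1$. M4. Perform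 in $R$ a jump of $r_j$ to an element of $\mathcal C_n$ that is minimal with respect to $\mathcal C_n$, in direction $o_j$. M5. Set $s_n\gets n$. If $o_j$ is left and $R^{[j]}$ is bottom-based, or $o_j$ is right and $R^{[j]}$ is right-based, then reverse $o_j$, set $s_j\gets s_{j-1}$ and then $s_{j-1}\gets j-1$. Go back to M2. **Theorem.** For every $n\ge 1$ and every zigzag set $\mathcal C_n\subseteq\mathcal R_n$, Algorithm M terminates and visits every rectangulation of $\mathcal C_n$ exactly once (and no others), in the order $J(\mathcal C_n)$ in which Algorithm J visits them. -/

import Mathlib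

namespace Rectangulations

/-! ### Drawings of generic rectangulations -/

/-- An axis-aligned box `[x₁, x₂] × [y₁, y₂]`; the `y`-axis points upwards. -/
@[ext] structure Box where
  x₁ : ℝ
  x₂ : ℝ
  y₁ : ℝ
  y₂ : ℝ

/-- The closed point set of a box. -/
def Box.closedSet (b : Box) : Set (ℝ × ℝ) := Set.Icc b.x₁ b.x₂ ×ˢ Set.Icc b.y₁ b.y₂

/-- The open interior of a box. -/
def Box.openSet (b : Box) : Set (ℝ × ℝ) := Set.Ioo b.x₁ b.x₂ ×ˢ Set.Ioo b.y₁ b.y₂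

/-- A box with non-empty interior, that is, a rectangle. -/
def Box.Proper (b : Box) : Prop := b.x₁ < b.x₂ ∧ b.y₁ < b.y₂

/-- A concrete generic rectangulation with `n` rectangles: a partition of the rectangle `outer`
into `n` interior-disjoint axis-aligned rectangles, no four of which have a point in common. -/
structure Drawing (n : ℕ) where
  outer : Box
  rect : Fin n → Box
  outer_proper : outer.Proper
  rect_proper : ∀ i, (rect i).Proper
  cover : ⋃ i, (rect i).closedSet = outer.closedSet
  disjoint : ∀ i j, i ≠ j → Disjoint (rect i).openSet (rect j).openSet
  generic : ∀ p : ℝ × ℝ, {i | p ∈ (rect i).closedSet}.ncard ≤ 3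

namespace Drawing

variable {n : ℕ}

/-- Rectangle `i` is left of rectangle `j`: the right side of `i` meets the left side of `j`
in a segment. -/
def LeftOf (D : Drawing n) (i j : Fin n) : Prop :=
  (D.rect i).x₂ = (D.rect j).x₁ ∧ (D.rect i).y₁ < (D.rect j).y₂ ∧ (D.rect j).y₁ < (D.rect i).y₂

/-- Rectangle `i` is below rectangle `j`: the top side of `i` meets the bottom side of `j`
in a segment. -/
def BelowOf (D : Drawing n) (i j : Fin n) : Prop :=
  (D.rect i).y₂ = (D.rect j).y₁ ∧ (D.rect i).x₁ < (D.rect j).x₂ ∧ (D.rect j).x₁ < (D.rect i).x₂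

/-- Two drawings are equivalent if some bijection between their rectangles preserves the
left/right and the below/above relations. -/
def Equivalent (D D' : Drawing n) : Prop :=
  ∃ σ : Equiv.Perm (Fin n), ∀ i j,
    (D.LeftOf i j ↔ D'.LeftOf (σ i) (σ j)) ∧ (D.BelowOf i j ↔ D'.BelowOf (σ i) (σ j))

theorem equivalent_equivalence : Equivalence (@Equivalent n) where
  refl _ := ⟨Equiv.refl _, fun _ _ => ⟨Iff.rfl, Iff.rfl⟩⟩
  symm := by
    rintro D D' ⟨σ, h⟩
    refine ⟨σ.symm, fun i j => ?_⟩
    have := h (σ.symm i) (σ.symm j)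
    simp only [Equiv.apply_symm_apply] at this
    exact ⟨this.1.symm, this.2.symm⟩
  trans := by
    rintro D D' D'' ⟨σ, h⟩ ⟨τ, k⟩
    exact ⟨σ.trans τ, fun i j => ⟨(h i j).1.trans (k (σ i) (σ j)).1,
      (h i j).2.trans (k (σ i) (σ j)).2⟩⟩

instance instSetoid (n : ℕ) : Setoid (Drawing n) := ⟨Equivalent, equivalent_equivalence⟩

/-! ### Vertices and their types -/

/-- The point `(x, y)` is a vertex, that is, a corner of some rectangle. -/
def IsVertex (D : Drawing n) (x y : ℝ) : Prop :=
  ∃ i, (x = (D.rect i).x₁ ∨ x = (D.rect i).x₂) ∧ (y = (D.rect i).y₁ ∨ y = (D.rect i).y₂)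

/-- Some side of a rectangle leaves the point `(x, y)` upwards. -/
def EdgeUp (D : Drawing n) (x y : ℝ) : Prop :=
  ∃ i, (x = (D.rect i).x₁ ∨ x = (D.rect i).x₂) ∧ (D.rect i).y₁ ≤ y ∧ y < (D.rect i).y₂

/-- Some side of a rectangle leaves the point `(x, y)` downwards. -/
def EdgeDown (D : Drawing n) (x y : ℝ) : Prop :=
  ∃ i, (x = (D.rect i).x₁ ∨ x = (D.rect i).x₂) ∧ (D.rect i).y₁ < y ∧ y ≤ (D.rect i).y₂

/-- Some side of a rectangle leaves the point `(x, y)` to the right. -/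
def EdgeRight (D : Drawing n) (x y : ℝ) : Prop :=
  ∃ i, (y = (D.rect i).y₁ ∨ y = (D.rect i).y₂) ∧ (D.rect i).x₁ ≤ x ∧ x < (D.rect i).x₂

/-- Some side of a rectangle leaves the point `(x, y)` to the left. -/
def EdgeLeft (D : Drawing n) (x y : ℝ) : Prop :=
  ∃ i, (y = (D.rect i).y₁ ∨ y = (D.rect i).y₂) ∧ (D.rect i).x₁ < x ∧ x ≤ (D.rect i).x₂

/-- The T-joint at `(x, y)` has the shape `⊢`. -/
def TypeRight (D : Drawing n) (x y : ℝ) : Prop :=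
  D.EdgeUp x y ∧ D.EdgeDown x y ∧ D.EdgeRight x y ∧ ¬ D.EdgeLeft x y

/-- The T-joint at `(x, y)` has the shape `⊤`. -/
def TypeBottom (D : Drawing n) (x y : ℝ) : Prop :=
  D.EdgeLeft x y ∧ D.EdgeRight x y ∧ D.EdgeDown x y ∧ ¬ D.EdgeUp x y

/-! ### Deletion -/

/-- `r` is the rectangle in the bottom-right corner. -/
def IsBottomRight (D : Drawing n) (r : Fin n) : Prop :=
  (D.rect r).x₂ = D.outer.x₂ ∧ (D.rect r).y₁ = D.outer.y₁

open Classical in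
/-- `D'` is obtained from `D` by deleting the bottom-right rectangle `r`. If the top-left vertex
of `r` has shape `⊢`, the top side of `r` slides down onto the bottom side of `r`, so all
rectangles above `r` are extended downwards. If it has shape `⊤`, the left side of `r` slides
right onto the right side of `r`, so all rectangles left of `r` are extended to the right. -/
def DeletesTo (D : Drawing (n + 1)) (D' : Drawing n) : Prop :=
  ∃ r, D.IsBottomRight r ∧ D'.outer = D.outer ∧
    ((D.TypeRight (D.rect r).x₁ (D.rect r).y₂ ∧
        ∀ i, D'.rect i =
          if D.BelowOf r (r.succAbove i) then
            { D.rect (r.succAbove i) with y₁ := (D.rect r).y₁ }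
          else D.rect (r.succAbove i)) ∨
      (D.TypeBottom (D.rect r).x₁ (D.rect r).y₂ ∧
        ∀ i, D'.rect i =
          if D.LeftOf (r.succAbove i) r then
            { D.rect (r.succAbove i) with x₂ := (D.rect r).x₂ }
          else D.rect (r.succAbove i)))

end Drawing

/-! ### Insertion points -/

/-- A vertical segment `{x} × [a, b]` or a horizontal segment `[a, b] × {y}`. -/
inductive Segment where
  | vert (x a b : ℝ)
  | horiz (y a b : ℝ)

/-- Vertical segments come first, sorted lexicographically by `(x, y)`; they are followed by the
horizontal ones, sorted lexicographically by `(y, x)`. -/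
def Segment.Le : Segment → Segment → Prop
  | .vert x a _, .vert x' a' _ => x < x' ∨ (x = x' ∧ a ≤ a')
  | .vert _ _ _, .horiz _ _ _ => True
  | .horiz _ _ _, .vert _ _ _ => False
  | .horiz y a _, .horiz y' a' _ => y < y' ∨ (y = y' ∧ a ≤ a')

namespace Drawing

variable {n : ℕ}

/-- The edges that carry an insertion point (one insertion point per edge, anywhere in its
interior): the edges on the left side of a rectangle touching the bottom boundary, and the edges
on the top side of a rectangle touching the right boundary. -/
def IsInsertionEdge (D : Drawing n) : Segment → Prop
  | .vert x a b =>
      a < b ∧ D.IsVertex x a ∧ D.IsVertex x b ∧ (∀ c, a < c → c < b → ¬ D.IsVertex x c) ∧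
      ∃ s, (D.rect s).y₁ = D.outer.y₁ ∧ (D.rect s).x₁ = x ∧
        (D.rect s).y₁ ≤ a ∧ b ≤ (D.rect s).y₂
  | .horiz y a b =>
      a < b ∧ D.IsVertex a y ∧ D.IsVertex b y ∧ (∀ c, a < c → c < b → ¬ D.IsVertex c y) ∧
      ∃ s, (D.rect s).x₂ = D.outer.x₂ ∧ (D.rect s).y₂ = y ∧
        (D.rect s).x₁ ≤ a ∧ b ≤ (D.rect s).x₂

/-- The (1-based) index of the insertion point on the edge `e`. -/
noncomputable def insertionIndex (D : Drawing n) (e : Segment) : ℕ :=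
  {e' | D.IsInsertionEdge e' ∧ e'.Le e}.ncard

/-- The number of insertion points. -/
noncomputable def insertionCount (D : Drawing n) : ℕ :=
  {e | D.IsInsertionEdge e}.ncard

/-! ### Insertion -/

open Classical in
/-- `D'` is obtained from `D` by inserting a new rectangle into the bottom-right corner whose
top-left corner is an interior point of `e`. For a vertical `e` the new rectangle pushes up the
bottom sides of all rectangles that touch the bottom boundary and lie to the right of `e`; for a
horizontal `e` it pushes to the left the right sides of all rectangles that touch the right
boundary and lie below `e`. Since `D'` has to be a drawing again, this needs a representative `D`
in which those rectangles are high (wide) enough. In `D'` the new rectangle then has exactly the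
pushed rectangles above it (to its left), and exactly the rectangles that touch the wall
through `e` below (to the right of) the chosen point to its left (above it). -/
def InsertsTo (D : Drawing n) : Segment → Drawing (n + 1) → Prop
  | .vert x a b, D' => ∃ y, a < y ∧ y < b ∧ D'.outer = D.outer ∧
      D'.rect (Fin.last n) = ⟨x, D.outer.x₂, D.outer.y₁, y⟩ ∧
      ∀ i : Fin n, D'.rect i.castSucc =
        if (D.rect i).y₁ = D.outer.y₁ ∧ x ≤ (D.rect i).x₁ then { D.rect i with y₁ := y }
        else D.rect i
  | .horiz y a b, D' => ∃ x, a < x ∧ x < b ∧ D'.outer = D.outer ∧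
      D'.rect (Fin.last n) = ⟨x, D.outer.x₂, D.outer.y₁, y⟩ ∧
      ∀ i : Fin n, D'.rect i.castSucc =
        if (D.rect i).x₂ = D.outer.x₂ ∧ (D.rect i).y₂ ≤ y then { D.rect i with x₂ := x }
        else D.rect i

/-- Some rectangle has the entire bottom boundary as its bottom side. -/
def BottomBased (D : Drawing n) : Prop :=
  ∃ i, (D.rect i).y₁ = D.outer.y₁ ∧ (D.rect i).x₁ = D.outer.x₁ ∧ (D.rect i).x₂ = D.outer.x₂

/-- Some rectangle has the entire right boundary as its right side. -/
def RightBased (D : Drawing n) : Prop :=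
  ∃ i, (D.rect i).x₂ = D.outer.x₂ ∧ (D.rect i).y₁ = D.outer.y₁ ∧ (D.rect i).y₂ = D.outer.y₂

/-- The drawing with `n` unit-width vertical strips `[i, i + 1] × [0, 1]`, from left to right. -/
def strips (n : ℕ) [NeZero n] : Drawing n where
  outer := ⟨0, n, 0, 1⟩
  rect i := ⟨i, i + 1, 0, 1⟩
  outer_proper := ⟨by simpa using Nat.pos_of_ne_zero (NeZero.ne n), by norm_num⟩
  rect_proper i := ⟨by simp, by norm_num⟩
  cover := by
    ext ⟨x, y⟩
    simp only [Set.mem_iUnion, Box.closedSet, Set.mem_prod, Set.mem_Icc]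
    constructor
    · rintro ⟨i, ⟨h1, h2⟩, h3⟩
      have hi : ((i : ℕ) : ℝ) + 1 ≤ n := by exact_mod_cast i.2
      have h0 : (0 : ℝ) ≤ ((i : ℕ) : ℝ) := Nat.cast_nonneg _
      exact ⟨⟨by linarith, by linarith⟩, h3⟩
    · rintro ⟨⟨h1, h2⟩, h3⟩
      rcases h2.lt_or_eq with h | h
      · exact ⟨⟨⌊x⌋₊, (Nat.floor_lt h1).2 h⟩, ⟨Nat.floor_le h1, (Nat.lt_floor_add_one x).le⟩, h3⟩
      · have hn : 1 ≤ n := Nat.pos_of_ne_zero (NeZero.ne n)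
        refine ⟨⟨n - 1, by omega⟩, ⟨?_, ?_⟩, h3⟩ <;> push_cast [Nat.cast_sub hn] <;> linarith
  disjoint := by
    intro i j hij
    rw [Set.disjoint_left]
    rintro ⟨x, y⟩ ⟨⟨h1, h2⟩, -⟩ ⟨⟨h3, h4⟩, -⟩
    simp only at h1 h2 h3 h4
    have h5 : ((i : ℕ) : ℝ) < ((j : ℕ) : ℝ) + 1 := by linarith
    have h6 : ((j : ℕ) : ℝ) < ((i : ℕ) : ℝ) + 1 := by linarith
    have h7 : (i : ℕ) < j + 1 := by exact_mod_cast h5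
    have h8 : (j : ℕ) < i + 1 := by exact_mod_cast h6
    exact hij (Fin.ext (by omega))
  generic := by
    rintro ⟨x, y⟩
    have key : Set.InjOn (fun i : Fin n => ((i : ℕ) : ℤ))
        {i : Fin n | (x, y) ∈ Box.closedSet ⟨i, i + 1, 0, 1⟩} :=
      fun a _ b _ h => Fin.ext (by simpa using h)
    rw [← key.ncard_image]
    refine (Set.ncard_le_ncard (t := (Finset.Icc (⌈x⌉ - 1) (⌈x⌉ + 1) : Finset ℤ)) ?_
      (Finset.finite_toSet _)).trans ?_
    · rintro _ ⟨i, ⟨⟨h1, h2⟩, -⟩, rfl⟩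
      simp only at h1 h2
      have h3 : ((i : ℕ) : ℤ) < ⌈x⌉ + 1 := by
        have := Int.le_ceil x
        have h : (((i : ℕ) : ℤ) : ℝ) < ((⌈x⌉ + 1 : ℤ) : ℝ) := by push_cast; linarith
        exact_mod_cast h
      have h4 : ⌈x⌉ ≤ ((i : ℕ) : ℤ) + 1 := Int.ceil_le.2 (by push_cast; linarith)
      simp only [Finset.coe_Icc, Set.mem_Icc]
      omega
    · rw [Set.ncard_coe_finset, Int.card_Icc]
      omega

end Drawing

/-! ### Rectangulations, parents and children -/

/-- The set of generic rectangulations with `n` rectangles: drawings up to equivalence. -/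
def Rectangulation (n : ℕ) : Type := Quotient (Drawing.instSetoid n)

/-- The class of a drawing. -/
def Drawing.toRect {n : ℕ} (D : Drawing n) : Rectangulation n := Quotient.mk _ D

/-- `n` side-by-side vertical strips. -/
def idRect (n : ℕ) [NeZero n] : Rectangulation n := (Drawing.strips n).toRect

variable {n : ℕ}

/-- `P = p(R)`: deletion of the bottom-right rectangle of `R` gives `P`. -/
def IsParent (R : Rectangulation (n + 1)) (P : Rectangulation n) : Prop :=
  ∃ (D : Drawing (n + 1)) (D' : Drawing n), D.toRect = R ∧ D'.toRect = P ∧ D.DeletesTo D'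

/-- `R = c_k(P)`: insertion at the `k`th insertion point of `P` gives `R`. -/
def IsChild (P : Rectangulation n) (k : ℕ) (R : Rectangulation (n + 1)) : Prop :=
  ∃ (D : Drawing n) (D' : Drawing (n + 1)) (e : Segment), D.toRect = P ∧ D'.toRect = R ∧
    D.IsInsertionEdge e ∧ D.insertionIndex e = k ∧ D.InsertsTo e D'

/-- `ν(P) = k`: the rectangulation `P` has exactly `k` insertion points. -/
def HasInsertionCount (P : Rectangulation n) (k : ℕ) : Prop :=
  ∃ D : Drawing n, D.toRect = P ∧ D.insertionCount = k

/-- Some rectangle of `R` has the entire bottom boundary as its bottom side. -/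
def BottomBased (R : Rectangulation n) : Prop := ∃ D : Drawing n, D.toRect = R ∧ D.BottomBased

/-- Some rectangle of `R` has the entire right boundary as its right side. -/
def RightBased (R : Rectangulation n) : Prop := ∃ D : Drawing n, D.toRect = R ∧ D.RightBased

/-- `Φ` holds for the sub-rectangulation `R^[j] = p^(n-j)(R)` formed by the first `j` rectangles
of `R`. -/
def SubSatisfies (Φ : ∀ {m : ℕ}, Rectangulation m → Prop) (j : ℕ) :
    ∀ {n : ℕ}, Rectangulation n → Prop
  | 0, R => j = 0 ∧ Φ R
  | n + 1, R => (j = n + 1 ∧ Φ R) ∨ (j < n + 1 ∧ ∃ P : Rectangulation n, IsParent R P ∧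
      SubSatisfies Φ j P)

/-- The set of parents `{p(R) | R ∈ C}`. -/
def parents (C : Set (Rectangulation (n + 1))) : Set (Rectangulation n) :=
  {P | ∃ R ∈ C, IsParent R P}

/-- Zigzag sets of rectangulations. -/
def IsZigzag : ∀ {n : ℕ}, Set (Rectangulation n) → Prop
  | 0, _ => False
  | 1, C => C = {idRect 1}
  | _ + 2, C => IsZigzag (parents C) ∧ ∀ P ∈ parents C,
      (∃ R ∈ C, IsChild P 1 R) ∧ ∃ k, HasInsertionCount P k ∧ ∃ R ∈ C, IsChild P k R

/-! ### Jumps -/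

/-- Jump directions. -/
inductive Dir where
  | left
  | right

/-- The opposite direction. -/
def Dir.opp : Dir → Dir
  | .left => .right
  | .right => .left

/-- `R'` differs from `R` by a jump of rectangle `j` by `d` steps in direction `dir`. -/
def IsJump (dir : Dir) (j d : ℕ) : ∀ {n : ℕ}, Rectangulation n → Rectangulation n → Prop
  | 0, _, _ => False
  | n + 1, R, R' => 2 ≤ j ∧ 0 < d ∧
      ((j = n + 1 ∧ ∃ (P : Rectangulation n) (k k' : ℕ), IsParent R P ∧ IsParent R' P ∧
          IsChild P k R ∧ IsChild P k' R' ∧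
          (match dir with
            | .right => k' = k + d
            | .left => k = k' + d)) ∨
        (j < n + 1 ∧ ((BottomBased R ∧ BottomBased R') ∨ (RightBased R ∧ RightBased R')) ∧
          ∃ P P' : Rectangulation n, IsParent R P ∧ IsParent R' P' ∧ IsJump dir j d P P'))

/-- `R'` is a member of `C` that differs from `R` by a jump of rectangle `j` in direction `dir`
that is minimal with respect to `C`: no jump of rectangle `j` in the same direction by fewer steps
leads from `R` into `C`. -/
def IsMinJump (C : Set (Rectangulation n)) (dir : Dir) (j : ℕ) (R R' : Rectangulation n) : Prop :=
  R' ∈ C ∧ ∃ d, IsJump dir j d R R' ∧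
    ∀ d' < d, ∀ R'' ∈ C, ¬ IsJump dir j d' R R''

/-! ### The greedy algorithm J -/

/-- After the rectangulations in `visited`, with `R` the most recent one, a minimal jump of
rectangle `j` in direction `dir` leads to the unvisited rectangulation `R'` in `C`. -/
def GreedyCandidate (C : Set (Rectangulation n)) (visited : List (Rectangulation n))
    (R : Rectangulation n) (dir : Dir) (j : ℕ) (R' : Rectangulation n) : Prop :=
  IsMinJump C dir j R R' ∧ R' ∉ visited

/-- Step J2 visits `R'` next: the rectangle that jumps has the largest possible index, and the
jump direction is not ambiguous. -/
def GreedyStep (C : Set (Rectangulation n)) (visited : List (Rectangulation n))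
    (R R' : Rectangulation n) : Prop :=
  ∃ dir j, GreedyCandidate C visited R dir j R' ∧
    ∀ dir' j' R'', GreedyCandidate C visited R dir' j' R'' → j' ≤ j ∧ (j' = j → dir' = dir)

/-- `GreedyRun C l R`: started at the vertical strips, the algorithm can visit the sequence `l`,
whose last entry is `R`. -/
inductive GreedyRun [NeZero n] (C : Set (Rectangulation n)) :
    List (Rectangulation n) → Rectangulation n → Prop
  | init : GreedyRun C [idRect n] (idRect n)
  | step {l : List (Rectangulation n)} {R R' : Rectangulation n} :
      GreedyRun C l R → GreedyStep C l R R' → GreedyRun C (l ++ [R']) R'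

/-- `l` is a sequence of rectangulations visited by the greedy algorithm up to termination. -/
def IsGreedySequence [NeZero n] (C : Set (Rectangulation n)) (l : List (Rectangulation n)) :
    Prop :=
  ∃ R, GreedyRun C l R ∧ ∀ R', ¬ GreedyStep C l R R'

/-! ### The memoryless algorithm M -/

/-- The variables of the memoryless algorithm: the current rectangulation and the arrays
`o = (o_1, …, o_n)` and `s = (s_1, …, s_n)`. Array entries outside `1, …, n` are irrelevant. -/
structure State (n : ℕ) where
  R : Rectangulation n
  o : ℕ → Dir
  s : ℕ → ℕ

/-- Line M1. -/
def State.init (n : ℕ) [NeZero n] : State n where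
  R := idRect n
  o _ := .left
  s j := j

/-- Line M3: the algorithm terminates when the selected index `s_n` is `1`. -/
def State.Halted (S : State n) : Prop := S.s n = 1

open Classical in
/-- Lines M3 (without termination), M4 and M5. -/
def MemorylessStep (C : Set (Rectangulation n)) (S S' : State n) : Prop :=
  let j := S.s n
  let flip : Prop :=
    (S.o j = .left ∧ SubSatisfies BottomBased j S'.R) ∨
      (S.o j = .right ∧ SubSatisfies RightBased j S'.R)
  let s₁ : ℕ → ℕ := Function.update S.s n n
  ¬ S.Halted ∧ IsMinJump C (S.o j) j S.R S'.R ∧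
    S'.o = (if flip then Function.update S.o j (S.o j).opp else S.o) ∧
    S'.s = (if flip then Function.update (Function.update s₁ j (s₁ (j - 1))) (j - 1) (j - 1)
      else s₁)

/-- `MemorylessRun C l S`: the algorithm can visit the sequence `l`, and its variables have the
values `S` when the last entry of `l` is visited in line M2. -/
inductive MemorylessRun [NeZero n] (C : Set (Rectangulation n)) :
    List (Rectangulation n) → State n → Prop
  | init : MemorylessRun C [idRect n] (State.init n)
  | step {l : List (Rectangulation n)} {S S' : State n} :
      MemorylessRun C l S → MemorylessStep C S S' → MemorylessRun C (l ++ [S'.R]) S'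

end Rectangulations

/-! The visited sequence is built by induction on `n`. In the sequence for the set of parents, each
rectangulation `P` is replaced by the block of its children in `C`, sorted by child index and
traversed alternately in direction left and right, beginning with left. By the zigzag condition each
block contains the bottom-based child, which has index 1, and the right-based child, which has index
`ν(P)`. A block traversed to the left therefore ends with a bottom-based child, and the next block,
traversed to the right, starts with a bottom-based child; the same holds with left and right,
bottom-based and right-based exchanged. So the passage from block to block is a jump of an earlier
rectangle while the last one stays at an extreme position, and it is minimal in `C` exactly when the
jump between the parents is minimal (`isMinJump_of_lt_iff`).

Algorithm J follows this order. Inside a block the last rectangle jumps forward to the next child,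
while its backward jump only reaches visited children, so the step is forced and unambiguous. At the
end of a block all children of `P` have been visited, and the remaining candidates are lifts of the
candidates for the parents (`greedyStep_expandList`).

Algorithm M follows it as well. Its state within a block is the state `S` of the parent run together
with an entry `n` in `s_n` and the current direction in `o_n`. At the last child of the block `s_n`
receives the parent's selected index, so that the next step imitates the step of the parent run
(`KidList.isChain_block`, `forcedStep_lastState`). `IsTrace` collects what both algorithms need, and
`exists_isTrace` is the induction.

The geometric half shows that insertion and deletion, defined by coordinates, act on equivalence
classes and are inverse to each other. Everything is rewritten in terms of the two relations:
contact with a boundary is the absence of neighbours, and the order of rectangles with overlapping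
projections is the transitive closure of a relation (`transGen_leftOf_iff`). Insertion edges become
pairs of rectangles (`isInsertionEdge_iff`). The relations after an insertion determine, and are
determined by, the old relations together with such a pair (`VInsert.extend`, `VInsert.restrict`).
Horizontal insertions are reduced to vertical ones by a reflection. Existence of a child for every
index is not needed: the zigzag condition supplies the children that matter. -/

open Filter Topology Relation

namespace Rectangulations

namespace Drawing

variable {n : ℕ}

/-! ### Elementary geometry of drawings -/

theorem lt_x (D : Drawing n) (i : Fin n) : (D.rect i).x₁ < (D.rect i).x₂ := (D.rect_proper i).1

theorem lt_y (D : Drawing n) (i : Fin n) : (D.rect i).y₁ < (D.rect i).y₂ := (D.rect_proper i).2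

theorem closedSet_subset (D : Drawing n) (i : Fin n) :
    (D.rect i).closedSet ⊆ D.outer.closedSet :=
  D.cover ▸ Set.subset_iUnion (fun i => (D.rect i).closedSet) i

theorem rect_subset (D : Drawing n) (i : Fin n) :
    D.outer.x₁ ≤ (D.rect i).x₁ ∧ (D.rect i).x₂ ≤ D.outer.x₂ ∧
      D.outer.y₁ ≤ (D.rect i).y₁ ∧ (D.rect i).y₂ ≤ D.outer.y₂ := by
  have hx := (D.lt_x i).le
  have hy := (D.lt_y i).le
  have h1 : ((D.rect i).x₁, (D.rect i).y₁) ∈ D.outer.closedSet :=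
    D.closedSet_subset i ⟨⟨le_rfl, hx⟩, ⟨le_rfl, hy⟩⟩
  have h2 : ((D.rect i).x₂, (D.rect i).y₂) ∈ D.outer.closedSet :=
    D.closedSet_subset i ⟨⟨hx, le_rfl⟩, ⟨hy, le_rfl⟩⟩
  exact ⟨h1.1.1, h2.1.2, h1.2.1, h2.2.2⟩

theorem outer_le_x₁ (D : Drawing n) (i : Fin n) : D.outer.x₁ ≤ (D.rect i).x₁ := (D.rect_subset i).1
theorem x₂_le_outer (D : Drawing n) (i : Fin n) : (D.rect i).x₂ ≤ D.outer.x₂ :=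
  (D.rect_subset i).2.1
theorem outer_le_y₁ (D : Drawing n) (i : Fin n) : D.outer.y₁ ≤ (D.rect i).y₁ :=
  (D.rect_subset i).2.2.1
theorem y₂_le_outer (D : Drawing n) (i : Fin n) : (D.rect i).y₂ ≤ D.outer.y₂ :=
  (D.rect_subset i).2.2.2

/-- The interiors of two boxes are disjoint unless both coordinate projections overlap. -/
theorem disjoint_openSet_iff (b c : Box) : Disjoint b.openSet c.openSet ↔
    ¬ ((b.x₁ < b.x₂ ∧ b.x₁ < c.x₂ ∧ c.x₁ < b.x₂ ∧ c.x₁ < c.x₂) ∧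
      (b.y₁ < b.y₂ ∧ b.y₁ < c.y₂ ∧ c.y₁ < b.y₂ ∧ c.y₁ < c.y₂)) := by
  unfold Box.openSet
  rw [Set.disjoint_prod, Set.Ioo_disjoint_Ioo, Set.Ioo_disjoint_Ioo]
  simp only [min_le_iff, le_max_iff]
  simp only [← not_lt]
  tauto

/-- The workhorse of the geometric half: most contradictions below arise from two rectangles that
would share interior points and hence coincide. -/
theorem eq_of_overlap (D : Drawing n) {i j : Fin n} (h1 : (D.rect i).x₁ < (D.rect j).x₂)
    (h2 : (D.rect j).x₁ < (D.rect i).x₂) (h3 : (D.rect i).y₁ < (D.rect j).y₂)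
    (h4 : (D.rect j).y₁ < (D.rect i).y₂) : i = j := by
  by_contra h
  exact (disjoint_openSet_iff _ _).1 (D.disjoint i j h)
    ⟨⟨D.lt_x i, h1, h2, D.lt_x j⟩, ⟨D.lt_y i, h3, h4, D.lt_y j⟩⟩

theorem exists_of_mem_outer (D : Drawing n) {x y : ℝ}
    (hx : D.outer.x₁ ≤ x ∧ x ≤ D.outer.x₂) (hy : D.outer.y₁ ≤ y ∧ y ≤ D.outer.y₂) :
    ∃ i, ((D.rect i).x₁ ≤ x ∧ x ≤ (D.rect i).x₂) ∧ (D.rect i).y₁ ≤ y ∧ y ≤ (D.rect i).y₂ := by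
  have h : (x, y) ∈ D.outer.closedSet := ⟨hx, hy⟩
  rw [← D.cover, Set.mem_iUnion] at h
  exact h

theorem eventually_add_lt {a b : ℝ} (h : a < b) : ∀ᶠ ε in 𝓝[>] (0 : ℝ), a + ε < b := by
  have h1 : Tendsto (fun ε : ℝ => a + ε) (𝓝[>] 0) (𝓝 (a + 0)) :=
    (Continuous.tendsto (by fun_prop) _).mono_left nhdsWithin_le_nhds
  rw [add_zero] at h1
  exact h1.eventually (gt_mem_nhds h)

theorem eventually_lt_sub {a b : ℝ} (h : a < b) : ∀ᶠ ε in 𝓝[>] (0 : ℝ), a < b - ε := by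
  filter_upwards [eventually_add_lt h] with ε hε
  linarith

theorem eventually_pos : ∀ᶠ ε in 𝓝[>] (0 : ℝ), 0 < ε := self_mem_nhdsWithin

/-- The rectangle that contains the germ to the upper right of a point. -/
theorem exists_upper_right (D : Drawing n) {x y : ℝ}
    (hx : D.outer.x₁ ≤ x ∧ x < D.outer.x₂) (hy : D.outer.y₁ ≤ y ∧ y < D.outer.y₂) :
    ∃ i, ((D.rect i).x₁ ≤ x ∧ x < (D.rect i).x₂) ∧ (D.rect i).y₁ ≤ y ∧ y < (D.rect i).y₂ := by
  by_contra! h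
  -- There are finitely many rectangles, so a single small `ε` works for all of them: a rectangle
  -- without the germ misses the shifted point.
  have h1 : ∀ᶠ ε in 𝓝[>] (0 : ℝ), ∀ i, ¬ (((D.rect i).x₁ ≤ x + ε ∧ x + ε ≤ (D.rect i).x₂) ∧
      (D.rect i).y₁ ≤ y + ε ∧ y + ε ≤ (D.rect i).y₂) := by
    rw [eventually_all]
    intro i
    by_cases c1 : x < (D.rect i).x₁
    · filter_upwards [eventually_add_lt c1] with ε hε hc
      linarith [hc.1.1]
    by_cases c2 : y < (D.rect i).y₁
    · filter_upwards [eventually_add_lt c2] with ε hε hc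
      linarith [hc.2.1]
    filter_upwards [eventually_pos] with ε hε hc
    have := h i ⟨not_lt.1 c1, by linarith [hc.1.2]⟩ (not_lt.1 c2)
    linarith [hc.2.2]
  obtain ⟨ε, ⟨⟨h1, h2⟩, h3⟩, h0⟩ := ((h1.and (eventually_add_lt hx.2)).and
    (eventually_add_lt hy.2)|>.and eventually_pos).exists
  obtain ⟨i, hi⟩ := D.exists_of_mem_outer (x := x + ε) (y := y + ε) ⟨by linarith, h2.le⟩
    ⟨by linarith, h3.le⟩
  exact h1 i hi

/-- The rectangle that contains the germ to the upper left of a point. -/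
theorem exists_upper_left (D : Drawing n) {x y : ℝ}
    (hx : D.outer.x₁ < x ∧ x ≤ D.outer.x₂) (hy : D.outer.y₁ ≤ y ∧ y < D.outer.y₂) :
    ∃ i, ((D.rect i).x₁ < x ∧ x ≤ (D.rect i).x₂) ∧ (D.rect i).y₁ ≤ y ∧ y < (D.rect i).y₂ := by
  by_contra! h
  have h1 : ∀ᶠ ε in 𝓝[>] (0 : ℝ), ∀ i, ¬ (((D.rect i).x₁ ≤ x - ε ∧ x - ε ≤ (D.rect i).x₂) ∧
      (D.rect i).y₁ ≤ y + ε ∧ y + ε ≤ (D.rect i).y₂) := by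
    rw [eventually_all]
    intro i
    by_cases c1 : (D.rect i).x₂ < x
    · filter_upwards [eventually_lt_sub c1] with ε hε hc
      linarith [hc.1.2]
    by_cases c2 : y < (D.rect i).y₁
    · filter_upwards [eventually_add_lt c2] with ε hε hc
      linarith [hc.2.1]
    filter_upwards [eventually_pos] with ε hε hc
    have := h i ⟨by linarith [hc.1.1], not_lt.1 c1⟩ (not_lt.1 c2)
    linarith [hc.2.2]
  obtain ⟨ε, ⟨⟨h1, h2⟩, h3⟩, h0⟩ := ((h1.and (eventually_lt_sub hx.1)).and
    (eventually_add_lt hy.2)|>.and eventually_pos).exists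
  obtain ⟨i, hi⟩ := D.exists_of_mem_outer (x := x - ε) (y := y + ε) ⟨h2.le, by linarith⟩
    ⟨by linarith, h3.le⟩
  exact h1 i hi

/-- The rectangle that contains the germ to the lower right of a point. -/
theorem exists_lower_right (D : Drawing n) {x y : ℝ}
    (hx : D.outer.x₁ ≤ x ∧ x < D.outer.x₂) (hy : D.outer.y₁ < y ∧ y ≤ D.outer.y₂) :
    ∃ i, ((D.rect i).x₁ ≤ x ∧ x < (D.rect i).x₂) ∧ (D.rect i).y₁ < y ∧ y ≤ (D.rect i).y₂ := by
  by_contra! h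
  have h1 : ∀ᶠ ε in 𝓝[>] (0 : ℝ), ∀ i, ¬ (((D.rect i).x₁ ≤ x + ε ∧ x + ε ≤ (D.rect i).x₂) ∧
      (D.rect i).y₁ ≤ y - ε ∧ y - ε ≤ (D.rect i).y₂) := by
    rw [eventually_all]
    intro i
    by_cases c1 : x < (D.rect i).x₁
    · filter_upwards [eventually_add_lt c1] with ε hε hc
      linarith [hc.1.1]
    by_cases c2 : (D.rect i).y₂ < y
    · filter_upwards [eventually_lt_sub c2] with ε hε hc
      linarith [hc.2.2]
    filter_upwards [eventually_pos] with ε hε hc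
    have := h i ⟨not_lt.1 c1, by linarith [hc.1.2]⟩ (by linarith [hc.2.1])
    linarith
  obtain ⟨ε, ⟨⟨h1, h2⟩, h3⟩, h0⟩ := ((h1.and (eventually_add_lt hx.2)).and
    (eventually_lt_sub hy.1)|>.and eventually_pos).exists
  obtain ⟨i, hi⟩ := D.exists_of_mem_outer (x := x + ε) (y := y - ε) ⟨by linarith, h2.le⟩
    ⟨h3.le, by linarith⟩
  exact h1 i hi

/-! ### Reflection in the antidiagonal -/

/-- Reflection `(x, y) ↦ (-y, -x)` of a box. -/
def _root_.Rectangulations.Box.anti (b : Box) : Box := ⟨-b.y₂, -b.y₁, -b.x₂, -b.x₁⟩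

theorem mem_anti_closedSet (b : Box) (p : ℝ × ℝ) :
    p ∈ b.anti.closedSet ↔ (-p.2, -p.1) ∈ b.closedSet := by
  simp only [Box.closedSet, Box.anti, Set.mem_prod, Set.mem_Icc]
  constructor <;> rintro ⟨⟨h1, h2⟩, h3, h4⟩ <;> refine ⟨⟨?_, ?_⟩, ?_, ?_⟩ <;> linarith

/-- Reflection `(x, y) ↦ (-y, -x)` of a drawing. -/
def anti (D : Drawing n) : Drawing n where
  outer := D.outer.anti
  rect i := (D.rect i).anti
  outer_proper := ⟨neg_lt_neg D.outer_proper.2, neg_lt_neg D.outer_proper.1⟩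
  rect_proper i := ⟨neg_lt_neg (D.lt_y i), neg_lt_neg (D.lt_x i)⟩
  cover := by
    ext p
    simp only [Set.mem_iUnion, mem_anti_closedSet]
    rw [← D.cover, Set.mem_iUnion]
  disjoint := by
    intro i j hij
    have := D.disjoint i j hij
    rw [disjoint_openSet_iff] at this ⊢
    simp only [Box.anti, neg_lt_neg_iff]
    tauto
  generic p := by
    simp only [mem_anti_closedSet]
    exact D.generic _

@[simp] theorem anti_x₁ (D : Drawing n) (i) : (D.anti.rect i).x₁ = -(D.rect i).y₂ := rfl
@[simp] theorem anti_x₂ (D : Drawing n) (i) : (D.anti.rect i).x₂ = -(D.rect i).y₁ := rfl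
@[simp] theorem anti_y₁ (D : Drawing n) (i) : (D.anti.rect i).y₁ = -(D.rect i).x₂ := rfl
@[simp] theorem anti_y₂ (D : Drawing n) (i) : (D.anti.rect i).y₂ = -(D.rect i).x₁ := rfl
@[simp] theorem anti_outer_x₁ (D : Drawing n) : D.anti.outer.x₁ = -D.outer.y₂ := rfl
@[simp] theorem anti_outer_x₂ (D : Drawing n) : D.anti.outer.x₂ = -D.outer.y₁ := rfl
@[simp] theorem anti_outer_y₁ (D : Drawing n) : D.anti.outer.y₁ = -D.outer.x₂ := rfl

theorem _root_.Rectangulations.Box.anti_anti (b : Box) : b.anti.anti = b := by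
  simp [Box.anti]

theorem anti_outer (D : Drawing n) : D.anti.outer = D.outer.anti := rfl
theorem anti_rect (D : Drawing n) (i) : D.anti.rect i = (D.rect i).anti := rfl

theorem anti_anti (D : Drawing n) : D.anti.anti = D := by
  cases D
  simp [anti, Box.anti_anti]

-- The reflection fixes the bottom-right corner and exchanges the bottom with the right boundary.
-- Hence it turns horizontal insertions and deletions into vertical ones, at the price of swapping
-- the arguments of the relations.
@[simp] theorem anti_leftOf (D : Drawing n) (i j : Fin n) :
    D.anti.LeftOf i j ↔ D.BelowOf j i := by
  simp only [LeftOf, BelowOf, anti_x₁, anti_x₂, anti_y₁, anti_y₂, neg_lt_neg_iff, neg_inj]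
  grind

@[simp] theorem anti_belowOf (D : Drawing n) (i j : Fin n) :
    D.anti.BelowOf i j ↔ D.LeftOf j i := by
  simp only [LeftOf, BelowOf, anti_x₁, anti_x₂, anti_y₁, anti_y₂, neg_lt_neg_iff, neg_inj]
  grind

/-- The rectangle that contains the germ to the lower left of a point. -/
theorem exists_lower_left (D : Drawing n) {x y : ℝ}
    (hx : D.outer.x₁ < x ∧ x ≤ D.outer.x₂) (hy : D.outer.y₁ < y ∧ y ≤ D.outer.y₂) :
    ∃ i, ((D.rect i).x₁ < x ∧ x ≤ (D.rect i).x₂) ∧ (D.rect i).y₁ < y ∧ y ≤ (D.rect i).y₂ := by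
  -- The reflection carries the lower left germ to an upper right germ.
  obtain ⟨i, ⟨h1, h2⟩, h3, h4⟩ := D.anti.exists_upper_right (x := -y) (y := -x)
    ⟨neg_le_neg hy.2, neg_lt_neg hy.1⟩ ⟨neg_le_neg hx.2, neg_lt_neg hx.1⟩
  exact ⟨i, ⟨neg_lt_neg_iff.1 h4, neg_le_neg_iff.1 h3⟩, neg_lt_neg_iff.1 h2, neg_le_neg_iff.1 h1⟩

/-! ### Neighbours and chains -/

/-- If the left side of `i` is not on the boundary, the germ to the upper left of its bottom-left
corner lies in some rectangle, which must end at this side. This makes boundary contact a property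
of the relations, invariant under equivalence. -/
theorem exists_leftOf_iff (D : Drawing n) (i : Fin n) :
    (∃ j, D.LeftOf j i) ↔ D.outer.x₁ < (D.rect i).x₁ := by
  constructor
  · rintro ⟨j, h, -⟩
    rw [← h]
    exact (D.outer_le_x₁ j).trans_lt (D.lt_x j)
  · intro h
    obtain ⟨j, ⟨h1, h2⟩, h3, h4⟩ := D.exists_upper_left (x := (D.rect i).x₁) (y := (D.rect i).y₁)
      ⟨h, (D.lt_x i).le.trans (D.x₂_le_outer i)⟩
      ⟨D.outer_le_y₁ i, (D.lt_y i).trans_le (D.y₂_le_outer i)⟩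
    refine ⟨j, le_antisymm ?_ h2, h3.trans_lt (D.lt_y i), h4⟩
    by_contra! h5
    obtain rfl := D.eq_of_overlap (i := i) (j := j) h5 (h1.trans (D.lt_x i)) h4
      (h3.trans_lt (D.lt_y i))
    exact lt_irrefl _ h1

theorem exists_rightOf_iff (D : Drawing n) (i : Fin n) :
    (∃ j, D.LeftOf i j) ↔ (D.rect i).x₂ < D.outer.x₂ := by
  constructor
  · rintro ⟨j, h, -⟩
    rw [h]
    exact (D.lt_x j).trans_le (D.x₂_le_outer j)
  · intro h
    obtain ⟨j, ⟨h1, h2⟩, h3, h4⟩ := D.exists_upper_right (x := (D.rect i).x₂) (y := (D.rect i).y₁)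
      ⟨(D.outer_le_x₁ i).trans (D.lt_x i).le, h⟩
      ⟨D.outer_le_y₁ i, (D.lt_y i).trans_le (D.y₂_le_outer i)⟩
    refine ⟨j, le_antisymm ?_ h1, h4, h3.trans_lt (D.lt_y i)⟩
    by_contra! h5
    obtain rfl := D.eq_of_overlap (i := i) (j := j) ((D.lt_x i).trans h2) h5 h4
      (h3.trans_lt (D.lt_y i))
    exact lt_irrefl _ h2

theorem exists_belowOf_iff (D : Drawing n) (i : Fin n) :
    (∃ j, D.BelowOf j i) ↔ D.outer.y₁ < (D.rect i).y₁ := by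
  simpa using D.anti.exists_rightOf_iff i

theorem forall_not_leftOf_iff (D : Drawing n) (i : Fin n) :
    (∀ j, ¬ D.LeftOf j i) ↔ (D.rect i).x₁ = D.outer.x₁ := by
  rw [← not_exists, exists_leftOf_iff, not_lt, le_antisymm_iff]
  simp [D.outer_le_x₁ i]

theorem forall_not_rightOf_iff (D : Drawing n) (i : Fin n) :
    (∀ j, ¬ D.LeftOf i j) ↔ (D.rect i).x₂ = D.outer.x₂ := by
  rw [← not_exists, exists_rightOf_iff, not_lt, le_antisymm_iff]
  simp [D.x₂_le_outer i]

theorem forall_not_belowOf_iff (D : Drawing n) (i : Fin n) :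
    (∀ j, ¬ D.BelowOf j i) ↔ (D.rect i).y₁ = D.outer.y₁ := by
  rw [← not_exists, exists_belowOf_iff, not_lt, le_antisymm_iff]
  simp [D.outer_le_y₁ i]

theorem x₂_le_x₁_of_transGen {D : Drawing n} {i j : Fin n} (h : TransGen D.LeftOf i j) :
    (D.rect i).x₂ ≤ (D.rect j).x₁ := by
  induction h with
  | single h => exact h.1.le
  | tail _ h ih => exact ih.trans ((D.lt_x _).le.trans h.1.le)

/-- Two rectangles whose vertical extents overlap are joined by a chain of left-right neighbours. -/
theorem transGen_leftOf_iff (D : Drawing n) {i j : Fin n} (h1 : (D.rect i).y₁ < (D.rect j).y₂)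
    (h2 : (D.rect j).y₁ < (D.rect i).y₂) :
    TransGen D.LeftOf i j ↔ (D.rect i).x₂ ≤ (D.rect j).x₁ := by
  refine ⟨x₂_le_x₁_of_transGen, ?_⟩
  obtain ⟨y, hi, hj⟩ : ∃ y, ((D.rect i).y₁ ≤ y ∧ y < (D.rect i).y₂) ∧
      (D.rect j).y₁ ≤ y ∧ y < (D.rect j).y₂ :=
    ⟨max (D.rect i).y₁ (D.rect j).y₁, ⟨le_max_left _ _, max_lt (D.lt_y i) h2⟩,
      le_max_right _ _, max_lt h1 (D.lt_y j)⟩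
  clear h1 h2
  have wf : WellFounded (fun a b : Fin n => (D.rect a).x₁ < (D.rect b).x₁) :=
    InvImage.wf (fun a => (⟨(D.rect a).x₁, a, rfl⟩ : Set.range fun a => (D.rect a).x₁))
      (wellFounded_lt)
  -- Walk to the left along the horizontal line at height `y`: the rectangle just left of `j` at
  -- this height is either `i` or still entirely to the right of `i`. The half-open condition on `y`
  -- is preserved by each upper left germ.
  induction j using wf.induction with
  | _ j ih =>
    intro h
    obtain ⟨k, ⟨k1, k2⟩, k3, k4⟩ := D.exists_upper_left (x := (D.rect j).x₁) (y := y)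
      ⟨((D.outer_le_x₁ i).trans_lt (D.lt_x i)).trans_le h, (D.lt_x j).le.trans (D.x₂_le_outer j)⟩
      ⟨(D.outer_le_y₁ j).trans hj.1, hj.2.trans_le (D.y₂_le_outer j)⟩
    have hk : D.LeftOf k j := by
      refine ⟨le_antisymm ?_ k2, k3.trans_lt hj.2, hj.1.trans_lt k4⟩
      by_contra! h5
      obtain rfl := D.eq_of_overlap (i := j) (j := k) h5 (k1.trans (D.lt_x j)) (hj.1.trans_lt k4)
        (k3.trans_lt hj.2)
      exact lt_irrefl _ k1
    by_cases hik : i = k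
    · exact hik ▸ TransGen.single hk
    · refine (ih k k1 ⟨k3, k4⟩ ?_).tail hk
      by_contra! h5
      refine hik (D.eq_of_overlap ?_ h5 (hi.1.trans_lt k4) (k3.trans_lt hi.2))
      have := D.lt_x i
      linarith

theorem transGen_belowOf_iff (D : Drawing n) {i j : Fin n} (h1 : (D.rect i).x₁ < (D.rect j).x₂)
    (h2 : (D.rect j).x₁ < (D.rect i).x₂) :
    TransGen D.BelowOf i j ↔ (D.rect i).y₂ ≤ (D.rect j).y₁ := by
  have h := D.anti.transGen_leftOf_iff (i := j) (j := i) (by simpa using h1) (by simpa using h2)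
  have e : D.anti.LeftOf = Function.swap D.BelowOf := by
    ext a b
    simp [Function.swap]
  rw [e, transGen_swap] at h
  simpa using h

/-! ### Isomorphisms of drawings -/

/-- `σ` preserves the left/right and the below/above relations. -/
def IsIso (D D' : Drawing n) (σ : Equiv.Perm (Fin n)) : Prop :=
  ∀ i j, (D.LeftOf i j ↔ D'.LeftOf (σ i) (σ j)) ∧ (D.BelowOf i j ↔ D'.BelowOf (σ i) (σ j))

section

variable {D D' : Drawing n} {σ : Equiv.Perm (Fin n)}

theorem IsIso.symm (h : D.IsIso D' σ) : D'.IsIso D σ.symm := fun i j => by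
  have := h (σ.symm i) (σ.symm j)
  simp only [Equiv.apply_symm_apply] at this
  exact ⟨this.1.symm, this.2.symm⟩

theorem IsIso.anti (h : D.IsIso D' σ) : D.anti.IsIso D'.anti σ := fun i j => by
  simpa using ⟨(h j i).2, (h j i).1⟩

theorem IsIso.transGen_leftOf (h : D.IsIso D' σ) (i j : Fin n) :
    TransGen D.LeftOf i j ↔ TransGen D'.LeftOf (σ i) (σ j) := by
  refine ⟨fun k => k.lift σ fun a b => ((h a b).1).1, fun k => ?_⟩
  simpa [Function.onFun] using k.lift σ.symm fun a b => ((h.symm a b).1).1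

theorem IsIso.transGen_belowOf (h : D.IsIso D' σ) (i j : Fin n) :
    TransGen D.BelowOf i j ↔ TransGen D'.BelowOf (σ i) (σ j) := by
  refine ⟨fun k => k.lift σ fun a b => ((h a b).2).1, fun k => ?_⟩
  simpa [Function.onFun] using k.lift σ.symm fun a b => ((h.symm a b).2).1

theorem IsIso.no_left (h : D.IsIso D' σ) (i : Fin n) :
    (∀ j, ¬ D.LeftOf j i) ↔ ∀ j, ¬ D'.LeftOf j (σ i) := by
  rw [← σ.forall_congr_right (q := fun j => ¬ D'.LeftOf j (σ i))]
  exact forall_congr' fun j => not_congr (h j i).1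

theorem IsIso.no_right (h : D.IsIso D' σ) (i : Fin n) :
    (∀ j, ¬ D.LeftOf i j) ↔ ∀ j, ¬ D'.LeftOf (σ i) j := by
  rw [← σ.forall_congr_right (q := fun j => ¬ D'.LeftOf (σ i) j)]
  exact forall_congr' fun j => not_congr (h i j).1

theorem IsIso.no_below (h : D.IsIso D' σ) (i : Fin n) :
    (∀ j, ¬ D.BelowOf j i) ↔ ∀ j, ¬ D'.BelowOf j (σ i) := by
  simpa using h.anti.no_right i

theorem IsIso.toRect_eq (h : D.IsIso D' σ) : D.toRect = D'.toRect := Quotient.sound ⟨σ, h⟩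

theorem exists_isIso (h : D.toRect = D'.toRect) : ∃ σ, D.IsIso D' σ := Quotient.exact h

end

end Drawing

/-! ### Reflection and comparison of segments. -/

/-- Reflection `(x, y) ↦ (-y, -x)` of a segment. -/
def Segment.anti : Segment → Segment
  | .vert x a b => .horiz (-x) (-b) (-a)
  | .horiz y a b => .vert (-y) (-b) (-a)

theorem Segment.anti_anti (e : Segment) : e.anti.anti = e := by
  cases e <;> simp [Segment.anti]

theorem Segment.anti_injective : Function.Injective Segment.anti :=
  Function.LeftInverse.injective Segment.anti_anti

theorem Segment.le_refl (e : Segment) : e.Le e := by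
  cases e <;> simp [Segment.Le]

theorem Segment.le_trans {e f g : Segment} (h : e.Le f) (h' : f.Le g) : e.Le g := by
  cases e <;> cases f <;> cases g <;> simp only [Segment.Le] at * <;> grind

theorem Segment.le_total (e f : Segment) : e.Le f ∨ f.Le e := by
  cases e <;> cases f <;> simp only [Segment.Le] <;> grind

namespace Drawing

variable {n : ℕ}

/-! ### Insertion edges and their codes -/

theorem anti_isVertex (D : Drawing n) (x y : ℝ) :
    D.anti.IsVertex (-y) (-x) ↔ D.IsVertex x y := by
  simp only [IsVertex, anti_x₁, anti_x₂, anti_y₁, anti_y₂, neg_inj]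
  exact exists_congr fun i => by tauto

theorem IsInsertionEdge.anti {D : Drawing n} {e : Segment} (h : D.IsInsertionEdge e) :
    D.anti.IsInsertionEdge e.anti := by
  cases e with
  | vert x a b =>
    obtain ⟨h1, h2, h3, h4, s, h5, h6, h7, h8⟩ := h
    refine ⟨neg_lt_neg h1, (D.anti_isVertex _ _).2 h3, (D.anti_isVertex _ _).2 h2,
      fun c hc hc' => ?_, s, by simp [h5], by simp [h6], by simpa using h8, by simpa using h7⟩
    rw [← neg_neg c, anti_isVertex]
    exact h4 _ (by linarith) (by linarith)
  | horiz x a b =>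
    obtain ⟨h1, h2, h3, h4, s, h5, h6, h7, h8⟩ := h
    refine ⟨neg_lt_neg h1, (D.anti_isVertex _ _).2 h3, (D.anti_isVertex _ _).2 h2,
      fun c hc hc' => ?_, s, by simp [h5], by simp [h6], by simpa using h8, by simpa using h7⟩
    rw [← neg_neg c, anti_isVertex]
    exact h4 _ (by linarith) (by linarith)

theorem anti_isInsertionEdge (D : Drawing n) (e : Segment) :
    D.anti.IsInsertionEdge e.anti ↔ D.IsInsertionEdge e := by
  refine ⟨fun h => ?_, fun h => h.anti⟩
  simpa [anti_anti, Segment.anti_anti] using h.anti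

/-- The pair `(l, s)` describes a vertical insertion edge on the left side of `s`: either it is
the common part of this side with the right side of `l`, or `l = s` and the side is on the left
boundary. -/
def VCode (D : Drawing n) (l s : Fin n) : Prop :=
  (∀ j, ¬ D.BelowOf j s) ∧ (D.LeftOf l s ∨ (l = s ∧ ∀ j, ¬ D.LeftOf j s))

/-- The vertical insertion edge described by a pair of rectangles. -/
noncomputable def vseg (D : Drawing n) (l s : Fin n) : Segment :=
  -- Since `s` touches the bottom boundary, no maximum is needed at the lower end.
  .vert (D.rect s).x₁ (D.rect l).y₁ (min (D.rect l).y₂ (D.rect s).y₂)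

/-- The horizontal insertion edge described by a pair of rectangles. -/
noncomputable def hseg (D : Drawing n) (l s : Fin n) : Segment :=
  .horiz (D.rect s).y₂ (max (D.rect l).x₁ (D.rect s).x₁) (D.rect l).x₂

theorem anti_vseg (D : Drawing n) (l s : Fin n) : D.anti.vseg l s = (D.hseg l s).anti := by
  simp [vseg, hseg, Segment.anti, min_neg_neg]

/-- The facts about a vertical insertion edge that are used in most arguments. -/
theorem VCode.facts {D : Drawing n} {l s : Fin n} (h : D.VCode l s) :
    (D.rect s).y₁ = D.outer.y₁ ∧ (D.rect l).y₁ < (D.rect s).y₂ ∧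
      (l ≠ s → (D.rect l).x₂ = (D.rect s).x₁) ∧ (l = s → (D.rect s).x₁ = D.outer.x₁) := by
  obtain ⟨h1, h2⟩ := h
  rw [forall_not_belowOf_iff] at h1
  rw [forall_not_leftOf_iff] at h2
  refine ⟨h1, ?_, ?_, ?_⟩
  · rcases h2 with h2 | ⟨rfl, -⟩
    · exact h2.2.1
    · exact D.lt_y _
  · rcases h2 with h2 | ⟨rfl, -⟩
    · exact fun _ => h2.1
    · exact fun h => (h rfl).elim
  · rintro rfl
    rcases h2 with h2 | ⟨-, h2⟩
    · exact ((D.lt_x l).ne h2.1.symm).elim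
    · exact h2

theorem VCode.eq_of_bottom {D : Drawing n} {s t : Fin n} (hs : (D.rect s).y₁ = D.outer.y₁)
    (ht : (D.rect t).y₁ = D.outer.y₁) (h : (D.rect s).x₁ = (D.rect t).x₁) : s = t := by
  have := D.lt_x s
  have := D.lt_x t
  have := D.lt_y s
  have := D.lt_y t
  apply D.eq_of_overlap <;> linarith

theorem VCode.right_eq {D : Drawing n} {l s l' s' : Fin n} (h : D.VCode l s) (h' : D.VCode l' s')
    (hx : (D.rect s).x₁ = (D.rect s').x₁) : s = s' :=
  VCode.eq_of_bottom h.facts.1 h'.facts.1 hx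

/-- All candidates `l` for a given `s` have their right sides on the line of the left side of `s`,
so distinct ones are separated vertically; if `s` touches the left boundary, `s` itself is the only
candidate. -/
theorem VCode.trichotomy {D : Drawing n} {l l' s : Fin n} (h : D.VCode l s) (h' : D.VCode l' s) :
    l = l' ∨ (D.rect l).y₂ ≤ (D.rect l').y₁ ∨ (D.rect l').y₂ ≤ (D.rect l).y₁ := by
  have f := h.facts
  have f' := h'.facts
  by_contra! hc
  refine hc.1 (D.eq_of_overlap ?_ ?_ hc.2.2 hc.2.1)
  all_goals
    by_cases hl : l = s <;> by_cases hl' : l' = s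
    · exact (hc.1 (hl.trans hl'.symm)).elim
    · have := D.outer_le_x₁ l'
      have := D.lt_x l'
      linarith [f.2.2.2 hl, f'.2.2.1 hl']
    · have := D.outer_le_x₁ l
      have := D.lt_x l
      linarith [f'.2.2.2 hl', f.2.2.1 hl]
    · have := D.lt_x l
      have := D.lt_x l'
      linarith [f.2.2.1 hl, f'.2.2.1 hl']

/-- This makes `transGen_belowOf_iff` applicable to two candidates for the same `s`. -/
theorem VCode.overlap_x {D : Drawing n} {l l' s : Fin n} (h : D.VCode l s) (h' : D.VCode l' s) :
    (D.rect l).x₁ < (D.rect l').x₂ := by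
  have f := h.facts
  have f' := h'.facts
  have := D.lt_x l
  have := D.lt_x l'
  by_cases hl : l = s <;> by_cases hl' : l' = s
  · rw [hl, hl']
    exact D.lt_x s
  · have := D.outer_le_x₁ l'
    linarith [f.2.2.2 hl, f'.2.2.1 hl']
  · have := D.outer_le_x₁ l
    linarith [f'.2.2.2 hl', f.2.2.1 hl]
  · linarith [f.2.2.1 hl, f'.2.2.1 hl']

theorem VCode.isInsertionEdge {D : Drawing n} {l s : Fin n} (h : D.VCode l s) :
    D.IsInsertionEdge (D.vseg l s) := by
  have f := h.facts
  have hly := D.lt_y l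
  have hsy := D.lt_y s
  have hlb := D.outer_le_y₁ l
  have hlx := D.lt_x l
  have hsx := D.lt_x s
  refine ⟨lt_min hly f.2.1, ?_, ?_, ?_, s, f.1, rfl, by linarith, min_le_right _ _⟩
  · refine ⟨l, ?_, Or.inl rfl⟩
    by_cases hl : l = s
    · simp [hl]
    · exact Or.inr (f.2.2.1 hl).symm
  · rcases min_choice (D.rect l).y₂ (D.rect s).y₂ with hm | hm <;> rw [hm]
    · refine ⟨l, ?_, Or.inr rfl⟩
      by_cases hl : l = s
      · simp [hl]
      · exact Or.inr (f.2.2.1 hl).symm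
    · exact ⟨s, Or.inl rfl, Or.inr rfl⟩
  -- A corner inside the segment belongs to a rectangle on one side of the wall. That rectangle
  -- overlaps `s` or `l`, hence equals it, but `s` and `l` have no corner strictly between the two
  -- ends.
  · rintro c hc1 hc2 ⟨i, hx, hy⟩
    rw [lt_min_iff] at hc2
    have hix := D.lt_x i
    have hiy := D.lt_y i
    rcases hx with hx | hx
    · have : i = s := D.eq_of_overlap (by linarith) (by linarith)
        (by rcases hy with hy | hy <;> linarith) (by rcases hy with hy | hy <;> linarith)
      subst this
      rcases hy with hy | hy <;> linarith
    · by_cases hl : l = s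
      · have := D.outer_le_x₁ i
        linarith [f.2.2.2 hl]
      · have hlx2 := f.2.2.1 hl
        have : i = l := D.eq_of_overlap (by linarith) (by linarith)
          (by rcases hy with hy | hy <;> linarith) (by rcases hy with hy | hy <;> linarith)
        subst this
        rcases hy with hy | hy <;> linarith

/-- An inner point of the edge singles out the rectangle `l` to its left. The given edge and the
edge of the code both contain this point and have no inner vertices, so their ends agree. -/
theorem exists_vcode {D : Drawing n} {x a b : ℝ} (h : D.IsInsertionEdge (.vert x a b)) :
    ∃ l s, D.VCode l s ∧ D.vseg l s = .vert x a b := by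
  obtain ⟨hab, ha, hb, hc, s, hs, rfl, hsa, hsb⟩ := h
  obtain ⟨m, ham, hmb⟩ := exists_between hab
  have hsx := D.lt_x s
  have hsy := D.lt_y s
  suffices H : ∃ l, D.VCode l s ∧ (D.rect l).y₁ ≤ m ∧ m < (D.rect l).y₂ by
    obtain ⟨l, hl, h1, h2⟩ := H
    refine ⟨l, s, hl, ?_⟩
    obtain ⟨g1, g2, g3, g4, -⟩ := hl.isInsertionEdge
    have e1 : a = (D.rect l).y₁ := by
      rcases lt_trichotomy a (D.rect l).y₁ with h | h | h
      · exact (hc _ h (by linarith) g2).elim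
      · exact h
      · exact (g4 a h (lt_min (by linarith) (by linarith)) ha).elim
    have e2 : b = min (D.rect l).y₂ (D.rect s).y₂ := by
      rcases lt_trichotomy b (min (D.rect l).y₂ (D.rect s).y₂) with h | h | h
      · exact (g4 b (by linarith) h hb).elim
      · exact h
      · exact (hc _ (lt_min (by linarith) (by linarith)) h g3).elim
    rw [vseg, ← e1, ← e2]
  by_cases hx : D.outer.x₁ < (D.rect s).x₁
  · obtain ⟨l, ⟨l1, l2⟩, l3, l4⟩ := D.exists_upper_left (x := (D.rect s).x₁) (y := m)
      ⟨hx, (D.lt_x s).le.trans (D.x₂_le_outer s)⟩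
      ⟨(D.outer_le_y₁ s).trans (by linarith), lt_of_lt_of_le (by linarith) (D.y₂_le_outer s)⟩
    refine ⟨l, ⟨(D.forall_not_belowOf_iff s).2 hs, Or.inl ⟨le_antisymm ?_ l2, by linarith,
      by linarith⟩⟩, l3, l4⟩
    by_contra! h5
    obtain rfl := D.eq_of_overlap (i := l) (j := s) (by linarith) h5 (by linarith) (by linarith)
    linarith
  · exact ⟨s, ⟨(D.forall_not_belowOf_iff s).2 hs, Or.inr ⟨rfl, (D.forall_not_leftOf_iff s).2
      (le_antisymm (not_lt.1 hx) (D.outer_le_x₁ s))⟩⟩, by linarith, by linarith⟩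

/-- Codes of insertion edges: the Boolean tells whether the edge is vertical. -/
abbrev Code (n : ℕ) : Type := Bool × Fin n × Fin n

/-- The codes that describe insertion edges. -/
def IsCode (D : Drawing n) : Code n → Prop
  | (true, l, s) => D.VCode l s
  | (false, l, s) => D.anti.VCode l s

/-- The insertion edge described by a code. -/
noncomputable def seg (D : Drawing n) : Code n → Segment
  | (true, l, s) => D.vseg l s
  | (false, l, s) => D.hseg l s

/-- Replaces segments with real coordinates by finite combinatorial data on which isomorphisms act.
-/
theorem isInsertionEdge_iff (D : Drawing n) (e : Segment) :
    D.IsInsertionEdge e ↔ ∃ c, D.IsCode c ∧ D.seg c = e := by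
  constructor
  · intro h
    cases e with
    | vert x a b =>
      obtain ⟨l, s, h1, h2⟩ := exists_vcode h
      exact ⟨(true, l, s), h1, h2⟩
    | horiz y a b =>
      obtain ⟨l, s, h1, h2⟩ := exists_vcode h.anti
      exact ⟨(false, l, s), h1, Segment.anti_injective ((D.anti_vseg l s).symm.trans h2)⟩
  · rintro ⟨⟨_ | _, l, s⟩, h, rfl⟩
    · rw [← anti_isInsertionEdge]
      exact D.anti_vseg l s ▸ VCode.isInsertionEdge h
    · exact VCode.isInsertionEdge h

/-- Rectangles on the bottom boundary overlap vertically, so their order by `x` is given by chains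
of left-right neighbours. For equal `s` the candidates `l` are stacked along one wall and are
ordered by chains of below-above neighbours. -/
theorem vseg_le_vseg_iff {D : Drawing n} {l s l' s' : Fin n} (h : D.VCode l s)
    (h' : D.VCode l' s') : (D.vseg l s).Le (D.vseg l' s') ↔
      TransGen D.LeftOf s s' ∨ (s = s' ∧ (l = l' ∨ TransGen D.BelowOf l l')) := by
  have f := h.facts
  have f' := h'.facts
  have hsy := D.lt_y s
  have hsy' := D.lt_y s'
  have hsx := D.lt_x s
  have hly := D.lt_y l
  have hly' := D.lt_y l'
  rw [D.transGen_leftOf_iff (i := s) (j := s') (by linarith) (by linarith)]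
  simp only [vseg, Segment.Le]
  by_cases hs : s = s'
  · subst hs
    have hov := h.overlap_x h'
    have hov' := h'.overlap_x h
    rw [D.transGen_belowOf_iff hov hov']
    have ht := h.trichotomy h'
    constructor
    · rintro (hh | ⟨-, hh⟩)
      · exact (lt_irrefl _ hh).elim
      · rcases ht with ht | ht | ht
        · exact Or.inr ⟨rfl, Or.inl ht⟩
        · exact Or.inr ⟨rfl, Or.inr ht⟩
        · linarith
    · rintro (hh | ⟨-, hh | hh⟩)
      · linarith
      · exact Or.inr ⟨rfl, by rw [hh]⟩
      · exact Or.inr ⟨rfl, by linarith⟩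
  · have hne : (D.rect s).x₁ ≠ (D.rect s').x₁ := fun hx => hs (h.right_eq h' hx)
    simp only [hs, hne, false_and, or_false]
    refine ⟨fun hlt => ?_, fun hle => hsx.trans_le hle⟩
    by_contra! hc
    exact hs (D.eq_of_overlap (hlt.trans (D.lt_x s')) hc (by linarith) (by linarith))

/-- The reflection reverses the order. For segments at equal height this needs an argument: the
order compares left ends, whereas the reflected order compares right ends, and `key` shows that both
comparisons agree. -/
theorem hseg_le_hseg_iff {D : Drawing n} {l s l' s' : Fin n} (h : D.anti.VCode l s)
    (h' : D.anti.VCode l' s') : (D.hseg l s).Le (D.hseg l' s') ↔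
      (D.anti.vseg l' s').Le (D.anti.vseg l s) := by
  have key : s = s' → (max (D.rect l).x₁ (D.rect s).x₁ ≤ max (D.rect l').x₁ (D.rect s').x₁ ↔
      (D.rect l).x₂ ≤ (D.rect l').x₂) := by
    rintro rfl
    have f := h.facts
    have f' := h'.facts
    have ht := h.trichotomy h'
    simp only [anti_y₁, anti_y₂, neg_lt_neg_iff, neg_le_neg_iff] at f f' ht
    have hlx := D.lt_x l
    have hlx' := D.lt_x l'
    rcases ht with rfl | ht | ht
    · simp
    · refine iff_of_false (fun hc => ?_) (by linarith)
      have := (le_max_left _ _).trans hc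
      rcases le_max_iff.1 this with g | g <;> linarith
    · refine iff_of_true (max_le (le_max_of_le_left (by linarith)) (le_max_right _ _))
        (by linarith)
  simp only [vseg, hseg, Segment.Le, anti_x₁, anti_y₁, neg_lt_neg_iff, neg_inj, neg_le_neg_iff]
  refine or_congr Iff.rfl ?_
  constructor
  · rintro ⟨h1, h2⟩
    exact ⟨h1.symm, (key (h.right_eq h' (by simp [h1]))).1 h2⟩
  · rintro ⟨h1, h2⟩
    exact ⟨h1.symm, (key (h.right_eq h' (by simp [h1]))).2 h2⟩

theorem vseg_antisymm {D : Drawing n} {l s l' s' : Fin n} (h : D.VCode l s)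
    (h' : D.VCode l' s') (h1 : (D.vseg l s).Le (D.vseg l' s'))
    (h2 : (D.vseg l' s').Le (D.vseg l s)) : l = l' ∧ s = s' := by
  simp only [vseg, Segment.Le] at h1 h2
  obtain rfl : s = s' := h.right_eq h' (by
    rcases h1 with h1 | h1 <;> rcases h2 with h2 | h2 <;> linarith)
  have := D.lt_y l
  have := D.lt_y l'
  simp only [lt_irrefl, false_or, true_and] at h1 h2
  rcases h.trichotomy h' with h | h | h
  · exact ⟨h, rfl⟩
  · linarith
  · linarith

/-- `Segment.Le` ignores the second end of a segment and is only a preorder in general; among the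
edges described by codes the first end determines the edge. -/
theorem seg_antisymm {D : Drawing n} {c c' : Code n} (h : D.IsCode c) (h' : D.IsCode c')
    (h1 : (D.seg c).Le (D.seg c')) (h2 : (D.seg c').Le (D.seg c)) : c = c' := by
  obtain ⟨_ | _, l, s⟩ := c <;> obtain ⟨_ | _, l', s'⟩ := c'
  · have := vseg_antisymm h h' ((hseg_le_hseg_iff h' h).1 h2) ((hseg_le_hseg_iff h h').1 h1)
    rw [this.1, this.2]
  · exact h1.elim
  · exact h2.elim
  · have := vseg_antisymm h h' h1 h2
    rw [this.1, this.2]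

theorem finite_insertionEdges (D : Drawing n) : {e | D.IsInsertionEdge e}.Finite := by
  refine (Set.finite_range D.seg).subset fun e he => ?_
  obtain ⟨c, -, hc⟩ := (D.isInsertionEdge_iff e).1 he
  exact ⟨c, hc⟩

/-- The index is the rank in a finite total preorder, and a strictly larger edge has a strictly
larger initial segment. -/
theorem insertionIndex_lt {D : Drawing n} {e f : Segment} (hf : D.IsInsertionEdge f)
    (h : ¬ f.Le e) : D.insertionIndex e < D.insertionIndex f := by
  refine Set.ncard_lt_ncard ⟨fun g hg => ⟨hg.1, Segment.le_trans hg.2 ((e.le_total f).resolve_right h)⟩,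
    fun hs => h (hs ⟨hf, f.le_refl⟩).2⟩ (D.finite_insertionEdges.subset fun g hg => hg.1)

theorem insertionIndex_injective {D : Drawing n} {e f : Segment} (he : D.IsInsertionEdge e)
    (hf : D.IsInsertionEdge f) (h : D.insertionIndex e = D.insertionIndex f) : e = f := by
  obtain ⟨c, hc, rfl⟩ := (D.isInsertionEdge_iff e).1 he
  obtain ⟨d, hd, rfl⟩ := (D.isInsertionEdge_iff f).1 hf
  congr 1
  refine seg_antisymm hc hd ?_ ?_
  · by_contra hn
    exact (insertionIndex_lt he hn).ne h.symm
  · by_contra hn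
    exact (insertionIndex_lt hf hn).ne h

theorem one_le_insertionIndex {D : Drawing n} {e : Segment} (he : D.IsInsertionEdge e) :
    1 ≤ D.insertionIndex e :=
  (Set.ncard_pos (D.finite_insertionEdges.subset fun _ hg => hg.1)).2 ⟨e, he, e.le_refl⟩

theorem insertionIndex_le (D : Drawing n) (e : Segment) :
    D.insertionIndex e ≤ D.insertionCount :=
  Set.ncard_le_ncard (fun _ hg => hg.1) D.finite_insertionEdges

/-! ### Invariance of the insertion index -/

section

variable {D D' : Drawing n} {σ : Equiv.Perm (Fin n)}

/-- The action of a permutation of the rectangles on codes. -/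
def codeMap (σ : Equiv.Perm (Fin n)) : Code n ≃ Code n :=
  (Equiv.refl Bool).prodCongr (σ.prodCongr σ)

theorem IsIso.vcode (h : D.IsIso D' σ) (l s : Fin n) :
    D.VCode l s ↔ D'.VCode (σ l) (σ s) := by
  simp only [VCode]
  rw [h.no_below, h.no_left, (h l s).1, σ.injective.eq_iff]

theorem IsIso.isCode (h : D.IsIso D' σ) (c : Code n) : D.IsCode c ↔ D'.IsCode (codeMap σ c) := by
  obtain ⟨_ | _, l, s⟩ := c
  · exact h.anti.vcode l s
  · exact h.vcode l s

theorem IsIso.vseg_le (h : D.IsIso D' σ) {l s l' s' : Fin n} (hc : D.VCode l s)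
    (hc' : D.VCode l' s') : (D.vseg l s).Le (D.vseg l' s') ↔
      (D'.vseg (σ l) (σ s)).Le (D'.vseg (σ l') (σ s')) := by
  rw [vseg_le_vseg_iff hc hc', vseg_le_vseg_iff ((h.vcode _ _).1 hc) ((h.vcode _ _).1 hc'),
    h.transGen_leftOf, h.transGen_belowOf, σ.injective.eq_iff, σ.injective.eq_iff]

theorem IsIso.seg_le (h : D.IsIso D' σ) {c c' : Code n} (hc : D.IsCode c)
    (hc' : D.IsCode c') : (D.seg c).Le (D.seg c') ↔
      (D'.seg (codeMap σ c)).Le (D'.seg (codeMap σ c')) := by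
  obtain ⟨_ | _, l, s⟩ := c <;> obtain ⟨_ | _, l', s'⟩ := c'
  · refine (hseg_le_hseg_iff hc hc').trans ((h.anti.vseg_le hc' hc).trans ?_)
    exact (hseg_le_hseg_iff ((h.anti.vcode _ _).1 hc) ((h.anti.vcode _ _).1 hc')).symm
  · exact Iff.rfl
  · exact Iff.rfl
  · exact h.vseg_le hc hc'

theorem seg_injOn (D : Drawing n) : Set.InjOn D.seg {c | D.IsCode c} := fun _ hc _ hc' h =>
  seg_antisymm hc hc' (h ▸ Segment.le_refl _) (h ▸ Segment.le_refl _)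

theorem insertionIndex_seg (D : Drawing n) (c : Code n) :
    D.insertionIndex (D.seg c) = {d | D.IsCode d ∧ (D.seg d).Le (D.seg c)}.ncard := by
  rw [insertionIndex, ← (D.seg_injOn.mono fun d hd => hd.1 :
    Set.InjOn D.seg {d | D.IsCode d ∧ (D.seg d).Le (D.seg c)}).ncard_image]
  congr 1
  ext e
  simp only [Set.mem_ofPred_eq, Set.mem_image, isInsertionEdge_iff]
  constructor
  · rintro ⟨⟨d, hd, rfl⟩, h⟩
    exact ⟨d, ⟨hd, h⟩, rfl⟩
  · rintro ⟨d, ⟨hd, h⟩, rfl⟩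
    exact ⟨⟨d, hd, rfl⟩, h⟩

theorem insertionCount_eq (D : Drawing n) : D.insertionCount = {d | D.IsCode d}.ncard := by
  rw [insertionCount, ← D.seg_injOn.ncard_image]
  congr 1
  ext e
  simp [isInsertionEdge_iff]

/-- Codes and their order are expressed by the relations, so an isomorphism maps initial segments
onto initial segments. Hence `c_k` makes sense on equivalence classes. -/
theorem IsIso.insertionIndex_seg (h : D.IsIso D' σ) {c : Code n} (hc : D.IsCode c) :
    D.insertionIndex (D.seg c) = D'.insertionIndex (D'.seg (codeMap σ c)) := by
  rw [Drawing.insertionIndex_seg, Drawing.insertionIndex_seg,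
    ← (codeMap σ).injective.injOn.ncard_image]
  congr 1
  ext d
  simp only [Set.mem_image, Set.mem_ofPred_eq]
  constructor
  · rintro ⟨d, ⟨hd, hd'⟩, rfl⟩
    exact ⟨(h.isCode d).1 hd, (h.seg_le hd hc).1 hd'⟩
  · rintro ⟨hd, hd'⟩
    obtain ⟨d, rfl⟩ := (codeMap σ).surjective d
    rw [← h.isCode] at hd
    exact ⟨d, ⟨hd, (h.seg_le hd hc).2 hd'⟩, rfl⟩

theorem IsIso.insertionCount_eq (h : D.IsIso D' σ) : D.insertionCount = D'.insertionCount := by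
  rw [Drawing.insertionCount_eq, Drawing.insertionCount_eq,
    ← (codeMap σ).injective.injOn.ncard_image]
  congr 1
  ext d
  obtain ⟨d, rfl⟩ := (codeMap σ).surjective d
  simp [h.isCode]

end

/-! ### The relations after an insertion -/

/-- `D'` arises from `D` by a vertical insertion at height `y` on the edge described by
`(l, s)`. -/
structure VInsert (D : Drawing n) (l s : Fin n) (y : ℝ) (D' : Drawing (n + 1)) : Prop where
  code : D.VCode l s
  lt_height : (D.rect l).y₁ < y
  height_lt_left : y < (D.rect l).y₂
  height_lt : y < (D.rect s).y₂
  outer : D'.outer = D.outer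
  new : D'.rect (Fin.last n) = ⟨(D.rect s).x₁, D.outer.x₂, D.outer.y₁, y⟩
  pushed : ∀ i, (D.rect i).y₁ = D.outer.y₁ → (D.rect s).x₁ ≤ (D.rect i).x₁ →
    D'.rect i.castSucc = { D.rect i with y₁ := y }
  unpushed : ∀ i, ((D.rect i).y₁ = D.outer.y₁ → (D.rect i).x₁ < (D.rect s).x₁) →
    D'.rect i.castSucc = D.rect i

theorem vInsert_iff (D : Drawing n) (l s : Fin n) (D' : Drawing (n + 1)) (hc : D.VCode l s) :
    D.InsertsTo (D.vseg l s) D' ↔ ∃ y, D.VInsert l s y D' := by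
  simp only [vseg, InsertsTo]
  refine exists_congr fun y => ⟨?_, ?_⟩
  · rintro ⟨h1, h2, h3, h4, h5⟩
    rw [lt_min_iff] at h2
    refine ⟨hc, h1, h2.1, h2.2, h3, h4, fun i hi hi' => ?_, fun i hi => ?_⟩
    · rw [h5, if_pos ⟨hi, hi'⟩]
    · rw [h5, if_neg fun h => (hi h.1).not_ge h.2]
  · intro h
    refine ⟨h.lt_height, lt_min h.height_lt_left h.height_lt, h.outer, h.new, fun i => ?_⟩
    split_ifs with hi
    · exact h.pushed i hi.1 hi.2
    · exact h.unpushed i fun h1 => not_le.1 fun h2 => hi ⟨h1, h2⟩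

namespace VInsert

variable {D : Drawing n} {D' : Drawing (n + 1)} {l s : Fin n} {y : ℝ}

/-- The three ways in which a rectangle of `D` can be affected by the insertion. -/
theorem cases (h : D.VInsert l s y D') (i : Fin n) :
    ((D.rect i).y₁ = D.outer.y₁ ∧ (D.rect s).x₁ ≤ (D.rect i).x₁ ∧ y < (D.rect i).y₂ ∧
      D'.rect i.castSucc = { D.rect i with y₁ := y }) ∨
    (((D.rect i).y₁ = D.outer.y₁ → (D.rect i).x₁ < (D.rect s).x₁) ∧
      ((D.rect i).x₂ ≤ (D.rect s).x₁ ∨ y ≤ (D.rect i).y₁) ∧ D'.rect i.castSucc = D.rect i) := by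
  by_cases hi : (D.rect i).y₁ = D.outer.y₁ ∧ (D.rect s).x₁ ≤ (D.rect i).x₁
  · refine Or.inl ⟨hi.1, hi.2, ?_, h.pushed i hi.1 hi.2⟩
    -- Boxes of `D'` are proper, which forces a pushed rectangle to be higher than `y`.
    simpa [h.pushed i hi.1 hi.2] using D'.lt_y i.castSucc
  · replace hi : (D.rect i).y₁ = D.outer.y₁ → (D.rect i).x₁ < (D.rect s).x₁ :=
      fun h1 => not_le.1 fun h2 => hi ⟨h1, h2⟩
    refine Or.inr ⟨hi, ?_, h.unpushed i hi⟩
    -- Otherwise `i` would overlap the new rectangle in `D'`.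
    by_contra! hc
    refine (Fin.castSucc_lt_last i).ne (D'.eq_of_overlap ?_ ?_ ?_ ?_) <;>
      simp only [h.unpushed i hi, h.new]
    · exact (D.lt_x i).trans_le (D.x₂_le_outer i)
    · exact hc.1
    · exact hc.2
    · exact (D.outer_le_y₁ i).trans_lt (D.lt_y i)

theorem outer_le (h : D.VInsert l s y D') : D.outer.y₁ < y :=
  (D.outer_le_y₁ l).trans_lt h.lt_height

/-- For a left neighbour of the rectangle above the new one, height comparison with the top-left
corner of the new rectangle is determined by the relations. -/
theorem height_lt_iff (h : D.VInsert l s y D') {i : Fin n} (hi : D.LeftOf i s) :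
    y < (D.rect i).y₂ ↔ i = l ∨ TransGen D.BelowOf l i := by
  have hci : D.VCode i s := ⟨h.code.1, Or.inl hi⟩
  rw [D.transGen_belowOf_iff (h.code.overlap_x hci) (hci.overlap_x h.code)]
  have := h.lt_height
  have := h.height_lt_left
  have := D.lt_y i
  rcases h.code.trichotomy hci with rfl | ht | ht
  · simpa using h.height_lt_left
  · exact iff_of_true (by linarith) (Or.inr ht)
  · refine iff_of_false (by linarith) ?_
    rintro (rfl | h) <;> linarith

theorem lt_height_iff (h : D.VInsert l s y D') {i : Fin n} (hi : D.LeftOf i s) :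
    (D.rect i).y₁ < y ↔ i = l ∨ TransGen D.BelowOf i l := by
  have hci : D.VCode i s := ⟨h.code.1, Or.inl hi⟩
  rw [D.transGen_belowOf_iff (hci.overlap_x h.code) (h.code.overlap_x hci)]
  have := h.lt_height
  have := h.height_lt_left
  have := D.lt_y i
  rcases h.code.trichotomy hci with rfl | ht | ht
  · simpa using h.lt_height
  · refine iff_of_false (by linarith) ?_
    rintro (rfl | h) <;> linarith
  · exact iff_of_true (by linarith) (Or.inr ht)

/-- The only contacts that can be lost are those with the left side of `s` below height `y`: to the
left of any other pushed rectangle there is a pushed one or one that lies entirely above `y`. -/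
theorem leftOf_castSucc_iff_height (h : D.VInsert l s y D') (i j : Fin n) :
    D'.LeftOf i.castSucc j.castSucc ↔ D.LeftOf i j ∧ (j = s → y < (D.rect i).y₂) := by
  have hy := h.outer_le
  have f := h.code.facts
  have hsi : (D.rect i).y₁ = D.outer.y₁ → (D.rect s).x₁ = (D.rect i).x₁ → i = s :=
    fun h1 h2 => VCode.eq_of_bottom h1 f.1 h2.symm
  have hsj : (D.rect j).y₁ = D.outer.y₁ → (D.rect s).x₁ = (D.rect j).x₁ → j = s :=
    fun h1 h2 => VCode.eq_of_bottom h1 f.1 h2.symm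
  have hyi := D.lt_y i
  have hyj := D.lt_y j
  have hxi := D.lt_x i
  have hxj := D.lt_x j
  have hbj := D.outer_le_y₁ j
  have hbi := D.outer_le_y₁ i
  have hjs : j = s → (D.rect s).x₁ = (D.rect j).x₁ := by rintro rfl; rfl
  simp only [LeftOf]
  rcases h.cases i with ⟨i1, i2, i3, i4⟩ | ⟨i1, i2, i4⟩ <;>
    rcases h.cases j with ⟨j1, j2, j3, j4⟩ | ⟨j1, j2, j4⟩ <;> rw [i4, j4] <;> try dsimp only
  · grind
  · grind
  · constructor
    · rintro ⟨h1, h2, h3⟩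
      exact ⟨⟨h1, h2, by linarith⟩, fun _ => h3⟩
    · rintro ⟨⟨h1, h2, h3⟩, h4⟩
      refine ⟨h1, h2, ?_⟩
      rcases j2.eq_or_lt with g | g
      · exact h4 (hsj j1 g)
      · rcases i2 with i2 | i2 <;> linarith
  · have : j ≠ s := by
      rintro rfl
      exact lt_irrefl _ (j1 f.1)
    exact ⟨fun hc => ⟨hc, fun hj => (this hj).elim⟩, And.left⟩

/-- The height `y` has been eliminated, so the right-hand side is transported by isomorphisms of
`D`. -/
theorem leftOf_castSucc (h : D.VInsert l s y D') (i j : Fin n) :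
    D'.LeftOf i.castSucc j.castSucc ↔
      D.LeftOf i j ∧ (j = s → i = l ∨ TransGen D.BelowOf l i) := by
  rw [h.leftOf_castSucc_iff_height]
  refine and_congr_right fun hij => ⟨?_, ?_⟩
  · rintro hs rfl
    exact (h.height_lt_iff hij).1 (hs rfl)
  · rintro hs rfl
    exact (h.height_lt_iff hij).2 (hs rfl)

theorem leftOf_last_iff_height (h : D.VInsert l s y D') (i : Fin n) :
    D'.LeftOf i.castSucc (Fin.last n) ↔ D.LeftOf i s ∧ (D.rect i).y₁ < y := by
  have hy := h.outer_le
  have f := h.code.facts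
  have hyi := D.lt_y i
  have hxi := D.lt_x i
  have hbi := D.outer_le_y₁ i
  have hys := h.height_lt
  simp only [LeftOf, h.new]
  rcases h.cases i with ⟨i1, i2, i3, i4⟩ | ⟨i1, i2, i4⟩ <;> rw [i4] <;> try dsimp only
  · grind
  · grind

theorem leftOf_last (h : D.VInsert l s y D') (i : Fin n) :
    D'.LeftOf i.castSucc (Fin.last n) ↔
      D.LeftOf i s ∧ (i = l ∨ TransGen D.BelowOf i l) := by
  rw [h.leftOf_last_iff_height]
  exact and_congr_right fun hi => h.lt_height_iff hi

theorem isBottomRight_last (h : D.VInsert l s y D') : D'.IsBottomRight (Fin.last n) := by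
  simp [IsBottomRight, h.new, h.outer]

theorem last_leftOf (h : D.VInsert l s y D') (i : Fin (n + 1)) : ¬ D'.LeftOf (Fin.last n) i :=
  (D'.forall_not_rightOf_iff _).2 h.isBottomRight_last.1 i

theorem belowOf_last (h : D.VInsert l s y D') (i : Fin (n + 1)) : ¬ D'.BelowOf i (Fin.last n) :=
  (D'.forall_not_belowOf_iff _).2 h.isBottomRight_last.2 i

theorem belowOf_castSucc (h : D.VInsert l s y D') (i j : Fin n) :
    D'.BelowOf i.castSucc j.castSucc ↔ D.BelowOf i j := by
  have hy := h.outer_le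
  have hyi := D.lt_y i
  have hyj := D.lt_y j
  have hxi := D.lt_x i
  have hxj := D.lt_x j
  have hbi := D.outer_le_y₁ i
  simp only [BelowOf]
  rcases h.cases i with ⟨i1, i2, i3, i4⟩ | ⟨i1, i2, i4⟩ <;>
    rcases h.cases j with ⟨j1, j2, j3, j4⟩ | ⟨j1, j2, j4⟩ <;> rw [i4, j4] <;> grind

theorem last_belowOf_iff_le (h : D.VInsert l s y D') (j : Fin n) :
    D'.BelowOf (Fin.last n) j.castSucc ↔
      (D.rect j).y₁ = D.outer.y₁ ∧ (D.rect s).x₁ ≤ (D.rect j).x₁ := by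
  have hy := h.outer_le
  have hyj := D.lt_y j
  have hxj := D.lt_x j
  have hXj := D.x₂_le_outer j
  simp only [BelowOf, h.new]
  rcases h.cases j with ⟨j1, j2, j3, j4⟩ | ⟨j1, j2, j4⟩ <;> rw [j4]
  · exact iff_of_true ⟨rfl, by linarith, by linarith⟩ ⟨j1, j2⟩
  · refine iff_of_false ?_ fun hc => (j1 hc.1).not_ge hc.2
    rintro ⟨g1, g2, g3⟩
    -- Suppose an unpushed `j` rests on the new rectangle. Look in `D` just below the bottom side of
    -- `j`, to the right of the wall: a pushed rectangle there would overlap `j`, and an unpushed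
    -- one would lie left of the wall or above `y`.
    obtain ⟨z, hz1, hz2⟩ : ∃ z, max (D.rect s).x₁ (D.rect j).x₁ < z ∧ z < (D.rect j).x₂ :=
      exists_between (max_lt g2 (D.lt_x j))
    rw [max_lt_iff] at hz1
    obtain ⟨k, ⟨k1, k2⟩, k3, k4⟩ := D.exists_lower_right (x := z) (y := y)
      ⟨by linarith [D.outer_le_x₁ s], by linarith⟩ ⟨hy, by linarith [D.y₂_le_outer j]⟩
    rcases h.cases k with ⟨c1, c2, c3, c4⟩ | ⟨c1, c2, c4⟩
    · obtain rfl := D.eq_of_overlap (i := k) (j := j) (by linarith) (by linarith) (by linarith)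
        (by linarith)
      linarith
    · rcases c2 with c2 | c2 <;> linarith

theorem last_belowOf (h : D.VInsert l s y D') (j : Fin n) :
    D'.BelowOf (Fin.last n) j.castSucc ↔
      j = s ∨ ((∀ k, ¬ D.BelowOf k j) ∧ TransGen D.LeftOf s j) := by
  rw [h.last_belowOf_iff_le, forall_not_belowOf_iff]
  have f := h.code.facts
  have hys := D.lt_y s
  have hyj := D.lt_y j
  have hxs := D.lt_x s
  constructor
  · rintro ⟨h1, h2⟩
    rw [D.transGen_leftOf_iff (by linarith) (by linarith)]
    by_contra! hc
    exact hc.1 (D.eq_of_overlap (hc.2 h1) (by linarith [D.lt_x j]) (by linarith) (by linarith))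
  · rintro (rfl | ⟨h1, h2⟩)
    · exact ⟨f.1, le_rfl⟩
    · rw [D.transGen_leftOf_iff (by linarith) (by linarith)] at h2
      exact ⟨h1, by linarith⟩

/-- The left/right relation before the insertion in terms of the relations after it. -/
theorem leftOf_iff (h : D.VInsert l s y D') (i j : Fin n) :
    D.LeftOf i j ↔ D'.LeftOf i.castSucc j.castSucc ∨
      (D'.LeftOf i.castSucc (Fin.last n) ∧ D'.BelowOf (Fin.last n) j.castSucc ∧
        ∃ k, D'.LeftOf k (Fin.last n) ∧ D'.LeftOf k j.castSucc) := by
  have f := h.code.facts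
  rw [h.leftOf_castSucc_iff_height, h.leftOf_last_iff_height]
  constructor
  · intro hij
    by_cases hj : j = s
    · subst hj
      by_cases hyi : y < (D.rect i).y₂
      · exact Or.inl ⟨hij, fun _ => hyi⟩
      · refine Or.inr ⟨⟨hij, by linarith [D.lt_y i]⟩, (h.last_belowOf_iff_le j).2 ⟨f.1, le_rfl⟩,
          l.castSucc, ?_, ?_⟩
        · have hl : D.LeftOf l j := h.code.2.resolve_right fun hc => hc.2 i hij
          exact (h.leftOf_last_iff_height l).2 ⟨hl, h.lt_height⟩
        · have hl : D.LeftOf l j := h.code.2.resolve_right fun hc => hc.2 i hij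
          exact (h.leftOf_castSucc_iff_height l j).2 ⟨hl, fun _ => h.height_lt_left⟩
    · exact Or.inl ⟨hij, fun hc => (hj hc).elim⟩
  · rintro (hij | ⟨⟨h1, h2⟩, h3, k, h4, h5⟩)
    · exact hij.1
    · rw [h.last_belowOf_iff_le] at h3
      -- A common left neighbour `k` puts the left sides of the new rectangle and of `j` on one
      -- line, which singles out `s` among the pushed rectangles.
      have hx := h4.1.symm.trans h5.1
      rw [h.new] at hx
      have hx' : (D'.rect j.castSucc).x₁ = (D.rect j).x₁ := by
        rw [h.pushed j h3.1 h3.2]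
      obtain rfl : j = s := VCode.eq_of_bottom h3.1 f.1 (hx'.symm.trans hx.symm)
      exact h1

end VInsert

/-! ### Reading the insertion edge off the result. -/

/-- The vertical code of the new rectangle `r` of a rectangulation, in terms of the relations. -/
def NewCode (D : Drawing n) (r l s : Fin n) : Prop :=
  D.BelowOf r s ∧ ((D.LeftOf l r ∧ D.LeftOf l s) ∨
    (l = s ∧ (∀ j, ¬ D.LeftOf j r) ∧ ∀ j, ¬ D.LeftOf j s))

theorem IsIso.newCode {D D' : Drawing n} {σ : Equiv.Perm (Fin n)} (h : D.IsIso D' σ)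
    (r l s : Fin n) : D.NewCode r l s ↔ D'.NewCode (σ r) (σ l) (σ s) := by
  simp only [NewCode]
  rw [(h r s).2, (h l r).1, (h l s).1, σ.injective.eq_iff, h.no_left r, h.no_left s]

/-- The height `y` is strictly inside the right side of `l`, so off the left boundary `l` is the
only rectangle that touches both the new one and `s` from the left; on the left boundary the code is
diagonal. -/
theorem VInsert.newCode_iff {D : Drawing n} {D' : Drawing (n + 1)} {l s : Fin n} {y : ℝ}
    (h : D.VInsert l s y D') (l' s' : Fin (n + 1)) :
    D'.NewCode (Fin.last n) l' s' ↔ l' = l.castSucc ∧ s' = s.castSucc := by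
  have f := h.code.facts
  constructor
  · rintro ⟨h1, h2⟩
    obtain rfl | ⟨t, rfl⟩ := s'.eq_castSucc_or_eq_last.symm
    · exact (h.belowOf_last _ h1).elim
    rw [h.last_belowOf_iff_le] at h1
    have hx' : (D'.rect t.castSucc).x₁ = (D.rect t).x₁ := by rw [h.pushed t h1.1 h1.2]
    rcases h2 with ⟨h2, h3⟩ | ⟨rfl, h3, h4⟩
    · obtain rfl | ⟨k, rfl⟩ := l'.eq_castSucc_or_eq_last.symm
      · exact (h.last_leftOf _ h2).elim
      have hx := h2.1.symm.trans h3.1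
      rw [h.new] at hx
      obtain rfl : t = s := VCode.eq_of_bottom h1.1 f.1 (hx'.symm.trans hx.symm)
      rw [h.leftOf_last_iff_height] at h2
      rw [h.leftOf_castSucc_iff_height] at h3
      have hk : D.VCode k t := ⟨h.code.1, Or.inl h2.1⟩
      rcases h.code.trichotomy hk with rfl | ht | ht
      · exact ⟨rfl, rfl⟩
      · linarith [h.height_lt_left]
      · linarith [h3.2 rfl, h.lt_height]
    · rw [forall_not_leftOf_iff, h.outer] at h3 h4
      rw [h.new] at h3
      obtain rfl : t = s := VCode.eq_of_bottom h1.1 f.1 (by rw [← hx', h4]; exact h3.symm)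
      obtain hl | hl := h.code.2
      · have : D.outer.x₁ < (D.rect t).x₁ := (D.exists_leftOf_iff t).1 ⟨l, hl⟩
        exact (this.ne' h3).elim
      · rw [hl.1]
        exact ⟨rfl, rfl⟩
  · rintro ⟨rfl, rfl⟩
    refine ⟨(h.last_belowOf_iff_le s).2 ⟨f.1, le_rfl⟩, ?_⟩
    rcases h.code.2 with hl | ⟨rfl, hl⟩
    · exact Or.inl ⟨(h.leftOf_last_iff_height l).2 ⟨hl, h.lt_height⟩,
        (h.leftOf_castSucc_iff_height l s).2 ⟨hl, fun _ => h.height_lt_left⟩⟩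
    · refine Or.inr ⟨rfl, ?_, ?_⟩ <;> rw [forall_not_leftOf_iff, h.outer]
      · rw [h.new]
        exact f.2.2.2 rfl
      · rw [h.pushed l f.1 le_rfl]
        exact f.2.2.2 rfl

/-! ### Extending and restricting isomorphisms -/

/-- The extension of a permutation by a fixed last element. -/
def extendPerm (σ : Equiv.Perm (Fin n)) : Equiv.Perm (Fin (n + 1)) :=
  finSuccEquivLast.trans ((Equiv.optionCongr σ).trans finSuccEquivLast.symm)

@[simp] theorem extendPerm_castSucc (σ : Equiv.Perm (Fin n)) (i : Fin n) :
    extendPerm σ i.castSucc = (σ i).castSucc := by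
  simp [extendPerm]

@[simp] theorem extendPerm_last (σ : Equiv.Perm (Fin n)) :
    extendPerm σ (Fin.last n) = Fin.last n := by
  simp [extendPerm]

/-- A permutation that fixes the last element restricts to the other ones. -/
theorem exists_extendPerm_eq (τ : Equiv.Perm (Fin (n + 1))) (h : τ (Fin.last n) = Fin.last n) :
    ∃ σ : Equiv.Perm (Fin n), τ = extendPerm σ := by
  have key : ∀ i : Fin n, τ i.castSucc ≠ Fin.last n := fun i hi =>
    (Fin.castSucc_lt_last i).ne (τ.injective (hi.trans h.symm))
  have inj : Function.Injective fun i : Fin n => (τ i.castSucc).castPred (key i) := by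
    intro i j hij
    simpa using hij
  refine ⟨Equiv.ofBijective _ (Finite.injective_iff_bijective.1 inj), Equiv.ext fun i => ?_⟩
  obtain rfl | ⟨i, rfl⟩ := i.eq_castSucc_or_eq_last.symm
  · simp [h]
  · simp

section

variable {D₁ D₂ : Drawing n} {D₁' D₂' : Drawing (n + 1)} {σ : Equiv.Perm (Fin n)} {l s : Fin n}
  {y y' : ℝ}

/-- Well-definedness of insertion on classes: the relations of the result are formulas in the old
relations and the code. -/
theorem VInsert.extend (h₁ : D₁.VInsert l s y D₁') (h₂ : D₂.VInsert (σ l) (σ s) y' D₂')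
    (h : D₁.IsIso D₂ σ) : D₁'.IsIso D₂' (extendPerm σ) := by
  intro i j
  obtain rfl | ⟨i, rfl⟩ := i.eq_castSucc_or_eq_last.symm <;>
    obtain rfl | ⟨j, rfl⟩ := j.eq_castSucc_or_eq_last.symm <;>
    simp only [extendPerm_last, extendPerm_castSucc]
  · exact ⟨iff_of_false (h₁.last_leftOf _) (h₂.last_leftOf _),
      iff_of_false (h₁.belowOf_last _) (h₂.belowOf_last _)⟩
  · refine ⟨iff_of_false (h₁.last_leftOf _) (h₂.last_leftOf _), ?_⟩
    rw [h₁.last_belowOf, h₂.last_belowOf, h.no_below, h.transGen_leftOf, σ.injective.eq_iff]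
  · refine ⟨?_, iff_of_false (h₁.belowOf_last _) (h₂.belowOf_last _)⟩
    rw [h₁.leftOf_last, h₂.leftOf_last, (h i s).1, h.transGen_belowOf, σ.injective.eq_iff]
  · rw [h₁.leftOf_castSucc, h₂.leftOf_castSucc, h₁.belowOf_castSucc, h₂.belowOf_castSucc,
      (h i j).1, h.transGen_belowOf, σ.injective.eq_iff, σ.injective.eq_iff]
    exact ⟨Iff.rfl, (h i j).2⟩

/-- The converse, injectivity of insertion: `leftOf_iff` and `belowOf_castSucc` recover the old
relations, `newCode_iff` recovers the code. -/
theorem VInsert.restrict {l' s' : Fin n} (h₁ : D₁.VInsert l s y D₁')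
    (h₂ : D₂.VInsert l' s' y' D₂') (h : D₁'.IsIso D₂' (extendPerm σ)) :
    D₁.IsIso D₂ σ ∧ l' = σ l ∧ s' = σ s := by
  refine ⟨fun i j => ⟨?_, ?_⟩, ?_⟩
  · rw [h₁.leftOf_iff, h₂.leftOf_iff, ← (extendPerm σ).exists_congr_right
      (q := fun k => D₂'.LeftOf k (Fin.last n) ∧ D₂'.LeftOf k (σ j).castSucc),
      ← extendPerm_castSucc, ← extendPerm_castSucc, ← extendPerm_last σ, ← (h _ _).1,
      ← (h _ _).1, ← (h _ _).2]
    simp only [extendPerm_last, ← (h _ _).1]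
    conv_rhs =>
      enter [2, 2, 2, 1, k]
      rw [← extendPerm_last σ, ← (h _ _).1]
  · rw [← h₁.belowOf_castSucc, ← h₂.belowOf_castSucc, (h _ _).2]
    simp
  · have := (h.newCode _ _ _).1 ((h₁.newCode_iff _ _).2 ⟨rfl, rfl⟩)
    rw [extendPerm_last, h₂.newCode_iff] at this
    simp only [extendPerm_castSucc, Fin.castSucc_inj] at this
    exact ⟨this.1.symm, this.2.symm⟩

end

/-! ### Deletion -/

@[simp] theorem anti_edgeUp (D : Drawing n) (x y : ℝ) :
    D.anti.EdgeUp (-y) (-x) ↔ D.EdgeLeft x y := by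
  simp only [EdgeUp, EdgeLeft, anti_x₁, anti_x₂, anti_y₁, anti_y₂, neg_inj, neg_le_neg_iff,
    neg_lt_neg_iff]
  exact exists_congr fun i => by tauto

@[simp] theorem anti_edgeLeft (D : Drawing n) (x y : ℝ) :
    D.anti.EdgeLeft (-y) (-x) ↔ D.EdgeUp x y := by
  simp only [EdgeUp, EdgeLeft, anti_x₁, anti_x₂, anti_y₁, anti_y₂, neg_inj, neg_le_neg_iff,
    neg_lt_neg_iff]
  exact exists_congr fun i => by tauto

@[simp] theorem anti_edgeDown (D : Drawing n) (x y : ℝ) :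
    D.anti.EdgeDown (-y) (-x) ↔ D.EdgeRight x y := by
  simp only [EdgeDown, EdgeRight, anti_x₁, anti_x₂, anti_y₁, anti_y₂, neg_inj, neg_le_neg_iff,
    neg_lt_neg_iff]
  exact exists_congr fun i => by tauto

@[simp] theorem anti_edgeRight (D : Drawing n) (x y : ℝ) :
    D.anti.EdgeRight (-y) (-x) ↔ D.EdgeDown x y := by
  simp only [EdgeDown, EdgeRight, anti_x₁, anti_x₂, anti_y₁, anti_y₂, neg_inj, neg_le_neg_iff,
    neg_lt_neg_iff]
  exact exists_congr fun i => by tauto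

theorem anti_typeRight (D : Drawing n) (x y : ℝ) :
    D.anti.TypeRight (-y) (-x) ↔ D.TypeBottom x y := by
  simp [TypeRight, TypeBottom]

theorem anti_isBottomRight (D : Drawing n) (r : Fin n) :
    D.anti.IsBottomRight r ↔ D.IsBottomRight r := by
  simp [IsBottomRight, and_comm]

theorem isBottomRight_iff (D : Drawing n) (r : Fin n) :
    D.IsBottomRight r ↔ (∀ j, ¬ D.LeftOf r j) ∧ ∀ j, ¬ D.BelowOf j r := by
  rw [forall_not_rightOf_iff, forall_not_belowOf_iff, IsBottomRight]

theorem IsBottomRight.unique {D : Drawing n} {r r' : Fin n} (h : D.IsBottomRight r)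
    (h' : D.IsBottomRight r') : r = r' := by
  have := D.lt_x r
  have := D.lt_x r'
  have := D.lt_y r
  have := D.lt_y r'
  apply D.eq_of_overlap <;> linarith [h.1, h.2, h'.1, h'.2]

theorem IsIso.isBottomRight {D D' : Drawing n} {σ : Equiv.Perm (Fin n)} (h : D.IsIso D' σ)
    (r : Fin n) : D.IsBottomRight r ↔ D'.IsBottomRight (σ r) := by
  rw [isBottomRight_iff, isBottomRight_iff, h.no_right, h.no_below]

theorem exists_isBottomRight (D : Drawing n) : ∃ r, D.IsBottomRight r := by
  obtain ⟨h1, h2⟩ := D.outer_proper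
  obtain ⟨r, ⟨-, r1⟩, r2, -⟩ := D.exists_upper_left (x := D.outer.x₂) (y := D.outer.y₁)
    ⟨h1, le_rfl⟩ ⟨le_rfl, h2⟩
  exact ⟨r, le_antisymm (D.x₂_le_outer r) r1, le_antisymm r2 (D.outer_le_y₁ r)⟩

/-- `D'` arises from `D` by deleting `r` and sliding its top side down. -/
def VDelete (D : Drawing (n + 1)) (r : Fin (n + 1)) (D' : Drawing n) : Prop :=
  D.IsBottomRight r ∧ D'.outer = D.outer ∧ D.TypeRight (D.rect r).x₁ (D.rect r).y₂ ∧
    ∀ i, (D.BelowOf r (r.succAbove i) →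
        D'.rect i = { D.rect (r.succAbove i) with y₁ := (D.rect r).y₁ }) ∧
      (¬ D.BelowOf r (r.succAbove i) → D'.rect i = D.rect (r.succAbove i))

theorem _root_.Rectangulations.Box.anti_injective : Function.Injective Box.anti :=
  Function.LeftInverse.injective Box.anti_anti

theorem deletesTo_iff (D : Drawing (n + 1)) (D' : Drawing n) :
    D.DeletesTo D' ↔ ∃ r, D.VDelete r D' ∨ D.anti.VDelete r D'.anti := by
  simp only [DeletesTo, VDelete]
  refine exists_congr fun r => ?_
  have e1 : D'.anti.outer = D.anti.outer ↔ D'.outer = D.outer := by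
    rw [anti_outer, anti_outer, Box.anti_injective.eq_iff]
  have e2 : D.anti.TypeRight (D.anti.rect r).x₁ (D.anti.rect r).y₂ ↔
      D.TypeBottom (D.rect r).x₁ (D.rect r).y₂ := by
    rw [anti_x₁, anti_y₂, anti_typeRight]
  have e3 : ∀ i, D'.anti.rect i =
        { D.anti.rect (r.succAbove i) with y₁ := (D.anti.rect r).y₁ } ↔
      D'.rect i = { D.rect (r.succAbove i) with x₂ := (D.rect r).x₂ } := by
    intro i
    rw [← Box.anti_injective.eq_iff (a := D'.rect i)]
    rfl
  have e4 : ∀ i, D'.anti.rect i = D.anti.rect (r.succAbove i) ↔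
      D'.rect i = D.rect (r.succAbove i) := fun i => Box.anti_injective.eq_iff
  have e5 : ∀ (p : Prop) [Decidable p] (b c d : Box), (b = if p then c else d) ↔
      (p → b = c) ∧ (¬ p → b = d) := by
    intro p _ b c d
    split_ifs with hp <;> simp [hp]
  simp only [e1, e2, anti_isBottomRight, e3, e4, e5, anti_belowOf]
  tauto

/-- Renaming of the rectangles of a drawing. -/
def reindex (D : Drawing n) (ρ : Equiv.Perm (Fin n)) : Drawing n where
  outer := D.outer
  rect i := D.rect (ρ i)
  outer_proper := D.outer_proper
  rect_proper i := D.rect_proper (ρ i)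
  cover := by
    rw [← D.cover]
    exact ρ.surjective.iUnion_comp fun i => (D.rect i).closedSet
  disjoint i j hij := D.disjoint _ _ (ρ.injective.ne hij)
  generic p := by
    rw [← ρ.injective.injOn.ncard_image]
    refine le_trans (Set.ncard_le_ncard ?_) (D.generic p)
    rintro _ ⟨i, hi, rfl⟩
    exact hi

theorem isIso_reindex (D : Drawing n) (ρ : Equiv.Perm (Fin n)) : (D.reindex ρ).IsIso D ρ :=
  fun _ _ => ⟨Iff.rfl, Iff.rfl⟩

theorem reindex_typeRight (D : Drawing n) (ρ : Equiv.Perm (Fin n)) (x y : ℝ) :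
    (D.reindex ρ).TypeRight x y ↔ D.TypeRight x y := by
  simp only [TypeRight, EdgeUp, EdgeDown, EdgeLeft, EdgeRight, reindex]
  rw [ρ.exists_congr_right (q := fun i => (x = (D.rect i).x₁ ∨ x = (D.rect i).x₂) ∧
      (D.rect i).y₁ ≤ y ∧ y < (D.rect i).y₂),
    ρ.exists_congr_right (q := fun i => (x = (D.rect i).x₁ ∨ x = (D.rect i).x₂) ∧
      (D.rect i).y₁ < y ∧ y ≤ (D.rect i).y₂),
    ρ.exists_congr_right (q := fun i => (y = (D.rect i).y₁ ∨ y = (D.rect i).y₂) ∧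
      (D.rect i).x₁ ≤ x ∧ x < (D.rect i).x₂),
    ρ.exists_congr_right (q := fun i => (y = (D.rect i).y₁ ∨ y = (D.rect i).y₂) ∧
      (D.rect i).x₁ < x ∧ x ≤ (D.rect i).x₂)]

/-- The permutation that moves `r` to the last position and keeps the order of the rest. -/
def moveLast (r : Fin (n + 1)) : Equiv.Perm (Fin (n + 1)) :=
  finSuccEquivLast.trans (finSuccEquiv' r).symm

@[simp] theorem moveLast_castSucc (r : Fin (n + 1)) (i : Fin n) :
    moveLast r i.castSucc = r.succAbove i := by
  simp [moveLast]

@[simp] theorem moveLast_last (r : Fin (n + 1)) : moveLast r (Fin.last n) = r := by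
  simp [moveLast]

/-- Labels do not matter up to equivalence, so the deleted rectangle may be assumed to be the last
one, as after an insertion. -/
theorem VDelete.reindex {D : Drawing (n + 1)} {r : Fin (n + 1)} {D' : Drawing n}
    (h : D.VDelete r D') : (D.reindex (moveLast r)).VDelete (Fin.last n) D' := by
  obtain ⟨h1, h2, h3, h4⟩ := h
  have hr : (D.reindex (moveLast r)).rect (Fin.last n) = D.rect r := by
    simp [Drawing.reindex]
  refine ⟨?_, h2, ?_, fun i => ?_⟩
  · rw [(D.isIso_reindex _).isBottomRight]
    simpa using h1
  · rw [hr, reindex_typeRight]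
    exact h3
  · rw [hr, Fin.succAbove_last, ((D.isIso_reindex (moveLast r)) _ _).2]
    simpa [Drawing.reindex] using h4 i

/-- Deletion undoes insertion. The point at issue is that the corner of the new rectangle is a joint
of shape `⊢`: the left side of `s` continues upwards, and no wall ends there from the left because
the corner lies strictly inside an edge. -/
theorem VInsert.vDelete {D : Drawing n} {D' : Drawing (n + 1)} {l s : Fin n} {y : ℝ}
    (h : D.VInsert l s y D') : D'.VDelete (Fin.last n) D := by
  have f := h.code.facts
  have hy := h.outer_le
  refine ⟨h.isBottomRight_last, h.outer.symm, ?_, fun i => ?_⟩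
  · rw [h.new]
    refine ⟨⟨s.castSucc, ?_⟩, ⟨Fin.last n, ?_⟩, ⟨Fin.last n, ?_⟩, ?_⟩
    · rw [h.pushed s f.1 le_rfl]
      exact ⟨Or.inl rfl, le_rfl, h.height_lt⟩
    · rw [h.new]
      exact ⟨Or.inl rfl, hy, le_rfl⟩
    · rw [h.new]
      exact ⟨Or.inr rfl, le_rfl, (D.lt_x s).trans_le (D.x₂_le_outer s)⟩
    -- A horizontal side reaching the corner from the left belongs to a rectangle that either
    -- crosses the wall and overlaps `s`, or ends at it and overlaps `l`.
    · rintro ⟨i, h1, h2, h3⟩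
      obtain rfl | ⟨i, rfl⟩ := i.eq_castSucc_or_eq_last.symm
      · rw [h.new] at h2
        exact lt_irrefl _ h2
      have hiy := D.lt_y i
      rcases h.cases i with ⟨i1, i2, i3, i4⟩ | ⟨i1, i2, i4⟩ <;> rw [i4] at h1 h2 h3 <;>
        dsimp only at h1 h2 h3
      · linarith
      rcases h3.lt_or_eq with h3 | h3
      · obtain rfl := D.eq_of_overlap (i := i) (j := s) (h2.trans (D.lt_x s)) h3
          (by rcases h1 with h1 | h1 <;> rcases i2 with i2 | i2 <;> linarith [h.height_lt])
          (by rcases i2 with i2 | i2 <;> linarith [f.1])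
        exact lt_irrefl _ h2
      · by_cases hl : l = s
        · linarith [f.2.2.2 hl, D.outer_le_x₁ i]
        · have hlx := f.2.2.1 hl
          have := D.lt_x l
          have := h.lt_height
          have := h.height_lt_left
          obtain rfl := D.eq_of_overlap (i := i) (j := l) (by linarith) (by linarith)
            (by rcases h1 with h1 | h1 <;> linarith) (by rcases h1 with h1 | h1 <;> linarith)
          rcases h1 with h1 | h1 <;> linarith
  · rw [Fin.succAbove_last]
    rw [h.last_belowOf_iff_le]
    refine ⟨fun hi => ?_, fun hi => ?_⟩
    · rw [h.pushed i hi.1 hi.2, h.new]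
      simp [← hi.1]
    · exact (h.unpushed i fun h1 => not_le.1 fun h2 => hi ⟨h1, h2⟩).symm

/-- A rectangle on top of `r` that protrudes to the left would have a bottom side leaving the joint
to the left, which the shape `⊢` excludes. -/
theorem TypeRight.le_of_belowOf {D : Drawing n} {r j : Fin n}
    (h : D.TypeRight (D.rect r).x₁ (D.rect r).y₂) (hj : D.BelowOf r j) :
    (D.rect r).x₁ ≤ (D.rect j).x₁ := by
  by_contra! hc
  exact h.2.2.2 ⟨j, Or.inl hj.1, hc, hj.2.1.le⟩

theorem TypeRight.lt_outer {D : Drawing n} {r : Fin n} {x : ℝ}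
    (h : D.TypeRight x (D.rect r).y₂) : (D.rect r).y₂ < D.outer.y₂ := by
  obtain ⟨i, -, -, hi⟩ := h.1
  exact hi.trans_le (D.y₂_le_outer i)

/-- Insertion undoes deletion. The code is found at the top-left corner of the deleted rectangle:
`s` contains the upper right germ, `l` the upper left germ, and `l = s` if the corner is on the left
boundary. -/
theorem VDelete.vInsert {D' : Drawing (n + 1)} {D : Drawing n}
    (h : D'.VDelete (Fin.last n) D) : ∃ l s y, D.VInsert l s y D' := by
  obtain ⟨⟨h1, h1'⟩, h2, h3, h4⟩ := h
  simp only [Fin.succAbove_last] at h4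
  have hlx := D'.lt_x (Fin.last n)
  have hly := D'.lt_y (Fin.last n)
  have htop := h3.lt_outer
  have hbelow : ∀ i : Fin n, D'.BelowOf (Fin.last n) i.castSucc →
      D.rect i = { D'.rect i.castSucc with y₁ := (D'.rect (Fin.last n)).y₁ } :=
    fun i => (h4 i).1
  have hother : ∀ i : Fin n, ¬ D'.BelowOf (Fin.last n) i.castSucc →
      D.rect i = D'.rect i.castSucc := fun i => (h4 i).2
  obtain ⟨s, ⟨s1, s2⟩, s3, s4⟩ := D'.exists_upper_right (x := (D'.rect (Fin.last n)).x₁)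
    (y := (D'.rect (Fin.last n)).y₂) ⟨D'.outer_le_x₁ _, hlx.trans_le (D'.x₂_le_outer _)⟩
    ⟨by linarith, htop⟩
  obtain rfl | ⟨s, rfl⟩ := s.eq_castSucc_or_eq_last.symm
  · exact (lt_irrefl _ s4).elim
  have hsy : (D'.rect (Fin.last n)).y₂ = (D'.rect s.castSucc).y₁ := by
    refine le_antisymm ?_ s3
    by_contra! hc
    exact (Fin.castSucc_lt_last s).ne (D'.eq_of_overlap (by linarith) s2 hc (by linarith))
  have hs : D'.BelowOf (Fin.last n) s.castSucc := ⟨hsy, s2, by linarith⟩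
  have hsx : (D'.rect s.castSucc).x₁ = (D'.rect (Fin.last n)).x₁ :=
    le_antisymm s1 (h3.le_of_belowOf hs)
  have hsr := hbelow s hs
  have hsc : ∀ j, ¬ D.BelowOf j s := by
    rw [forall_not_belowOf_iff, hsr, h2]
    exact h1'
  suffices H : ∃ l, D.VCode l s ∧ (D.rect l).y₁ < (D'.rect (Fin.last n)).y₂ ∧
      (D'.rect (Fin.last n)).y₂ < (D.rect l).y₂ by
    obtain ⟨l, hl, hl1, hl2⟩ := H
    refine ⟨l, s, (D'.rect (Fin.last n)).y₂, hl, hl1, hl2, by rw [hsr]; exact s4, h2.symm, ?_,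
      fun i hi hi' => ?_, fun i hi => ?_⟩
    · rw [h2, ← h1, ← h1', hsr, hsx]
    · have hb : D'.BelowOf (Fin.last n) i.castSucc := by
        by_contra hc
        have hir := hother i hc
        rw [hir, hsr] at hi'
        rw [hir, h2] at hi
        have := D'.lt_x i.castSucc
        have := D'.lt_y i.castSucc
        have := D'.x₂_le_outer i.castSucc
        exact (Fin.castSucc_lt_last i).ne (D'.eq_of_overlap (by linarith) (by linarith)
          (by linarith) (by linarith))
      rw [hbelow i hb]
      ext <;> simp [hb.1]
    · refine (hother i fun hb => ?_).symm
      have hir := hbelow i hb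
      have := hi (by rw [hir, h2]; exact h1')
      rw [hir, hsr] at this
      have := h3.le_of_belowOf hb
      linarith
  by_cases hx : D'.outer.x₁ < (D'.rect (Fin.last n)).x₁
  · obtain ⟨l, ⟨l1, l2⟩, l3, l4⟩ := D'.exists_upper_left (x := (D'.rect (Fin.last n)).x₁)
      (y := (D'.rect (Fin.last n)).y₂) ⟨hx, hlx.le.trans (D'.x₂_le_outer _)⟩
      ⟨by linarith [D'.outer_le_y₁ (Fin.last n)], htop⟩
    obtain rfl | ⟨l, rfl⟩ := l.eq_castSucc_or_eq_last.symm
    · exact (lt_irrefl _ l4).elim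
    have hll : (D'.rect l.castSucc).x₂ = (D'.rect (Fin.last n)).x₁ := by
      refine le_antisymm ?_ l2
      by_contra! hc
      have := D'.eq_of_overlap (i := l.castSucc) (j := s.castSucc) (by linarith) (by linarith)
        (by linarith) (by linarith)
      rw [this] at l1
      linarith
    -- Equality would make the bottom side of `l` a wall that leaves the joint to the left.
    have hlt : (D'.rect l.castSucc).y₁ < (D'.rect (Fin.last n)).y₂ := by
      refine lt_of_le_of_ne l3 fun hc => h3.2.2.2 ⟨l.castSucc, Or.inl hc.symm, l1, l2⟩
    have hlr := hother l fun hc => by linarith [h3.le_of_belowOf hc]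
    refine ⟨l, ⟨hsc, Or.inl ⟨?_, ?_, ?_⟩⟩, ?_, ?_⟩ <;> rw [hlr] <;> (try rw [hsr]) <;>
      linarith
  · refine ⟨s, ⟨hsc, Or.inr ⟨rfl, ?_⟩⟩, ?_, ?_⟩
    · rw [forall_not_leftOf_iff, hsr, h2]
      exact hsx.trans (le_antisymm (not_lt.1 hx) (D'.outer_le_x₁ _))
    · rw [hsr]
      exact hly
    · rw [hsr]
      exact s4

/-! ### The boxes left after a deletion form a drawing. -/

open Classical in
/-- The boxes of the drawing that arises from `D` when the last rectangle is deleted. -/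
noncomputable def deleteRect (D : Drawing (n + 1)) (i : Fin n) : Box :=
  if D.BelowOf (Fin.last n) i.castSucc then
    { D.rect i.castSucc with y₁ := (D.rect (Fin.last n)).y₁ }
  else D.rect i.castSucc

theorem deleteRect_of_belowOf (D : Drawing (n + 1)) {i : Fin n} (hi : D.BelowOf (Fin.last n) i.castSucc) :
    D.deleteRect i = { D.rect i.castSucc with y₁ := (D.rect (Fin.last n)).y₁ } := if_pos hi

theorem deleteRect_of_not (D : Drawing (n + 1)) {i : Fin n} (hi : ¬ D.BelowOf (Fin.last n) i.castSucc) :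
    D.deleteRect i = D.rect i.castSucc := if_neg hi

/-- The rectangles above the deleted one cover its whole top side, so their downward extensions
cover its area. -/
theorem deleteRect_cover {D : Drawing (n + 1)}
    (ht : D.TypeRight (D.rect (Fin.last n)).x₁ (D.rect (Fin.last n)).y₂) :
    ⋃ i, (D.deleteRect i).closedSet = D.outer.closedSet := by
  have hlx := D.lt_x (Fin.last n)
  have hly := D.lt_y (Fin.last n)
  have htop := ht.lt_outer
  apply Set.Subset.antisymm
  · refine Set.iUnion_subset fun i => ?_
    by_cases hi : D.BelowOf (Fin.last n) i.castSucc
    · rw [D.deleteRect_of_belowOf hi]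
      exact Set.prod_mono (Set.Icc_subset_Icc (D.outer_le_x₁ _) (D.x₂_le_outer _))
        (Set.Icc_subset_Icc (D.outer_le_y₁ (Fin.last n)) (D.y₂_le_outer _))
    · rw [D.deleteRect_of_not hi]
      exact D.closedSet_subset _
  · rintro ⟨px, py⟩ hp
    rw [← D.cover, Set.mem_iUnion] at hp
    obtain ⟨i, hi⟩ := hp
    rw [Set.mem_iUnion]
    obtain rfl | ⟨i, rfl⟩ := i.eq_castSucc_or_eq_last.symm
    · obtain ⟨⟨p1, p2⟩, p3, p4⟩ := hi
      dsimp only at p1 p2 p3 p4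
      suffices H : ∃ k, D.BelowOf (Fin.last n) k ∧ (D.rect k).x₁ ≤ px ∧ px ≤ (D.rect k).x₂ by
        obtain ⟨k, hk, k1, k2⟩ := H
        obtain rfl | ⟨k, rfl⟩ := k.eq_castSucc_or_eq_last.symm
        · exact (hly.ne' hk.1).elim
        refine ⟨k, ?_⟩
        rw [D.deleteRect_of_belowOf hk]
        refine ⟨⟨k1, k2⟩, p3, p4.trans ?_⟩
        rw [hk.1]
        exact (D.lt_y _).le
      rcases p2.lt_or_eq with p2 | p2
      · obtain ⟨k, ⟨k1, k2⟩, k3, k4⟩ := D.exists_upper_right (x := px)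
          (y := (D.rect (Fin.last n)).y₂) ⟨(D.outer_le_x₁ _).trans p1, p2.trans_le
            (D.x₂_le_outer _)⟩ ⟨(D.outer_le_y₁ _).trans hly.le, htop⟩
        refine ⟨k, ⟨le_antisymm ?_ k3, by linarith, by linarith⟩, k1, k2.le⟩
        by_contra! hc
        obtain rfl := D.eq_of_overlap (i := k) (j := Fin.last n) (by linarith) (by linarith) hc
          (by linarith)
        exact lt_irrefl _ k4
      -- At the right end of the top side the upper right germ may leave the outer rectangle, hence
      -- the upper left one.
      · obtain ⟨k, ⟨k1, k2⟩, k3, k4⟩ := D.exists_upper_left (x := px)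
          (y := (D.rect (Fin.last n)).y₂) ⟨by linarith [D.outer_le_x₁ (Fin.last n)],
            p2.le.trans (D.x₂_le_outer _)⟩ ⟨(D.outer_le_y₁ _).trans hly.le, htop⟩
        refine ⟨k, ⟨le_antisymm ?_ k3, by linarith, by linarith⟩, k1.le, k2⟩
        by_contra! hc
        obtain rfl := D.eq_of_overlap (i := k) (j := Fin.last n) (by linarith) (by linarith) hc
          (by linarith)
        exact lt_irrefl _ k4
    · refine ⟨i, ?_⟩
      by_cases hb : D.BelowOf (Fin.last n) i.castSucc
      · rw [D.deleteRect_of_belowOf hb]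
        exact ⟨hi.1, (by linarith [hb.1, hi.2.1]), hi.2.2⟩
      · rw [D.deleteRect_of_not hb]
        exact hi

/-- A rectangle that is not above the last one stays away from the area of the last one. -/
theorem not_overlap_last {D : Drawing (n + 1)} (hr : D.IsBottomRight (Fin.last n))
    {i : Fin n} (h1 : (D.rect (Fin.last n)).x₁ < (D.rect i.castSucc).x₂)
    (h2 : (D.rect i.castSucc).y₁ < (D.rect (Fin.last n)).y₂) : False := by
  have := D.lt_x i.castSucc
  have := D.lt_y i.castSucc
  have := D.x₂_le_outer i.castSucc
  have := D.outer_le_y₁ i.castSucc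
  exact (Fin.castSucc_lt_last i).ne (D.eq_of_overlap (by linarith [hr.1]) h1 h2
    (by linarith [hr.2]))

/-- Extended rectangles do not protrude to the left, so any new overlap would lie in the area of the
deleted rectangle; `not_overlap_last` keeps the unextended rectangles out of it. -/
theorem deleteRect_disjoint {D : Drawing (n + 1)} (hr : D.IsBottomRight (Fin.last n))
    (ht : D.TypeRight (D.rect (Fin.last n)).x₁ (D.rect (Fin.last n)).y₂)
    (i j : Fin n) (hij : i ≠ j) :
    Disjoint (D.deleteRect i).openSet (D.deleteRect j).openSet := by
  rw [disjoint_openSet_iff]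
  have hne : i.castSucc ≠ j.castSucc := fun h => hij (Fin.castSucc_injective _ h)
  have hiy := D.lt_y i.castSucc
  have hjy := D.lt_y j.castSucc
  by_cases hi : D.BelowOf (Fin.last n) i.castSucc <;>
    by_cases hj : D.BelowOf (Fin.last n) j.castSucc
  · rw [D.deleteRect_of_belowOf hi, D.deleteRect_of_belowOf hj]
    rintro ⟨⟨-, h1, h2, -⟩, -⟩
    exact hne (D.eq_of_overlap h1 h2 (by linarith [hi.1, hj.1]) (by linarith [hi.1, hj.1]))
  · rw [D.deleteRect_of_belowOf hi, D.deleteRect_of_not hj]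
    rintro ⟨⟨-, h1, h2, -⟩, -, h3, h4, -⟩
    dsimp only at h1 h2 h3 h4
    by_cases hc : (D.rect i.castSucc).y₁ < (D.rect j.castSucc).y₂
    · exact hne (D.eq_of_overlap h1 h2 hc h4)
    · exact not_overlap_last hr (i := j) (by linarith [ht.le_of_belowOf hi])
        (by linarith [hi.1])
  · rw [D.deleteRect_of_not hi, D.deleteRect_of_belowOf hj]
    rintro ⟨⟨-, h1, h2, -⟩, -, h3, h4, -⟩
    dsimp only at h1 h2 h3 h4
    by_cases hc : (D.rect j.castSucc).y₁ < (D.rect i.castSucc).y₂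
    · exact hne (D.eq_of_overlap h1 h2 h3 hc)
    · exact not_overlap_last hr (i := i) (by linarith [ht.le_of_belowOf hj])
        (by linarith [hj.1])
  · rw [D.deleteRect_of_not hi, D.deleteRect_of_not hj, ← disjoint_openSet_iff]
    exact D.disjoint _ _ hne

/-- Injects the rectangles at `p` into those of `D` at some point. To the right of the left side of
the deleted rectangle, `p` is lifted to the height of its top side if it is lower. Otherwise `p` is
kept: an extended rectangle that meets it below this height must have its left side through `p`, so
there is at most one, and the deleted rectangle takes its place. -/
theorem deleteRect_generic {D : Drawing (n + 1)} (hr : D.IsBottomRight (Fin.last n))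
    (ht : D.TypeRight (D.rect (Fin.last n)).x₁ (D.rect (Fin.last n)).y₂)
    (p : ℝ × ℝ) : {i | p ∈ (D.deleteRect i).closedSet}.ncard ≤ 3 := by
  classical
  obtain ⟨px, py⟩ := p
  by_cases hp : (D.rect (Fin.last n)).x₁ < px
  · refine le_trans (Set.ncard_le_ncard_of_injOn (t := {i | ((px, max py (D.rect (Fin.last n)).y₂)
      ∈ (D.rect i).closedSet)}) Fin.castSucc ?_ (Fin.castSucc_injective n).injOn) (D.generic _)
    intro i hi
    by_cases hb : D.BelowOf (Fin.last n) i.castSucc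
    · rw [Set.mem_ofPred_eq, D.deleteRect_of_belowOf hb] at hi
      obtain ⟨h1, h2, h3⟩ := hi
      have := D.lt_y i.castSucc
      exact ⟨h1, le_max_of_le_right hb.1.ge, max_le h3 (by linarith [hb.1])⟩
    · rw [Set.mem_ofPred_eq, D.deleteRect_of_not hb] at hi
      have hle : (D.rect (Fin.last n)).y₂ ≤ py := by
        by_contra! hc
        exact not_overlap_last hr (i := i) (hp.trans_le hi.1.2) (hi.2.1.trans_lt hc)
      rw [Set.mem_ofPred_eq, max_eq_left hle]
      exact hi
  · refine le_trans (Set.ncard_le_ncard_of_injOn (t := {i | (px, py) ∈ (D.rect i).closedSet})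
      (fun i => if D.BelowOf (Fin.last n) i.castSucc ∧ py < (D.rect (Fin.last n)).y₂ then
        Fin.last n else i.castSucc) ?_ ?_) (D.generic (px, py))
    · intro i hi
      rw [Set.mem_ofPred_eq] at hi
      have hlx := D.lt_x (Fin.last n)
      rw [Set.mem_ofPred_eq]
      split_ifs with hc
      · rw [D.deleteRect_of_belowOf hc.1] at hi
        obtain ⟨⟨h1, h2⟩, h3, h4⟩ := hi
        have := ht.le_of_belowOf hc.1
        dsimp only at h1 h2 h3 h4
        exact ⟨⟨by linarith, by linarith⟩, h3, hc.2.le⟩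
      · by_cases hb : D.BelowOf (Fin.last n) i.castSucc
        · rw [D.deleteRect_of_belowOf hb] at hi
          exact ⟨hi.1, hb.1 ▸ not_lt.1 fun h => hc ⟨hb, h⟩, hi.2.2⟩
        · rwa [D.deleteRect_of_not hb] at hi
    · intro i hi j hj hij
      rw [Set.mem_ofPred_eq] at hi hj
      have key : ∀ k : Fin n, (px, py) ∈ (D.deleteRect k).closedSet →
          D.BelowOf (Fin.last n) k.castSucc → (D.rect k.castSucc).x₁ = px := by
        intro k hk hb
        rw [D.deleteRect_of_belowOf hb] at hk
        exact le_antisymm hk.1.1 ((not_lt.1 hp).trans (ht.le_of_belowOf hb))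
      dsimp only at hij
      split_ifs at hij with h1 h2 h2
      · have e1 := key i hi h1.1
        have e2 := key j hj h2.1
        have := D.lt_x i.castSucc
        have := D.lt_x j.castSucc
        have := D.lt_y i.castSucc
        have := D.lt_y j.castSucc
        exact Fin.castSucc_injective _ (D.eq_of_overlap (by linarith) (by linarith)
          (by linarith [h1.1.1, h2.1.1]) (by linarith [h1.1.1, h2.1.1]))
      · exact ((Fin.castSucc_lt_last j).ne' hij).elim
      · exact ((Fin.castSucc_lt_last i).ne hij).elim
      · exact Fin.castSucc_injective _ hij

theorem exists_vDelete_last {D : Drawing (n + 1)} (hr : D.IsBottomRight (Fin.last n))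
    (ht : D.TypeRight (D.rect (Fin.last n)).x₁ (D.rect (Fin.last n)).y₂) :
    ∃ D' : Drawing n, D.VDelete (Fin.last n) D' := by
  refine ⟨⟨D.outer, D.deleteRect, D.outer_proper, fun i => ?_, deleteRect_cover ht,
    deleteRect_disjoint hr ht, deleteRect_generic hr ht⟩, hr, rfl, ht, fun i => ?_⟩
  · by_cases hb : D.BelowOf (Fin.last n) i.castSucc
    · rw [D.deleteRect_of_belowOf hb]
      exact ⟨D.lt_x _, by linarith [hb.1, D.lt_y (Fin.last n), D.lt_y i.castSucc]⟩
    · rw [D.deleteRect_of_not hb]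
      exact D.rect_proper _
  · rw [Fin.succAbove_last]
    exact ⟨D.deleteRect_of_belowOf, D.deleteRect_of_not⟩

/-- The T-joint at the top-left corner of the bottom-right rectangle has shape `⊢` or `⊤`. -/
theorem typeRight_or_typeBottom (D : Drawing (n + 2)) {r : Fin (n + 2)}
    (hr : D.IsBottomRight r) : D.TypeRight (D.rect r).x₁ (D.rect r).y₂ ∨
      D.TypeBottom (D.rect r).x₁ (D.rect r).y₂ := by
  have hrx := D.lt_x r
  have hry := D.lt_y r
  have ox := D.outer_le_x₁ r
  have ox' := D.x₂_le_outer r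
  have oy := D.outer_le_y₁ r
  have oy' := D.y₂_le_outer r
  have hd : D.EdgeDown (D.rect r).x₁ (D.rect r).y₂ := ⟨r, Or.inl rfl, hry, le_rfl⟩
  have hr' : D.EdgeRight (D.rect r).x₁ (D.rect r).y₂ := ⟨r, Or.inr rfl, le_rfl, hrx⟩
  by_cases hu : D.EdgeUp (D.rect r).x₁ (D.rect r).y₂ <;>
    by_cases hl : D.EdgeLeft (D.rect r).x₁ (D.rect r).y₂
  -- With walls both upwards and to the left, the four germs at the corner belong to four different
  -- rectangles, contrary to genericity.
  · exfalso
    obtain ⟨i, i1, i2, i3⟩ := hu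
    obtain ⟨j, j1, j2, j3⟩ := hl
    have := D.y₂_le_outer i
    have := D.outer_le_x₁ j
    obtain ⟨a, ⟨a1, a2⟩, a3, a4⟩ := D.exists_upper_right (x := (D.rect r).x₁)
      (y := (D.rect r).y₂) ⟨ox, by linarith⟩ ⟨by linarith, by linarith⟩
    obtain ⟨b, ⟨b1, b2⟩, b3, b4⟩ := D.exists_upper_left (x := (D.rect r).x₁)
      (y := (D.rect r).y₂) ⟨by linarith, by linarith⟩ ⟨by linarith, by linarith⟩
    obtain ⟨c, ⟨c1, c2⟩, c3, c4⟩ := D.exists_lower_left (x := (D.rect r).x₁)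
      (y := (D.rect r).y₂) ⟨by linarith, by linarith⟩ ⟨by linarith, by linarith⟩
    have hix := D.lt_x i
    have hjy := D.lt_y j
    have hab : a ≠ b := by
      rintro rfl
      obtain rfl := D.eq_of_overlap (i := i) (j := a) (by rcases i1 with h | h <;> linarith)
        (by rcases i1 with h | h <;> linarith) (by linarith) (by linarith)
      rcases i1 with h | h <;> linarith
    have hbc : b ≠ c := by
      rintro rfl
      obtain rfl := D.eq_of_overlap (i := j) (j := b) (by linarith) (by linarith)
        (by rcases j1 with h | h <;> linarith) (by rcases j1 with h | h <;> linarith)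
      rcases j1 with h | h <;> linarith
    have hac : a ≠ c := by
      rintro rfl
      obtain rfl := D.eq_of_overlap (i := a) (j := r) (by linarith) (by linarith) (by linarith)
        (by linarith)
      linarith
    have har : a ≠ r := by
      rintro rfl
      linarith
    have hbr : b ≠ r := by
      rintro rfl
      linarith
    have hcr : c ≠ r := by
      rintro rfl
      linarith
    have hcard : ({a, b, c, r} : Finset (Fin (n + 2))).card = 4 := by
      rw [Finset.card_insert_of_notMem (by simp [hab, hac, har]),
        Finset.card_insert_of_notMem (by simp [hbc, hbr]), Finset.card_pair hcr]
    have hg := D.generic ((D.rect r).x₁, (D.rect r).y₂)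
    have hsub : (({a, b, c, r} : Finset (Fin (n + 2))) : Set (Fin (n + 2))) ⊆
        {i | ((D.rect r).x₁, (D.rect r).y₂) ∈ (D.rect i).closedSet} := by
      intro k hk
      simp only [Finset.coe_insert, Finset.coe_singleton, Set.mem_insert_iff,
        Set.mem_singleton_iff] at hk
      rcases hk with rfl | rfl | rfl | rfl <;>
        exact ⟨⟨by linarith, by linarith⟩, by linarith, by linarith⟩
    have := Set.ncard_le_ncard hsub
    rw [Set.ncard_coe_finset, hcard] at this
    omega
  · exact Or.inl ⟨hu, hd, hr', hl⟩
  · exact Or.inr ⟨hl, hr', hd, hu⟩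
  -- Away from the left boundary the lower left neighbour supplies a wall upwards or to the left; on
  -- it the boundary continues upwards unless `r` is everything, which is impossible with at least
  -- two rectangles.
  · exfalso
    by_cases hx : D.outer.x₁ < (D.rect r).x₁
    · obtain ⟨c, ⟨c1, c2⟩, c3, c4⟩ := D.exists_lower_left (x := (D.rect r).x₁)
        (y := (D.rect r).y₂) ⟨by linarith, by linarith⟩ ⟨by linarith, by linarith⟩
      rcases c4.lt_or_eq with c4 | c4
      · refine hu ⟨c, Or.inr (le_antisymm c2 ?_), c3.le, c4⟩
        by_contra! hc
        obtain rfl := D.eq_of_overlap (i := c) (j := r) (by linarith) hc (by linarith)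
          (by linarith)
        linarith
      · exact hl ⟨c, Or.inr c4, c1, c2⟩
    · by_cases hy : (D.rect r).y₂ < D.outer.y₂
      · obtain ⟨a, ⟨a1, a2⟩, a3, a4⟩ := D.exists_upper_right (x := (D.rect r).x₁)
          (y := (D.rect r).y₂) ⟨ox, by linarith⟩ ⟨by linarith, hy⟩
        exact hu ⟨a, Or.inl (by linarith [D.outer_le_x₁ a]), a3, a4⟩
      · obtain ⟨j, hj⟩ := exists_ne r
        have := D.lt_x j
        have := D.lt_y j
        have := D.outer_le_x₁ j
        have := D.outer_le_y₁ j
        have := D.x₂_le_outer j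
        have := D.y₂_le_outer j
        exact hj (D.eq_of_overlap (by linarith [hr.1]) (by linarith) (by linarith)
          (by linarith [hr.2]))

/-! ### Insertions up to isomorphism -/

theorem InsertsTo.anti {D : Drawing n} {D' : Drawing (n + 1)} {e : Segment}
    (h : D.InsertsTo e D') : D.anti.InsertsTo e.anti D'.anti := by
  cases e with
  | vert x a b =>
    obtain ⟨y, h1, h2, h3, h4, h5⟩ := h
    refine ⟨-y, neg_lt_neg h2, neg_lt_neg h1, ?_, ?_, fun i => ?_⟩
    · rw [anti_outer, anti_outer, h3]
    · rw [anti_rect, h4]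
      rfl
    · rw [anti_rect, h5]
      simp only [anti_x₂, anti_outer_x₂, neg_inj, anti_y₂, neg_le_neg_iff]
      split_ifs <;> rfl
  | horiz x a b =>
    obtain ⟨y, h1, h2, h3, h4, h5⟩ := h
    refine ⟨-y, neg_lt_neg h2, neg_lt_neg h1, ?_, ?_, fun i => ?_⟩
    · rw [anti_outer, anti_outer, h3]
    · rw [anti_rect, h4]
      rfl
    · rw [anti_rect, h5]
      simp only [anti_y₁, anti_outer_y₁, neg_inj, anti_x₁, neg_le_neg_iff]
      split_ifs <;> rfl

theorem anti_insertsTo (D : Drawing n) (D' : Drawing (n + 1)) (e : Segment) :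
    D.anti.InsertsTo e.anti D'.anti ↔ D.InsertsTo e D' := by
  refine ⟨fun h => ?_, InsertsTo.anti⟩
  simpa only [anti_anti, Segment.anti_anti] using h.anti

theorem insertsTo_vert_iff {D : Drawing n} {D' : Drawing (n + 1)} {l s : Fin n}
    (hc : D.IsCode (true, l, s)) :
    D.InsertsTo (D.seg (true, l, s)) D' ↔ ∃ y, D.VInsert l s y D' :=
  vInsert_iff D l s D' hc

theorem insertsTo_horiz_iff {D : Drawing n} {D' : Drawing (n + 1)} {l s : Fin n}
    (hc : D.IsCode (false, l, s)) :
    D.InsertsTo (D.seg (false, l, s)) D' ↔ ∃ y, D.anti.VInsert l s y D'.anti := by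
  rw [← anti_insertsTo, ← vInsert_iff D.anti l s D'.anti hc, anti_vseg]
  rfl

theorem InsertsTo.isBottomRight_last {D : Drawing n} {D' : Drawing (n + 1)} {e : Segment}
    (h : D.InsertsTo e D') : D'.IsBottomRight (Fin.last n) := by
  cases e <;> obtain ⟨y, -, -, h3, h4, -⟩ := h <;> simp [IsBottomRight, h3, h4]

/-- Either the side shared by `l` and `s` continues upwards from the corner, or the corner is on the
left boundary and nothing leaves it to the left. Thus the joint distinguishes vertical from
horizontal insertions. -/
theorem NewCode.not_typeBottom {D : Drawing n} {r l s : Fin n} (h : D.NewCode r l s) :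
    ¬ D.TypeBottom (D.rect r).x₁ (D.rect r).y₂ := by
  rintro ⟨⟨i, -, h1, -⟩, -, -, h2⟩
  obtain ⟨h3, ⟨h4, h5⟩ | ⟨-, h4, -⟩⟩ := h
  · refine h2 ⟨l, Or.inr h4.1.symm, h4.2.1.le, ?_⟩
    rw [h3.1]
    exact h5.2.2
  · rw [forall_not_leftOf_iff] at h4
    linarith [D.outer_le_x₁ i]

theorem not_vInsert_of_vInsert_anti {D₁ D₂ : Drawing n} {D₁' D₂' : Drawing (n + 1)}
    {τ : Equiv.Perm (Fin (n + 1))} (h : D₁'.IsIso D₂' τ) (hτ : τ (Fin.last n) = Fin.last n)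
    {l₁ s₁ l₂ s₂ : Fin n} {y₁ y₂ : ℝ} (h₁ : D₁.VInsert l₁ s₁ y₁ D₁')
    (h₂ : D₂.anti.VInsert l₂ s₂ y₂ D₂'.anti) : False := by
  have hn := (h.newCode _ _ _).1 ((h₁.newCode_iff _ _).2 ⟨rfl, rfl⟩)
  rw [hτ] at hn
  refine hn.not_typeBottom ?_
  rw [← anti_typeRight]
  exact h₂.vDelete.2.2.1

/-- Equivalent results of insertions come from equivalent drawings and corresponding insertion
edges. -/
theorem IsIso.of_insertsTo {D₁ D₂ : Drawing n} {D₁' D₂' : Drawing (n + 1)} {c₁ c₂ : Code n}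
    {τ : Equiv.Perm (Fin (n + 1))} (hc₁ : D₁.IsCode c₁) (hc₂ : D₂.IsCode c₂)
    (h₁ : D₁.InsertsTo (D₁.seg c₁) D₁') (h₂ : D₂.InsertsTo (D₂.seg c₂) D₂')
    (h : D₁'.IsIso D₂' τ) : ∃ σ, D₁.IsIso D₂ σ ∧ c₂ = codeMap σ c₁ := by
  have hτ : τ (Fin.last n) = Fin.last n :=
    ((h.isBottomRight _).1 h₁.isBottomRight_last).unique h₂.isBottomRight_last
  obtain ⟨σ, rfl⟩ := exists_extendPerm_eq τ hτ
  refine ⟨σ, ?_⟩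
  obtain ⟨_ | _, l₁, s₁⟩ := c₁ <;> obtain ⟨_ | _, l₂, s₂⟩ := c₂
  · obtain ⟨y₁, h₁⟩ := (insertsTo_horiz_iff hc₁).1 h₁
    obtain ⟨y₂, h₂⟩ := (insertsTo_horiz_iff hc₂).1 h₂
    obtain ⟨g1, rfl, rfl⟩ := h₁.restrict h₂ h.anti
    exact ⟨by simpa only [anti_anti] using g1.anti, rfl⟩
  · obtain ⟨y₁, h₁⟩ := (insertsTo_horiz_iff hc₁).1 h₁
    obtain ⟨y₂, h₂⟩ := (insertsTo_vert_iff hc₂).1 h₂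
    exact (not_vInsert_of_vInsert_anti h.symm (by rw [Equiv.symm_apply_eq, hτ]) h₂ h₁).elim
  · obtain ⟨y₁, h₁⟩ := (insertsTo_vert_iff hc₁).1 h₁
    obtain ⟨y₂, h₂⟩ := (insertsTo_horiz_iff hc₂).1 h₂
    exact (not_vInsert_of_vInsert_anti h hτ h₁ h₂).elim
  · obtain ⟨y₁, h₁⟩ := (insertsTo_vert_iff hc₁).1 h₁
    obtain ⟨y₂, h₂⟩ := (insertsTo_vert_iff hc₂).1 h₂
    obtain ⟨g1, rfl, rfl⟩ := h₁.restrict h₂ h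
    exact ⟨g1, rfl⟩

/-- Insertions on corresponding edges of equivalent drawings yield equivalent drawings. -/
theorem IsIso.insertsTo {D₁ D₂ : Drawing n} {D₁' D₂' : Drawing (n + 1)} {c : Code n}
    {σ : Equiv.Perm (Fin n)} (h : D₁.IsIso D₂ σ) (hc : D₁.IsCode c)
    (h₁ : D₁.InsertsTo (D₁.seg c) D₁') (h₂ : D₂.InsertsTo (D₂.seg (codeMap σ c)) D₂') :
    D₁'.IsIso D₂' (extendPerm σ) := by
  have hc₂ := (h.isCode c).1 hc
  obtain ⟨_ | _, l, s⟩ := c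
  · obtain ⟨y₁, h₁⟩ := (insertsTo_horiz_iff hc).1 h₁
    obtain ⟨y₂, h₂⟩ := (insertsTo_horiz_iff hc₂).1 h₂
    simpa only [anti_anti] using (h₁.extend h₂ h.anti).anti
  · obtain ⟨y₁, h₁⟩ := (insertsTo_vert_iff hc).1 h₁
    obtain ⟨y₂, h₂⟩ := (insertsTo_vert_iff hc₂).1 h₂
    exact h₁.extend h₂ h

/-! ### The first and the last insertion edge -/

theorem exists_vcode_self (D : Drawing n) : ∃ s, D.VCode s s := by
  obtain ⟨h1, h2⟩ := D.outer_proper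
  obtain ⟨s, ⟨s1, -⟩, s2, -⟩ := D.exists_upper_right (x := D.outer.x₁) (y := D.outer.y₁)
    ⟨le_rfl, h1⟩ ⟨le_rfl, h2⟩
  exact ⟨s, (D.forall_not_belowOf_iff s).2 (le_antisymm s2 (D.outer_le_y₁ s)),
    Or.inr ⟨rfl, (D.forall_not_leftOf_iff s).2 (le_antisymm s1 (D.outer_le_x₁ s))⟩⟩

theorem VCode.vseg_le {D : Drawing n} {s l' s' : Fin n} (h : D.VCode s s)
    (h' : D.VCode l' s') : (D.vseg s s).Le (D.vseg l' s') := by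
  have hx := h.facts.2.2.2 rfl
  rcases (D.outer_le_x₁ s').lt_or_eq with hs | hs
  · exact Or.inl (hx.trans_lt hs)
  · obtain rfl := h.right_eq h' (hx.trans hs)
    rcases h'.2 with hl | ⟨rfl, -⟩
    · exact ((D.forall_not_leftOf_iff s).2 hx _ hl).elim
    · exact Segment.le_refl _

/-- A diagonal code describes the left side of the rectangle in the bottom-left corner, which
precedes all other insertion edges. -/
theorem insertionIndex_eq_one_iff {D : Drawing n} {c : Code n} (hc : D.IsCode c) :
    D.insertionIndex (D.seg c) = 1 ↔ c.1 = true ∧ c.2.1 = c.2.2 := by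
  have key : ∀ s, D.VCode s s → D.insertionIndex (D.seg (true, s, s)) = 1 := by
    intro s hs
    rw [insertionIndex, Set.ncard_eq_one]
    refine ⟨D.seg (true, s, s), Set.eq_singleton_iff_unique_mem.2
      ⟨⟨(D.isInsertionEdge_iff _).2 ⟨(true, s, s), hs, rfl⟩, Segment.le_refl _⟩, ?_⟩⟩
    rintro e ⟨he, hle⟩
    obtain ⟨d, hd, rfl⟩ := (D.isInsertionEdge_iff e).1 he
    congr 1
    refine seg_antisymm hd hs hle ?_
    obtain ⟨_ | _, l', s'⟩ := d
    · exact trivial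
    · exact hs.vseg_le hd
  constructor
  · intro h
    obtain ⟨s, hs⟩ := D.exists_vcode_self
    have := insertionIndex_injective ((D.isInsertionEdge_iff _).2 ⟨c, hc, rfl⟩)
      ((D.isInsertionEdge_iff _).2 ⟨(true, s, s), hs, rfl⟩) (h.trans (key s hs).symm)
    rw [D.seg_injOn hc hs this]
    exact ⟨rfl, rfl⟩
  · obtain ⟨b, l, s⟩ := c
    rintro ⟨rfl, h⟩
    obtain rfl : l = s := h
    exact key l hc

theorem insertionIndex_eq_count_iff {D : Drawing n} {c : Code n} (hc : D.IsCode c) :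
    D.insertionIndex (D.seg c) = D.insertionCount ↔ c.1 = false ∧ c.2.1 = c.2.2 := by
  have key : ∀ s, D.anti.VCode s s →
      D.insertionIndex (D.seg (false, s, s)) = D.insertionCount := by
    intro s hs
    rw [insertionIndex, insertionCount]
    congr 1
    refine Set.Subset.antisymm (fun e he => he.1) fun e he => ⟨he, ?_⟩
    obtain ⟨d, hd, rfl⟩ := (D.isInsertionEdge_iff e).1 he
    obtain ⟨_ | _, l', s'⟩ := d
    · exact (hseg_le_hseg_iff hd hs).2 (hs.vseg_le hd)
    · exact trivial
  constructor
  · intro h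
    obtain ⟨s, hs⟩ := D.anti.exists_vcode_self
    have := insertionIndex_injective ((D.isInsertionEdge_iff _).2 ⟨c, hc, rfl⟩)
      ((D.isInsertionEdge_iff _).2 ⟨(false, s, s), hs, rfl⟩) (h.trans (key s hs).symm)
    rw [D.seg_injOn hc hs this]
    exact ⟨rfl, rfl⟩
  · obtain ⟨b, l, s⟩ := c
    rintro ⟨rfl, h⟩
    obtain rfl : l = s := h
    exact key l hc

/-- The first edge is vertical and the last is horizontal. That they differ keeps bottom-based and
right-based children apart. -/
theorem one_lt_insertionCount (D : Drawing n) : 1 < D.insertionCount := by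
  obtain ⟨s, hs⟩ := D.exists_vcode_self
  obtain ⟨t, ht⟩ := D.anti.exists_vcode_self
  rw [insertionCount_eq, Set.one_lt_ncard]
  exact ⟨(true, s, s), hs, (false, t, t), ht, by simp⟩

/-! ### Bottom-based and right-based drawings -/

theorem bottomBased_iff (D : Drawing n) :
    D.BottomBased ↔ ∃ i, D.IsBottomRight i ∧ ∀ j, ¬ D.LeftOf j i := by
  simp only [forall_not_leftOf_iff, BottomBased, IsBottomRight]
  exact exists_congr fun i => by tauto

theorem anti_bottomBased (D : Drawing n) : D.anti.BottomBased ↔ D.RightBased := by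
  simp only [BottomBased, RightBased, anti_x₁, anti_x₂, anti_y₁, anti_outer_x₁, anti_outer_x₂,
    anti_outer_y₁, neg_inj]
  exact exists_congr fun i => by tauto

theorem IsIso.bottomBased {D D' : Drawing n} {σ : Equiv.Perm (Fin n)} (h : D.IsIso D' σ) :
    D.BottomBased ↔ D'.BottomBased := by
  rw [bottomBased_iff, bottomBased_iff, ← σ.exists_congr_right
    (q := fun i => D'.IsBottomRight i ∧ ∀ j, ¬ D'.LeftOf j i)]
  exact exists_congr fun i => by rw [h.isBottomRight, h.no_left]

theorem bottomBased_toRect (D : Drawing n) :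
    Rectangulations.BottomBased D.toRect ↔ D.BottomBased := by
  refine ⟨fun ⟨D', h, h'⟩ => ?_, fun h => ⟨D, rfl, h⟩⟩
  obtain ⟨σ, hσ⟩ := exists_isIso h
  exact hσ.bottomBased.1 h'

theorem rightBased_toRect (D : Drawing n) :
    Rectangulations.RightBased D.toRect ↔ D.RightBased := by
  refine ⟨fun ⟨D', h, h'⟩ => ?_, fun h => ⟨D, rfl, h⟩⟩
  obtain ⟨σ, hσ⟩ := exists_isIso h
  rw [← anti_bottomBased] at h' ⊢
  exact hσ.anti.bottomBased.1 h'

/-- The new rectangle occupies the bottom-right corner, so it alone can span the bottom, and it does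
so when the insertion wall is the left boundary. -/
theorem VInsert.bottomBased_iff {D : Drawing n} {D' : Drawing (n + 1)} {l s : Fin n} {y : ℝ}
    (h : D.VInsert l s y D') : D'.BottomBased ↔ l = s := by
  rw [Drawing.bottomBased_iff]
  simp only [forall_not_leftOf_iff, h.outer]
  constructor
  · rintro ⟨i, hi, hx⟩
    obtain rfl := hi.unique h.isBottomRight_last
    rw [h.new] at hx
    rcases h.code.2 with hl | hl
    · exact ((D.forall_not_leftOf_iff s).2 hx l hl).elim
    · exact hl.1
  · intro hl
    refine ⟨Fin.last n, h.isBottomRight_last, ?_⟩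
    rw [h.new]
    exact h.code.facts.2.2.2 hl

theorem VInsert.not_rightBased {D : Drawing n} {D' : Drawing (n + 1)} {l s : Fin n} {y : ℝ}
    (h : D.VInsert l s y D') : ¬ D'.RightBased := by
  rintro ⟨i, h1, h2, h3⟩
  obtain rfl := IsBottomRight.unique ⟨h1, h2⟩ h.isBottomRight_last
  rw [h.new, h.outer] at h3
  exact (h.height_lt.trans_le (D.y₂_le_outer s)).ne h3

theorem InsertsTo.bottomBased_iff {D : Drawing n} {D' : Drawing (n + 1)} {c : Code n}
    (hc : D.IsCode c) (h : D.InsertsTo (D.seg c) D') :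
    D'.BottomBased ↔ D.insertionIndex (D.seg c) = 1 := by
  rw [insertionIndex_eq_one_iff hc]
  obtain ⟨_ | _, l, s⟩ := c
  · obtain ⟨y, h⟩ := (insertsTo_horiz_iff hc).1 h
    refine iff_of_false (fun hb => h.not_rightBased ?_) (by simp)
    rwa [← anti_bottomBased, anti_anti]
  · obtain ⟨y, h⟩ := (insertsTo_vert_iff hc).1 h
    simp [h.bottomBased_iff]

theorem InsertsTo.rightBased_iff {D : Drawing n} {D' : Drawing (n + 1)} {c : Code n}
    (hc : D.IsCode c) (h : D.InsertsTo (D.seg c) D') :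
    D'.RightBased ↔ D.insertionIndex (D.seg c) = D.insertionCount := by
  rw [insertionIndex_eq_count_iff hc]
  obtain ⟨_ | _, l, s⟩ := c
  · obtain ⟨y, h⟩ := (insertsTo_horiz_iff hc).1 h
    simp [← anti_bottomBased, h.bottomBased_iff]
  · obtain ⟨y, h⟩ := (insertsTo_vert_iff hc).1 h
    exact iff_of_false h.not_rightBased (by simp)

end Drawing

/-! ### Parents and children of rectangulations -/

open Drawing

variable {n : ℕ}

theorem isChild_iff (P : Rectangulation n) (k : ℕ) (R : Rectangulation (n + 1)) :
    IsChild P k R ↔ ∃ (D : Drawing n) (D' : Drawing (n + 1)) (c : Code n), D.toRect = P ∧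
      D'.toRect = R ∧ D.IsCode c ∧ D.insertionIndex (D.seg c) = k ∧
      D.InsertsTo (D.seg c) D' := by
  constructor
  · rintro ⟨D, D', e, h1, h2, h3, h4, h5⟩
    obtain ⟨c, hc, rfl⟩ := (D.isInsertionEdge_iff e).1 h3
    exact ⟨D, D', c, h1, h2, hc, h4, h5⟩
  · rintro ⟨D, D', c, h1, h2, h3, h4, h5⟩
    exact ⟨D, D', D.seg c, h1, h2, (D.isInsertionEdge_iff _).2 ⟨c, h3, rfl⟩, h4, h5⟩

theorem isParent_iff (R : Rectangulation (n + 1)) (P : Rectangulation n) :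
    IsParent R P ↔ ∃ k, IsChild P k R := by
  simp only [isChild_iff]
  constructor
  · rintro ⟨D', D, rfl, rfl, h⟩
    obtain ⟨r, h | h⟩ := (deletesTo_iff D' D).1 h
    · obtain ⟨l, s, y, h'⟩ := h.reindex.vInsert
      exact ⟨_, D, D'.reindex (moveLast r), (true, l, s), rfl, (D'.isIso_reindex _).toRect_eq,
        h'.code, rfl, (insertsTo_vert_iff h'.code).2 ⟨y, h'⟩⟩
    · obtain ⟨l, s, y, h'⟩ := h.reindex.vInsert
      exact ⟨_, D, D'.reindex (moveLast r), (false, l, s), rfl, (D'.isIso_reindex _).toRect_eq,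
        h'.code, rfl, (insertsTo_horiz_iff h'.code).2 ⟨y, h'⟩⟩
  · rintro ⟨k, D, D', ⟨_ | _, l, s⟩, h1, h2, hc, -, h⟩
    · obtain ⟨y, h⟩ := (insertsTo_horiz_iff hc).1 h
      exact ⟨D', D, h2, h1, (deletesTo_iff _ _).2 ⟨Fin.last n, Or.inr h.vDelete⟩⟩
    · obtain ⟨y, h⟩ := (insertsTo_vert_iff hc).1 h
      exact ⟨D', D, h2, h1, (deletesTo_iff _ _).2 ⟨Fin.last n, Or.inl h.vDelete⟩⟩

/-- Both parent and index can be recovered from the child, so each rectangulation has at most one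
parent and `childIndex` is meaningful. -/
theorem IsChild.unique {P P' : Rectangulation n} {k k' : ℕ} {R : Rectangulation (n + 1)}
    (h : IsChild P k R) (h' : IsChild P' k' R) : P = P' ∧ k = k' := by
  rw [isChild_iff] at h h'
  obtain ⟨D₁, D₁', c₁, rfl, rfl, hc₁, rfl, h₁⟩ := h
  obtain ⟨D₂, D₂', c₂, rfl, hR, hc₂, rfl, h₂⟩ := h'
  obtain ⟨τ, hτ⟩ := exists_isIso hR.symm
  obtain ⟨σ, hσ, rfl⟩ := hτ.of_insertsTo hc₁ hc₂ h₁ h₂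
  exact ⟨hσ.toRect_eq, hσ.insertionIndex_seg hc₁⟩

theorem IsChild.child_unique {P : Rectangulation n} {k : ℕ} {R R' : Rectangulation (n + 1)}
    (h : IsChild P k R) (h' : IsChild P k R') : R = R' := by
  rw [isChild_iff] at h h'
  obtain ⟨D₁, D₁', c₁, rfl, rfl, hc₁, hk, h₁⟩ := h
  obtain ⟨D₂, D₂', c₂, hP, rfl, hc₂, rfl, h₂⟩ := h'
  obtain ⟨σ, hσ⟩ := exists_isIso hP.symm
  have hc := (hσ.isCode c₁).1 hc₁
  rw [hσ.insertionIndex_seg hc₁] at hk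
  obtain rfl : codeMap σ c₁ = c₂ := D₂.seg_injOn hc hc₂ (insertionIndex_injective
    ((D₂.isInsertionEdge_iff _).2 ⟨_, hc, rfl⟩) ((D₂.isInsertionEdge_iff _).2 ⟨_, hc₂, rfl⟩) hk)
  exact (hσ.insertsTo hc₁ h₁ h₂).toRect_eq

theorem IsParent.unique {R : Rectangulation (n + 1)} {P P' : Rectangulation n}
    (h : IsParent R P) (h' : IsParent R P') : P = P' := by
  obtain ⟨k, hk⟩ := (isParent_iff R P).1 h
  obtain ⟨k', hk'⟩ := (isParent_iff R P').1 h'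
  exact (hk.unique hk').1

theorem IsChild.isParent {P : Rectangulation n} {k : ℕ} {R : Rectangulation (n + 1)}
    (h : IsChild P k R) : IsParent R P := (isParent_iff R P).2 ⟨k, h⟩

theorem HasInsertionCount.unique {P : Rectangulation n} {k k' : ℕ} (h : HasInsertionCount P k)
    (h' : HasInsertionCount P k') : k = k' := by
  obtain ⟨D, hD, rfl⟩ := h
  obtain ⟨D', hD', rfl⟩ := h'
  obtain ⟨σ, hσ⟩ := exists_isIso (hD.trans hD'.symm)
  exact hσ.insertionCount_eq

theorem HasInsertionCount.one_lt {P : Rectangulation n} {k : ℕ} (h : HasInsertionCount P k) :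
    1 < k := by
  obtain ⟨D, -, rfl⟩ := h
  exact D.one_lt_insertionCount

theorem exists_hasInsertionCount (P : Rectangulation n) : ∃ k, HasInsertionCount P k := by
  obtain ⟨D, rfl⟩ := Quotient.exists_rep P
  exact ⟨_, D, rfl, rfl⟩

theorem IsChild.one_le {P : Rectangulation n} {k : ℕ} {R : Rectangulation (n + 1)}
    (h : IsChild P k R) : 1 ≤ k := by
  obtain ⟨D, D', e, -, -, he, rfl, -⟩ := h
  exact one_le_insertionIndex he

theorem IsChild.le {P : Rectangulation n} {k m : ℕ} {R : Rectangulation (n + 1)}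
    (h : IsChild P k R) (hm : HasInsertionCount P m) : k ≤ m := by
  obtain ⟨D, D', e, h1, -, -, rfl, -⟩ := h
  rw [← HasInsertionCount.unique ⟨D, h1, rfl⟩ hm]
  exact D.insertionIndex_le e

theorem IsChild.bottomBased_iff {P : Rectangulation n} {k : ℕ} {R : Rectangulation (n + 1)}
    (h : IsChild P k R) : BottomBased R ↔ k = 1 := by
  rw [isChild_iff] at h
  obtain ⟨D, D', c, -, rfl, hc, rfl, h⟩ := h
  rw [bottomBased_toRect, h.bottomBased_iff hc]

theorem IsChild.rightBased_iff {P : Rectangulation n} {k m : ℕ} {R : Rectangulation (n + 1)}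
    (h : IsChild P k R) (hm : HasInsertionCount P m) : RightBased R ↔ k = m := by
  rw [isChild_iff] at h
  obtain ⟨D, D', c, hD, rfl, hc, rfl, h⟩ := h
  rw [rightBased_toRect, h.rightBased_iff hc, HasInsertionCount.unique ⟨D, hD, rfl⟩ hm]

theorem exists_isParent (R : Rectangulation (n + 2)) : ∃ P, IsParent R P := by
  obtain ⟨D, rfl⟩ := Quotient.exists_rep R
  obtain ⟨r, hr⟩ := D.exists_isBottomRight
  have hr' : (D.reindex (moveLast r)).IsBottomRight (Fin.last (n + 1)) := by
    rw [(D.isIso_reindex _).isBottomRight]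
    simpa using hr
  have hD : (D.reindex (moveLast r)).toRect = D.toRect := (D.isIso_reindex _).toRect_eq
  rcases typeRight_or_typeBottom _ hr' with ht | ht
  · obtain ⟨D', h⟩ := exists_vDelete_last hr' ht
    exact ⟨D'.toRect, _, D', hD, rfl, (deletesTo_iff _ _).2 ⟨_, Or.inl h⟩⟩
  · obtain ⟨D', h⟩ := exists_vDelete_last ((anti_isBottomRight _ _).2 hr')
      ((anti_typeRight _ _ _).2 ht)
    refine ⟨D'.anti.toRect, _, D'.anti, hD, rfl,
      (deletesTo_iff _ _).2 ⟨Fin.last (n + 1), Or.inr ?_⟩⟩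
    rwa [anti_anti]

/-! ### The vertical strips. -/

theorem strips_leftOf (n : ℕ) [NeZero n] (i j : Fin n) :
    (strips n).LeftOf i j ↔ (i : ℕ) + 1 = j := by
  simp only [LeftOf, strips, zero_lt_one, and_true]
  exact_mod_cast Iff.rfl

theorem not_strips_belowOf (n : ℕ) [NeZero n] (i j : Fin n) : ¬ (strips n).BelowOf i j := by
  simp [BelowOf, strips]

theorem rightBased_idRect (n : ℕ) [NeZero n] : RightBased (idRect n) := by
  refine ⟨strips n, rfl, ⟨n - 1, Nat.sub_lt (Nat.pos_of_ne_zero (NeZero.ne n)) one_pos⟩, ?_, rfl,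
    rfl⟩
  simp [strips, Nat.cast_sub (Nat.one_le_iff_ne_zero.2 (NeZero.ne n))]

/-- The last strip reaches the top boundary, so its joint is not `⊢` and the deletion slides to the
right. The result has one wider strip; it is therefore compared with the standard strips through the
relations. -/
theorem isParent_idRect (n : ℕ) : IsParent (idRect (n + 2)) (idRect (n + 1)) := by
  have hr : (strips (n + 2)).IsBottomRight (Fin.last (n + 1)) := by
    refine ⟨?_, rfl⟩
    simp [strips]
    ring
  have ht := (typeRight_or_typeBottom _ hr).resolve_left fun h => lt_irrefl _ h.lt_outer
  obtain ⟨D, h⟩ := exists_vDelete_last ((anti_isBottomRight _ _).2 hr)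
    ((anti_typeRight _ _ _).2 ht)
  refine ⟨_, D.anti, rfl, IsIso.toRect_eq (σ := Equiv.refl _) fun i j => ?_,
    (deletesTo_iff _ _).2 ⟨_, Or.inr (by rwa [anti_anti])⟩⟩
  obtain ⟨l, s, y, h⟩ := h.vInsert
  rw [anti_leftOf, anti_belowOf, ← h.belowOf_castSucc, h.leftOf_iff]
  simp [strips_leftOf, not_strips_belowOf]

/-! ### Child indices and directions -/

/-- The index `k` for which `R = c_k(P)`, where `P` is the parent of `R`. -/
noncomputable def childIndex (R : Rectangulation (n + 1)) : ℕ := sInf {k | ∃ P, IsChild P k R}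

theorem IsChild.childIndex_eq {P : Rectangulation n} {k : ℕ} {R : Rectangulation (n + 1)}
    (h : IsChild P k R) : childIndex R = k := by
  have : {k | ∃ P, IsChild P k R} = {k} := by
    ext m
    simp only [Set.mem_ofPred_eq, Set.mem_singleton_iff]
    exact ⟨fun ⟨Q, hQ⟩ => (hQ.unique h).2, fun hm => ⟨P, hm ▸ h⟩⟩
  rw [childIndex, this, csInf_singleton]

theorem IsParent.isChild {P : Rectangulation n} {R : Rectangulation (n + 1)}
    (h : IsParent R P) : IsChild P (childIndex R) R := by
  obtain ⟨k, hk⟩ := (isParent_iff R P).1 h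
  rwa [hk.childIndex_eq]

theorem IsParent.eq_of_childIndex {P : Rectangulation n} {R R' : Rectangulation (n + 1)}
    (h : IsParent R P) (h' : IsParent R' P) (hk : childIndex R = childIndex R') : R = R' :=
  h.isChild.child_unique (hk ▸ h'.isChild)

/-- `d.Lt a b`: the number `b` lies in direction `d` from `a`. -/
def Dir.Lt : Dir → ℕ → ℕ → Prop
  | .left, a, b => b < a
  | .right, a, b => a < b

theorem Dir.opp_opp (d : Dir) : d.opp.opp = d := by cases d <;> rfl

theorem Dir.eq_or_eq_opp (d e : Dir) : e = d ∨ e = d.opp := by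
  cases d <;> cases e <;> simp [Dir.opp]

theorem Dir.opp_lt (d : Dir) (a b : ℕ) : d.opp.Lt a b ↔ d.Lt b a := by cases d <;> rfl

theorem Dir.lt_irrefl (d : Dir) (a : ℕ) : ¬ d.Lt a a := by cases d <;> simp [Dir.Lt]

theorem Dir.lt_trans (d : Dir) {a b c : ℕ} (h : d.Lt a b) (h' : d.Lt b c) : d.Lt a c := by
  cases d <;> simp only [Dir.Lt] at * <;> omega

theorem Dir.lt_asymm (d : Dir) {a b : ℕ} (h : d.Lt a b) : ¬ d.Lt b a :=
  fun h' => d.lt_irrefl _ (d.lt_trans h h')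

/-- The rectangulations in which the last rectangle cannot jump any further in direction `d`. -/
def Based : Dir → Rectangulation n → Prop
  | .left => BottomBased
  | .right => RightBased

theorem IsParent.not_based_opp {P : Rectangulation n} {R : Rectangulation (n + 1)}
    (h : IsParent R P) {d : Dir} (h1 : Based d R) : ¬ Based d.opp R := by
  intro h2
  obtain ⟨m, hm⟩ := exists_hasInsertionCount P
  have h3 := h.isChild.bottomBased_iff
  have h4 := h.isChild.rightBased_iff hm
  have h5 := hm.one_lt
  cases d
  · have e1 := h3.1 h1
    have e2 := h4.1 h2
    omega
  · have e1 := h4.1 h1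
    have e2 := h3.1 h2
    omega

theorem IsParent.eq_of_based {P : Rectangulation n} {R R' : Rectangulation (n + 1)}
    (h : IsParent R P) (h' : IsParent R' P) {d : Dir} (h1 : Based d R) (h2 : Based d R') :
    R = R' := by
  obtain ⟨m, hm⟩ := exists_hasInsertionCount P
  refine h.eq_of_childIndex h' ?_
  cases d
  · rw [h.isChild.bottomBased_iff.1 h1, h'.isChild.bottomBased_iff.1 h2]
  · rw [(h.isChild.rightBased_iff hm).1 h1, (h'.isChild.rightBased_iff hm).1 h2]

theorem IsParent.not_lt_of_based {P : Rectangulation n} {R R' : Rectangulation (n + 1)}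
    (h : IsParent R P) (h' : IsParent R' P) {d : Dir} (h1 : Based d R) :
    ¬ d.Lt (childIndex R) (childIndex R') := by
  obtain ⟨m, hm⟩ := exists_hasInsertionCount P
  have h3 := h'.isChild.one_le
  have h4 := h'.isChild.le hm
  cases d
  · have := h.isChild.bottomBased_iff.1 h1
    simp only [Dir.Lt]
    omega
  · have := (h.isChild.rightBased_iff hm).1 h1
    simp only [Dir.Lt]
    omega

theorem IsZigzag.parents {C : Set (Rectangulation (n + 2))} (h : IsZigzag C) :
    IsZigzag (parents C) := h.1

/-- Apart from the passage to the parents, this is the only way in which the zigzag condition enters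
the induction step. -/
theorem IsZigzag.exists_based {C : Set (Rectangulation (n + 2))} (h : IsZigzag C)
    {P : Rectangulation (n + 1)} (hP : P ∈ Rectangulations.parents C) (d : Dir) :
    ∃ R ∈ C, IsParent R P ∧ Based d R := by
  obtain ⟨⟨R, hR, h1⟩, k, hk, R', hR', h2⟩ := h.2 P hP
  cases d
  · exact ⟨R, hR, h1.isParent, h1.bottomBased_iff.2 rfl⟩
  · exact ⟨R', hR', h2.isParent, (h2.rightBased_iff hk).2 rfl⟩

/-! ### Minimal jumps -/

theorem IsJump.bounds {dir : Dir} {j d : ℕ} {R R' : Rectangulation n} (h : IsJump dir j d R R') :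
    2 ≤ j ∧ 0 < d ∧ j ≤ n := by
  cases n with
  | zero => exact h.elim
  | succ n =>
    obtain ⟨h1, h2, ⟨rfl, -⟩ | ⟨h3, -⟩⟩ := h
    · exact ⟨h1, h2, le_rfl⟩
    · exact ⟨h1, h2, h3.le⟩

theorem isJump_last_iff {P : Rectangulation (n + 1)} {R R' : Rectangulation (n + 2)}
    (hP : IsParent R P) {dir : Dir} {d : ℕ} : IsJump dir (n + 2) d R R' ↔
      IsParent R' P ∧ 0 < d ∧ match dir with
        | .right => childIndex R' = childIndex R + d
        | .left => childIndex R = childIndex R' + d := by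
  constructor
  · rintro ⟨-, h2, ⟨-, Q, k, k', h3, h4, h5, h6, h7⟩ | ⟨h3, -⟩⟩
    · obtain rfl := hP.unique h3
      obtain rfl := h5.childIndex_eq
      obtain rfl := h6.childIndex_eq
      exact ⟨h4, h2, h7⟩
    · omega
  · rintro ⟨h1, h2, h3⟩
    exact ⟨by omega, h2, Or.inl ⟨rfl, P, _, _, hP, h1, hP.isChild, h1.isChild, h3⟩⟩

theorem isMinJump_last_iff {C : Set (Rectangulation (n + 2))} {P : Rectangulation (n + 1)}
    {R R' : Rectangulation (n + 2)} (hP : IsParent R P) {dir : Dir} :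
    IsMinJump C dir (n + 2) R R' ↔ R' ∈ C ∧ IsParent R' P ∧
      dir.Lt (childIndex R) (childIndex R') ∧ ∀ R'' ∈ C, IsParent R'' P →
        dir.Lt (childIndex R) (childIndex R'') → ¬ dir.Lt (childIndex R'') (childIndex R') := by
  simp only [IsMinJump, isJump_last_iff hP]
  refine and_congr_right fun hR' => ?_
  constructor
  · rintro ⟨d, ⟨h1, h2, h3⟩, h4⟩
    refine ⟨h1, ?_, fun R'' hR'' hp h5 h6 => ?_⟩
    · cases dir <;> simp only [Dir.Lt] at * <;> omega
    · cases dir <;> simp only [Dir.Lt] at *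
      · exact h4 (childIndex R - childIndex R'') (by omega) R'' hR'' ⟨hp, by omega, by omega⟩
      · exact h4 (childIndex R'' - childIndex R) (by omega) R'' hR'' ⟨hp, by omega, by omega⟩
  · rintro ⟨h1, h2, h3⟩
    cases dir <;> simp only [Dir.Lt] at *
    · refine ⟨childIndex R - childIndex R', ⟨h1, by omega, by omega⟩, ?_⟩
      rintro d hd R'' hR'' ⟨h4, h5, h6⟩
      exact h3 R'' hR'' h4 (by omega) (by omega)
    · refine ⟨childIndex R' - childIndex R, ⟨h1, by omega, by omega⟩, ?_⟩
      rintro d hd R'' hR'' ⟨h4, h5, h6⟩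
      exact h3 R'' hR'' h4 (by omega) (by omega)

/-- By `not_based_opp`, `R` is based on one side only, so the alternative in the definition of a
jump is decided by `e`. -/
theorem isJump_of_lt_iff {P : Rectangulation (n + 1)} {R R' : Rectangulation (n + 2)}
    (hP : IsParent R P) {e : Dir} (he : Based e R) {dir : Dir} {j d : ℕ} (hj : j < n + 2) :
    IsJump dir j d R R' ↔ Based e R' ∧ ∃ P', IsParent R' P' ∧ IsJump dir j d P P' := by
  constructor
  · rintro ⟨-, -, ⟨h3, -⟩ | ⟨-, h4, Q, P', h5, h6, h7⟩⟩
    · omega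
    obtain rfl := hP.unique h5
    refine ⟨?_, P', h6, h7⟩
    have hno := hP.not_based_opp he
    cases e
    · exact h4.elim And.right fun h => (hno h.1).elim
    · exact h4.elim (fun h => (hno h.1).elim) And.right
  · rintro ⟨h1, P', h2, h3⟩
    refine ⟨h3.bounds.1, h3.bounds.2.1, Or.inr ⟨hj, ?_, P, P', hP, h2, h3⟩⟩
    cases e
    · exact Or.inl ⟨he, h1⟩
    · exact Or.inr ⟨he, h1⟩

/-- Minimal jumps of the rectangles other than the last one are inherited from the parents. -/
theorem isMinJump_of_lt_iff {C : Set (Rectangulation (n + 2))} (hC : IsZigzag C)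
    {P : Rectangulation (n + 1)} {R R' : Rectangulation (n + 2)} (hP : IsParent R P) {e : Dir}
    (he : Based e R) {dir : Dir} {j : ℕ} (hj : j < n + 2) :
    IsMinJump C dir j R R' ↔ R' ∈ C ∧ Based e R' ∧
      ∃ P', IsParent R' P' ∧ IsMinJump (parents C) dir j P P' := by
  simp only [IsMinJump, isJump_of_lt_iff hP he hj]
  refine and_congr_right fun hR' => ?_
  constructor
  · rintro ⟨d, ⟨h1, P', h2, h3⟩, h4⟩
    refine ⟨h1, P', h2, ⟨R', hR', h2⟩, d, h3, fun d' hd' Q hQ h5 => ?_⟩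
    -- A shorter jump between parents would lift to a shorter jump in `C`, because `Q` also has an
    -- `e`-based child in `C`.
    obtain ⟨S, hS, hSQ, hSe⟩ := hC.exists_based hQ e
    exact h4 d' hd' S hS ⟨hSe, Q, hSQ, h5⟩
  · rintro ⟨h1, P', h2, -, d, h3, h4⟩
    refine ⟨d, ⟨h1, P', h2, h3⟩, fun d' hd' S hS => ?_⟩
    rintro ⟨-, Q, hSQ, h5⟩
    exact h4 d' hd' Q ⟨S, hS, hSQ⟩ h5

theorem IsMinJump.bounds {C : Set (Rectangulation n)} {dir : Dir} {j : ℕ}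
    {R R' : Rectangulation n} (h : IsMinJump C dir j R R') : 2 ≤ j ∧ j ≤ n := by
  obtain ⟨-, d, h, -⟩ := h
  exact ⟨h.bounds.1, h.bounds.2.2⟩

/-! ### The children of a rectangulation in a zigzag set -/

/-- `K` lists the children of `P` in `C` in the order in which jumps in direction `d` visit
them. -/
structure KidList (C : Set (Rectangulation (n + 2))) (P : Rectangulation (n + 1)) (d : Dir)
    (K : List (Rectangulation (n + 2))) : Prop where
  mem : ∀ R, R ∈ K ↔ R ∈ C ∧ IsParent R P
  sorted : K.Pairwise fun a b => d.Lt (childIndex a) (childIndex b)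
  ne_nil : K ≠ []
  first : ∀ R ∈ K.head?, Based d.opp R
  last : ∀ R ∈ K.getLast?, Based d R

theorem head_based {C : Set (Rectangulation (n + 2))} (hC : IsZigzag C)
    {P : Rectangulation (n + 1)} (hP : P ∈ parents C) {d : Dir}
    {K : List (Rectangulation (n + 2))} (mem : ∀ R, R ∈ K ↔ R ∈ C ∧ IsParent R P)
    (sorted : K.Pairwise fun a b => d.Lt (childIndex a) (childIndex b)) :
    ∀ R ∈ K.head?, Based d.opp R := by
  intro R hR
  cases K with
  | nil => simp at hR
  | cons a K =>
    obtain rfl : a = R := by simpa using hR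
    obtain ⟨E, hE, hEP, hEd⟩ := hC.exists_based hP d.opp
    have ha := ((mem a).1 List.mem_cons_self).2
    rcases List.mem_cons.1 ((mem E).2 ⟨hE, hEP⟩) with rfl | h
    · exact hEd
    · exact (hEP.not_lt_of_based ha hEd
        ((Dir.opp_lt _ _ _).2 ((List.pairwise_cons.1 sorted).1 E h))).elim

theorem KidList.of_sorted {C : Set (Rectangulation (n + 2))} (hC : IsZigzag C)
    {P : Rectangulation (n + 1)} (hP : P ∈ parents C) {d : Dir}
    {K : List (Rectangulation (n + 2))} (mem : ∀ R, R ∈ K ↔ R ∈ C ∧ IsParent R P)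
    (sorted : K.Pairwise fun a b => d.Lt (childIndex a) (childIndex b)) : KidList C P d K where
  mem := mem
  sorted := sorted
  ne_nil := by
    rintro rfl
    obtain ⟨R, hR, hRP⟩ := hP
    simpa using (mem R).2 ⟨hR, hRP⟩
  first := head_based hC hP mem sorted
  last := by
    intro R hR
    rw [← d.opp_opp]
    -- The last child in direction `d` is the first one in the opposite direction.
    refine head_based hC hP (d := d.opp) (K := K.reverse) (by simpa using mem) ?_ R (by simpa)
    rw [List.pairwise_reverse]
    exact sorted.imp fun h => (Dir.opp_lt _ _ _).2 h

/-- Membership of `P` stands behind the existential quantifier so that `choose` yields a function on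
all rectangulations. -/
theorem exists_kidList {C : Set (Rectangulation (n + 2))} (hC : IsZigzag C)
    (P : Rectangulation (n + 1)) (d : Dir) :
    ∃ K, P ∈ parents C → KidList C P d K := by
  classical
  suffices H : ∃ K : List (Rectangulation (n + 2)), (∀ R, R ∈ K ↔ R ∈ C ∧ IsParent R P) ∧
      K.Pairwise fun a b => childIndex a < childIndex b by
    obtain ⟨K, mem, sorted⟩ := H
    cases d
    · refine ⟨K.reverse, fun hP => KidList.of_sorted hC hP (by simpa using mem) ?_⟩
      rw [List.pairwise_reverse]
      exact sorted
    · exact ⟨K, fun hP => KidList.of_sorted hC hP mem sorted⟩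
  obtain ⟨m, hm⟩ := exists_hasInsertionCount P
  have : ∀ k, ∃ R, (∃ R ∈ C, IsChild P k R) → R ∈ C ∧ IsChild P k R := fun k => by
    by_cases h : ∃ R ∈ C, IsChild P k R
    · exact ⟨h.choose, fun _ => h.choose_spec⟩
    -- A default value for indices without a child in `C`; the filter below discards them.
    · exact ⟨idRect (n + 2), fun h' => (h h').elim⟩
  choose f hf using this
  refine ⟨((List.range (m + 1)).filter fun k => ∃ R ∈ C, IsChild P k R).map f, fun R => ?_, ?_⟩
  · simp only [List.mem_map, List.mem_filter, List.mem_range, decide_eq_true_eq]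
    constructor
    · rintro ⟨k, ⟨-, hk⟩, rfl⟩
      exact ⟨(hf k hk).1, (hf k hk).2.isParent⟩
    · rintro ⟨hR, hRP⟩
      refine ⟨childIndex R, ⟨Nat.lt_succ_of_le (hRP.isChild.le hm), R, hR, hRP.isChild⟩, ?_⟩
      exact (hf _ ⟨R, hR, hRP.isChild⟩).2.child_unique hRP.isChild
  · rw [List.pairwise_map]
    refine List.Pairwise.imp_of_mem ?_ (List.pairwise_lt_range.filter _)
    intro a b ha hb hab
    simp only [List.mem_filter, List.mem_range, decide_eq_true_eq] at ha hb
    rwa [(hf a ha.2).2.childIndex_eq, (hf b hb.2).2.childIndex_eq]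

namespace KidList

variable {C : Set (Rectangulation (n + 2))} {P : Rectangulation (n + 1)} {d : Dir}
  {K u v : List (Rectangulation (n + 2))} {a : Rectangulation (n + 2)}

theorem nodup (h : KidList C P d K) : K.Nodup := by
  refine List.Pairwise.imp ?_ h.sorted
  rintro a b hlt rfl
  exact d.lt_irrefl _ hlt

theorem isMinJump_iff (h : KidList C P d K) (hK : K = u ++ a :: v) (R : Rectangulation (n + 2)) :
    IsMinJump C d (n + 2) a R ↔ v.head? = some R := by
  subst hK
  have hs := h.sorted
  rw [List.pairwise_append, List.pairwise_cons] at hs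
  obtain ⟨-, ⟨hs1, hs2⟩, hs3⟩ := hs
  have ha := ((h.mem a).1 (by simp)).2
  have hv : ∀ R ∈ C, IsParent R P → d.Lt (childIndex a) (childIndex R) → R ∈ v := by
    intro R hR hRP hlt
    have := (h.mem R).2 ⟨hR, hRP⟩
    rw [List.mem_append, List.mem_cons] at this
    rcases this with hu | rfl | hv
    · exact (d.lt_asymm hlt (hs3 R hu a (by simp))).elim
    · exact (d.lt_irrefl _ hlt).elim
    · exact hv
  rw [isMinJump_last_iff ha]
  constructor
  · rintro ⟨h1, h2, h3, h4⟩
    have hR := hv R h1 h2 h3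
    cases v with
    | nil => simp at hR
    | cons b v =>
      rcases List.mem_cons.1 hR with rfl | hR
      · rfl
      · have hb := (h.mem b).1 (by simp)
        exact (h4 b hb.1 hb.2 (hs1 b (by simp)) ((List.pairwise_cons.1 hs2).1 R hR)).elim
  · intro hR
    cases v with
    | nil => simp at hR
    | cons b v =>
      obtain rfl : b = R := by simpa using hR
      have hb := (h.mem b).1 (by simp)
      refine ⟨hb.1, hb.2, hs1 b (by simp), fun S hS hSP h1 h2 => ?_⟩
      rcases List.mem_cons.1 (hv S hS hSP h1) with rfl | hSv
      · exact d.lt_irrefl _ h2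
      · exact d.lt_asymm h2 ((List.pairwise_cons.1 hs2).1 S hSv)

/-- Backward jumps only return to earlier children, which the greedy algorithm has already visited.
-/
theorem mem_of_isMinJump_opp (h : KidList C P d K) (hK : K = u ++ a :: v)
    {R : Rectangulation (n + 2)} (hR : IsMinJump C d.opp (n + 2) a R) : R ∈ u := by
  subst hK
  have hs := h.sorted
  rw [List.pairwise_append, List.pairwise_cons] at hs
  have ha := ((h.mem a).1 (by simp)).2
  rw [isMinJump_last_iff ha, Dir.opp_lt] at hR
  have := (h.mem R).2 ⟨hR.1, hR.2.1⟩
  rw [List.mem_append, List.mem_cons] at this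
  rcases this with hu | rfl | hv
  · exact hu
  · exact (d.lt_irrefl _ hR.2.2.1).elim
  · exact (d.lt_asymm hR.2.2.1 (hs.2.1.1 R hv)).elim

/-- The test in line M5 thus recognises the end of a block. -/
theorem based_iff (h : KidList C P d K) (hK : K = u ++ a :: v) : Based d a ↔ v = [] := by
  subst hK
  constructor
  · intro ha
    have hs := h.sorted
    rw [List.pairwise_append, List.pairwise_cons] at hs
    have ha' := ((h.mem a).1 (by simp)).2
    cases v with
    | nil => rfl
    | cons b v =>
      exact (ha'.not_lt_of_based ((h.mem b).1 (by simp)).2 ha (hs.2.1.1 b (by simp))).elim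
  · rintro rfl
    exact h.last a (by simp)

/-- A single child would be first and last, hence based on both sides. So a block never starts with
its last child. -/
theorem exists_cons_cons (h : KidList C P d K) : ∃ b c t, K = b :: c :: t := by
  match K, h with
  | [], h => exact (h.ne_nil rfl).elim
  | [b], h =>
    exact (((h.mem b).1 (by simp)).2.not_based_opp (h.last b (by simp)) (h.first b (by simp))).elim
  | b :: c :: t, _ => exact ⟨b, c, t, rfl⟩

theorem head?_eq_iff (h : KidList C P d K) (R : Rectangulation (n + 2)) :
    K.head? = some R ↔ R ∈ C ∧ IsParent R P ∧ Based d.opp R := by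
  constructor
  · intro hR
    have := (h.mem R).1 (List.mem_of_mem_head? hR)
    exact ⟨this.1, this.2, h.first R hR⟩
  · rintro ⟨h1, h2, h3⟩
    obtain ⟨b, c, t, rfl⟩ := h.exists_cons_cons
    rw [((h.mem b).1 (by simp)).2.eq_of_based h2 (h.first b (by simp)) h3]
    rfl

end KidList

/-! ### The order in which the children of a sequence of rectangulations are visited -/

/-- The concatenation of the lists of children of the members of a list, in alternating
directions. -/
def expandList {α β : Type*} (K : α → Dir → List β) : Dir → List α → List β
  | _, [] => []
  | d, P :: q => K P d ++ expandList K d.opp q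

theorem mem_expandList {C : Set (Rectangulation (n + 2))}
    {K : Rectangulation (n + 1) → Dir → List (Rectangulation (n + 2))}
    {q : List (Rectangulation (n + 1))} (hK : ∀ P ∈ q, ∀ d, KidList C P d (K P d)) (d : Dir)
    (R : Rectangulation (n + 2)) :
    R ∈ expandList K d q ↔ R ∈ C ∧ ∃ P ∈ q, IsParent R P := by
  induction q generalizing d with
  | nil => simp [expandList]
  | cons P q ih =>
    rw [expandList, List.mem_append, (hK P (by simp) d).mem,
      ih (fun Q hQ => hK Q (List.mem_cons_of_mem _ hQ))]
    simp only [List.mem_cons, exists_eq_or_imp]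
    tauto

theorem nodup_expandList {C : Set (Rectangulation (n + 2))}
    {K : Rectangulation (n + 1) → Dir → List (Rectangulation (n + 2))}
    {q : List (Rectangulation (n + 1))} (hK : ∀ P ∈ q, ∀ d, KidList C P d (K P d)) (d : Dir)
    (hq : q.Nodup) : (expandList K d q).Nodup := by
  induction q generalizing d with
  | nil => simp [expandList]
  | cons P q ih =>
    rw [List.nodup_cons] at hq
    have hK' : ∀ Q ∈ q, ∀ d, KidList C Q d (K Q d) := fun Q hQ => hK Q (List.mem_cons_of_mem _ hQ)
    refine List.nodup_append'.2 ⟨(hK P (by simp) d).nodup, ih hK' d.opp hq.2, fun R hR hR' => ?_⟩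
    obtain ⟨-, Q, hQ, hRQ⟩ := (mem_expandList hK' _ _).1 hR'
    exact hq.1 (((hK P (by simp) d).mem R).1 hR |>.2.unique hRQ ▸ hQ)

/-- Candidates for the next rectangulation after the last child of `P` has been visited. -/
theorem greedyCandidate_iff {C : Set (Rectangulation (n + 2))} (hC : IsZigzag C)
    {P : Rectangulation (n + 1)} {R R' : Rectangulation (n + 2)} (hP : IsParent R P) {e : Dir}
    (he : Based e R) {W : List (Rectangulation (n + 2))} {V : List (Rectangulation (n + 1))}
    (hW : ∀ S, S ∈ W ↔ S ∈ C ∧ ∃ Q ∈ V, IsParent S Q) {dir : Dir} {j : ℕ} (hj : j < n + 2) :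
    GreedyCandidate C W R dir j R' ↔ R' ∈ C ∧ Based e R' ∧
      ∃ P', IsParent R' P' ∧ GreedyCandidate (parents C) V P dir j P' := by
  simp only [GreedyCandidate]
  rw [isMinJump_of_lt_iff hC hP he hj, hW]
  constructor
  · rintro ⟨⟨h1, h2, P', h3, h4⟩, h5⟩
    exact ⟨h1, h2, P', h3, h4, fun h => h5 ⟨h1, P', h, h3⟩⟩
  · rintro ⟨h1, h2, P', h3, h4, h5⟩
    refine ⟨⟨h1, h2, P', h3, h4⟩, ?_⟩
    rintro ⟨-, Q, hQ, hRQ⟩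
    exact h5 (h3.unique hRQ ▸ hQ)

theorem GreedyCandidate.le {C : Set (Rectangulation n)} {W : List (Rectangulation n)}
    {R R' : Rectangulation n} {dir : Dir} {j : ℕ} (h : GreedyCandidate C W R dir j R') : j ≤ n :=
  h.1.bounds.2

/-- All children of `P` are visited, so the last rectangle offers no candidate. The others
correspond to the candidates for the parents, and the maximal index and its direction are the same
on both levels. -/
theorem KidList.greedyStep_last_iff {C : Set (Rectangulation (n + 2))} (hC : IsZigzag C)
    {P : Rectangulation (n + 1)} {d : Dir} {K u : List (Rectangulation (n + 2))}
    {a : Rectangulation (n + 2)} (h : KidList C P d K) (hK : K = u ++ [a])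
    {W : List (Rectangulation (n + 2))} {V : List (Rectangulation (n + 1))}
    (hW : ∀ S, S ∈ W ↔ S ∈ C ∧ ∃ Q ∈ V, IsParent S Q) (hPV : P ∈ V)
    (R : Rectangulation (n + 2)) :
    GreedyStep C W a R ↔ R ∈ C ∧ Based d R ∧
      ∃ P', IsParent R P' ∧ GreedyStep (parents C) V P P' := by
  have ha := ((h.mem a).1 (by simp [hK])).2
  have had : Based d a := (h.based_iff hK).2 rfl
  have hlt : ∀ {dir j R'}, GreedyCandidate C W a dir j R' → j < n + 2 := by
    intro dir j R' hc
    refine lt_of_le_of_ne hc.le ?_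
    rintro rfl
    refine hc.2 ((hW R').2 ⟨hc.1.1, P, hPV, ?_⟩)
    exact ((isMinJump_last_iff ha).1 hc.1).2.1
  constructor
  · rintro ⟨dir, j, h1, h2⟩
    obtain ⟨h3, h4, P', h5, h6⟩ := (greedyCandidate_iff hC ha had hW (hlt h1)).1 h1
    refine ⟨h3, h4, P', h5, dir, j, h6, fun dir' j' P'' h7 => ?_⟩
    -- Every candidate for the parents lifts to a `d`-based child, so it competes in `C` as well.
    obtain ⟨S, hS, hSP, hSd⟩ := hC.exists_based h7.1.1 d
    exact h2 dir' j' S ((greedyCandidate_iff hC ha had hW (Nat.lt_succ_of_le h7.le)).2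
      ⟨hS, hSd, P'', hSP, h7⟩)
  · rintro ⟨h3, h4, P', h5, dir, j, h6, h7⟩
    refine ⟨dir, j, (greedyCandidate_iff hC ha had hW (Nat.lt_succ_of_le h6.le)).2
      ⟨h3, h4, P', h5, h6⟩, fun dir' j' S h8 => ?_⟩
    obtain ⟨-, -, P'', -, h9⟩ := (greedyCandidate_iff hC ha had hW (hlt h8)).1 h8
    exact h7 dir' j' P'' h9

theorem KidList.greedyStep_inner_iff {C : Set (Rectangulation (n + 2))}
    {P : Rectangulation (n + 1)} {d : Dir} {K u v : List (Rectangulation (n + 2))}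
    {a b : Rectangulation (n + 2)} (h : KidList C P d K) (hK : K = u ++ a :: b :: v)
    {W : List (Rectangulation (n + 2))} (hu : ∀ R ∈ u, R ∈ W) (hb : b ∉ W)
    (R : Rectangulation (n + 2)) : GreedyStep C W a R ↔ b = R := by
  have hcand : GreedyCandidate C W a d (n + 2) b := ⟨(h.isMinJump_iff hK b).2 rfl, hb⟩
  have huniq : ∀ {dir R'}, GreedyCandidate C W a dir (n + 2) R' → dir = d ∧ b = R' := by
    intro dir R' hc
    rcases d.eq_or_eq_opp dir with rfl | rfl
    · exact ⟨rfl, by simpa using (h.isMinJump_iff hK R').1 hc.1⟩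
    · exact (hc.2 (hu _ (h.mem_of_isMinJump_opp hK hc.1))).elim
  constructor
  · rintro ⟨dir, j, h1, h2⟩
    obtain rfl : j = n + 2 := le_antisymm h1.le (h2 _ _ _ hcand).1
    exact (huniq h1).2
  · rintro rfl
    refine ⟨d, n + 2, hcand, fun dir' j' R' h' => ⟨h'.le, ?_⟩⟩
    rintro rfl
    exact (huniq h').1

/-- For the induction on `q`, the parents already treated are collected in `p`, and `W` contains
exactly their children. -/
theorem greedyStep_expandList {C : Set (Rectangulation (n + 2))} (hC : IsZigzag C)
    {K : Rectangulation (n + 1) → Dir → List (Rectangulation (n + 2))}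
    (p q : List (Rectangulation (n + 1))) (hpq : (p ++ q).Nodup)
    (hK : ∀ P ∈ q, ∀ d, KidList C P d (K P d))
    (hgreedy : ∀ u v P, p ++ q = u ++ P :: v →
      ∀ P', GreedyStep (parents C) (u ++ [P]) P P' ↔ v.head? = some P')
    (W : List (Rectangulation (n + 2)))
    (hW : ∀ S, S ∈ W ↔ S ∈ C ∧ ∃ Q ∈ p, IsParent S Q) (d : Dir)
    (u v : List (Rectangulation (n + 2))) (a : Rectangulation (n + 2))
    (huv : expandList K d q = u ++ a :: v) (R : Rectangulation (n + 2)) :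
    GreedyStep C (W ++ (u ++ [a])) a R ↔ v.head? = some R := by
  induction q generalizing p W d u with
  | nil => simp [expandList] at huv
  | cons P q ih =>
    have hKP := hK P (by simp) d
    have hKq : ∀ Q ∈ q, ∀ d, KidList C Q d (K Q d) := fun Q hQ => hK Q (List.mem_cons_of_mem _ hQ)
    have hW' : ∀ S, S ∈ W ++ K P d ↔ S ∈ C ∧ ∃ Q ∈ p ++ [P], IsParent S Q := by
      intro S
      rw [List.mem_append, hW, hKP.mem]
      simp only [List.mem_append, List.mem_singleton, or_and_right, exists_or, exists_eq_left]
      exact and_or_left.symm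
    rw [expandList, List.append_eq_append_iff] at huv
    have later : ∀ w, u = K P d ++ w → expandList K d.opp q = w ++ a :: v →
        -- The case in which `a` lies beyond the block of `P`, settled by the induction hypothesis
        -- with `P` moved to `p`.
        (GreedyStep C (W ++ (u ++ [a])) a R ↔ v.head? = some R) := by
      rintro w rfl hw
      have := ih (p ++ [P]) (by simpa using hpq) hKq (by simpa using hgreedy) (W ++ K P d) hW'
        d.opp w hw
      simpa using this
    rcases huv with ⟨w, hu, hw⟩ | ⟨w, hKu, hw⟩
    · exact later w hu hw
    · cases w with
      | nil => exact later [] (by simpa using hKu.symm) (by simpa using hw.symm)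
      | cons a' w =>
        obtain ⟨rfl, rfl⟩ : a = a' ∧ v = w ++ expandList K d.opp q := by simpa using hw
        cases w with
        -- Here `a` ends the block of `P`. The greedy step among the parents fixes the next parent,
        -- and its only `d`-based child heads the next block.
        | nil =>
          have hg := hgreedy p q P rfl
          rw [← hKu, hKP.greedyStep_last_iff hC hKu hW' (by simp), List.nil_append]
          simp only [hg]
          cases q with
          | nil => simp [expandList]
          | cons Q q =>
            have hKQ := hK Q (by simp) d.opp
            obtain ⟨b, c, t, hbc⟩ := hKQ.exists_cons_cons
            have hh := hKQ.head?_eq_iff R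
            rw [d.opp_opp] at hh
            have : (expandList K d.opp (Q :: q)).head? = (K Q d.opp).head? := by
              rw [expandList, hbc]
              rfl
            rw [this, hh]
            simp only [List.head?_cons, Option.some.injEq, exists_eq_right']
            tauto
        | cons b w =>
          rw [hKP.greedyStep_inner_iff hKu (by simp +contextual)]
          · simp
          · have hnd := hKP.nodup
            rw [hKu] at hnd
            have hbK : b ∈ C ∧ IsParent b P := (hKP.mem b).1 (by simp [hKu])
            rw [List.mem_append, hW]
            rintro (⟨-, Q, hQ, hbQ⟩ | hb)
            · obtain rfl := hbK.2.unique hbQ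
              simp [List.nodup_append] at hpq
              exact absurd rfl (hpq.2.2 _ hQ).1
            · simp [List.nodup_append] at hnd hb
              rcases hb with hb | rfl
              · exact absurd rfl (hnd.2.2 _ hb).2.1
              · exact absurd rfl hnd.2.1.1.1

/-! ### The states of the memoryless algorithm -/

theorem subSatisfies_self {Φ : ∀ {m : ℕ}, Rectangulation m → Prop} (R : Rectangulation n) :
    SubSatisfies Φ n R ↔ Φ R := by
  cases n <;> simp [SubSatisfies]

theorem subSatisfies_iff_of_isParent {Φ : ∀ {m : ℕ}, Rectangulation m → Prop} {j : ℕ}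
    (hj : j < n + 1) {R : Rectangulation (n + 1)} {P : Rectangulation n} (h : IsParent R P) :
    SubSatisfies Φ j R ↔ SubSatisfies Φ j P := by
  simp only [SubSatisfies, hj.ne, false_and, false_or, hj, true_and]
  exact ⟨fun ⟨Q, hQ, hS⟩ => h.unique hQ ▸ hS, fun hS => ⟨P, h, hS⟩⟩

/-- The condition under which the direction `d` of rectangle `j` is reversed when `R` is
reached. -/
def Flips (d : Dir) (j : ℕ) (R : Rectangulation n) : Prop :=
  (d = .left ∧ SubSatisfies BottomBased j R) ∨ (d = .right ∧ SubSatisfies RightBased j R)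

theorem flips_self (d : Dir) (R : Rectangulation n) : Flips d n R ↔ Based d R := by
  cases d <;> simp [Flips, subSatisfies_self, Based]

theorem flips_iff_of_isParent {j : ℕ} (hj : j < n + 1) {R : Rectangulation (n + 1)}
    {P : Rectangulation n} (h : IsParent R P) (d : Dir) : Flips d j R ↔ Flips d j P := by
  simp only [Flips, subSatisfies_iff_of_isParent hj h]

open Classical in
/-- The state after a jump to `R`. -/
noncomputable def State.next (S : State n) (R : Rectangulation n) : State n where
  R := R
  o := if Flips (S.o (S.s n)) (S.s n) R then
    Function.update S.o (S.s n) (S.o (S.s n)).opp else S.o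
  s := if Flips (S.o (S.s n)) (S.s n) R then
      Function.update (Function.update (Function.update S.s n n) (S.s n)
        (Function.update S.s n n (S.s n - 1))) (S.s n - 1) (S.s n - 1)
    else Function.update S.s n n

theorem memorylessStep_iff (C : Set (Rectangulation n)) (S S' : State n) :
    MemorylessStep C S S' ↔ ¬ S.Halted ∧ IsMinJump C (S.o (S.s n)) (S.s n) S.R S'.R ∧
      S' = S.next S'.R := by
  obtain ⟨R, o, s⟩ := S'
  simp only [MemorylessStep, State.next, State.mk.injEq, true_and]
  by_cases hf : Flips (S.o (S.s n)) (S.s n) R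
  · have hf' := hf
    unfold Flips at hf'
    simp only [if_pos hf, if_pos hf']
  · have hf' := hf
    unfold Flips at hf'
    simp only [if_neg hf, if_neg hf']

/-- `S'` is the only state to which the memoryless algorithm can proceed from `S`. -/
def ForcedStep (C : Set (Rectangulation n)) (S S' : State n) : Prop :=
  ∀ S'', MemorylessStep C S S'' ↔ S'' = S'

theorem forcedStep_iff (C : Set (Rectangulation n)) (S S' : State n) :
    ForcedStep C S S' ↔ ¬ S.Halted ∧ S' = S.next S'.R ∧
      ∀ R, IsMinJump C (S.o (S.s n)) (S.s n) S.R R ↔ R = S'.R := by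
  simp only [ForcedStep, memorylessStep_iff]
  constructor
  · intro h
    obtain ⟨h1, h2, h3⟩ := (h S').2 rfl
    refine ⟨h1, h3, fun R => ⟨fun hR => ?_, fun hR => hR ▸ h2⟩⟩
    rw [← (h (S.next R)).1 ⟨h1, hR, rfl⟩]
    rfl
  · rintro ⟨h1, h2, h3⟩ S''
    constructor
    · rintro ⟨-, h4, h5⟩
      rw [h5, (h3 _).1 h4, ← h2]
    · rintro rfl
      exact ⟨h1, (h3 _).2 rfl, h2⟩

/-- The state in which a child `R` of `S.R` other than the last one is visited. -/
def innerState (d : Dir) (S : State (n + 1)) (R : Rectangulation (n + 2)) : State (n + 2) where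
  R := R
  o := Function.update S.o (n + 2) d
  s := Function.update S.s (n + 2) (n + 2)

/-- The state in which the last child `R` of `S.R` is visited. -/
def lastState (d : Dir) (S : State (n + 1)) (R : Rectangulation (n + 2)) : State (n + 2) where
  R := R
  o := Function.update S.o (n + 2) d.opp
  -- The effect of line M5 with `j = n + 2` on the array of an inner state; `s_{n+2}` now carries
  -- the selected index of the parent run.
  s := Function.update (Function.update S.s (n + 2) (S.s (n + 1))) (n + 1) (n + 1)

/-- The states in which the children of `S.R` are visited. -/
def block (d : Dir) (S : State (n + 1)) : List (Rectangulation (n + 2)) → List (State (n + 2))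
  | [] => []
  | [R] => [lastState d S R]
  | R :: R' :: K => innerState d S R :: block d S (R' :: K)

theorem map_block (d : Dir) (S : State (n + 1)) (K : List (Rectangulation (n + 2))) :
    (block d S K).map State.R = K := by
  induction K with
  | nil => rfl
  | cons R K ih =>
    cases K with
    | nil => rfl
    | cons R' K => rw [block, List.map_cons, ih]; rfl

theorem getLast?_block (d : Dir) (S : State (n + 1)) (K : List (Rectangulation (n + 2))) :
    (block d S K).getLast? = K.getLast?.map (lastState d S) := by
  induction K with
  | nil => rfl
  | cons R K ih =>
    cases K with
    | nil => rfl
    | cons R' K =>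
      rw [block, List.getLast?_cons, ih]
      cases K <;> simp [List.getLast?_cons]

/-- An inner state selects the last rectangle and direction `d`. The minimal jump leads to the next
child, and the direction is reversed precisely when that child is the last one. -/
theorem KidList.isChain_block {C : Set (Rectangulation (n + 2))}
    {P : Rectangulation (n + 1)} {d : Dir} {K u v : List (Rectangulation (n + 2))}
    (h : KidList C P d K) (hK : K = u ++ v) (S : State (n + 1)) :
    (block d S v).IsChain (ForcedStep C) := by
  induction v generalizing u with
  | nil => exact .nil
  | cons a v ih =>
    cases v with
    | nil => exact .singleton _
    | cons b v =>
      have ih' := ih (u := u ++ [a]) (by simpa using hK)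
      have hmin := h.isMinJump_iff hK
      have hbased := h.based_iff (u := u ++ [a]) (a := b) (v := v) (by simpa using hK)
      have hs : (innerState d S a).s (n + 2) = n + 2 := by simp [innerState]
      have ho : (innerState d S a).o (n + 2) = d := by simp [innerState]
      have hR : (innerState d S a).R = a := rfl
      have hhalt : ¬ (innerState d S a).Halted := by
        rw [State.Halted, hs]
        omega
      cases v with
      | nil =>
        refine .cons_cons ?_ ih'
        rw [forcedStep_iff, hs, ho, hR]
        refine ⟨hhalt, ?_, fun R => (hmin R).trans (by simp [lastState, eq_comm])⟩
        have hb : Flips d (n + 2) b := (flips_self d b).2 (hbased.2 rfl)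
        have hl : (lastState d S b).R = b := rfl
        rw [State.next, hs, ho, hl, if_pos hb, if_pos hb, lastState, State.mk.injEq]
        refine ⟨rfl, ?_, ?_⟩ <;> funext i <;> simp only [innerState, Function.update_apply] <;>
          split_ifs <;> first | rfl | omega
      | cons c v =>
        refine .cons_cons ?_ ih'
        rw [forcedStep_iff, hs, ho, hR]
        refine ⟨hhalt, ?_, fun R => (hmin R).trans (by simp [innerState, eq_comm])⟩
        have hb : ¬ Flips d (n + 2) b := by
          rw [flips_self, hbased]
          simp
        have hl : (innerState d S b).R = b := rfl
        rw [State.next, hs, ho, hl, if_neg hb, if_neg hb]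
        simp [innerState]

/-- The step from the last child of a rectangulation to the first child of the next one. -/
theorem forcedStep_lastState {C : Set (Rectangulation (n + 2))} (hC : IsZigzag C)
    {S S' : State (n + 1)} (h : ForcedStep (parents C) S S') {d : Dir}
    {a b : Rectangulation (n + 2)} (ha : IsParent a S.R) (had : Based d a)
    (hb : IsParent b S'.R) (hbd : Based d b) (hbC : b ∈ C) :
    ForcedStep C (lastState d S a) (innerState d.opp S' b) := by
  rw [forcedStep_iff] at h
  obtain ⟨h1, h2, h3⟩ := h
  -- The selected index of the parent run is at most `n + 1`, so the direction stored for the last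
  -- rectangle does not interfere.
  have hj := ((h3 _).2 rfl).bounds
  have ho : (lastState d S a).o (S.s (n + 1)) = S.o (S.s (n + 1)) := by
    exact Function.update_of_ne (by omega) _ _
  have hs : (lastState d S a).s (n + 2) = S.s (n + 1) := by simp [lastState]
  have hR : (lastState d S a).R = a := rfl
  have hR' : (innerState d.opp S' b).R = b := rfl
  rw [forcedStep_iff, hs, ho, hR, hR']
  refine ⟨?_, ?_, fun R => ?_⟩
  · rwa [State.Halted, hs]
  · have hf := flips_iff_of_isParent (j := S.s (n + 1)) (by omega) hb (S.o (S.s (n + 1)))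
    rw [State.next, hs, ho]
    rw [State.next] at h2
    generalize S.s (n + 1) = j at *
    have ho' : S'.o = _ := congrArg State.o h2
    have hs' : S'.s = _ := congrArg State.s h2
    dsimp only at ho' hs'
    by_cases hfl : Flips (S.o j) j S'.R
    · rw [if_pos hfl] at ho' hs'
      simp only [if_pos (hf.2 hfl), innerState, State.mk.injEq, true_and]
      rw [ho', hs']
      -- The arrays are compared entry by entry; `lastState` has already reset `s_{n+1}` to `n + 1`,
      -- as line M5 does in the parent run.
      refine ⟨?_, ?_⟩ <;> funext i <;> simp only [lastState, Function.update_apply] <;>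
        split_ifs <;> first | rfl | omega
    · rw [if_neg hfl] at ho' hs'
      simp only [if_neg (mt hf.1 hfl), innerState, State.mk.injEq, true_and]
      rw [ho', hs']
      refine ⟨rfl, ?_⟩
      funext i
      simp only [lastState, Function.update_apply]
      split_ifs <;> rfl
  · rw [isMinJump_of_lt_iff hC ha had (by omega)]
    simp only [h3]
    constructor
    · rintro ⟨-, hRd, P', hRP, rfl⟩
      exact hRP.eq_of_based hb hRd hbd
    · rintro rfl
      exact ⟨hbC, hbd, _, hb, rfl⟩

/-- The states in which the children of the rectangulations of a sequence of states are
visited. -/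
def expandStates (K : Rectangulation (n + 1) → Dir → List (Rectangulation (n + 2))) :
    Dir → List (State (n + 1)) → List (State (n + 2)) :=
  expandList fun S d => block d S (K S.R d)

theorem map_expandStates (K : Rectangulation (n + 1) → Dir → List (Rectangulation (n + 2)))
    (d : Dir) (L : List (State (n + 1))) :
    (expandStates K d L).map State.R = expandList K d (L.map State.R) := by
  induction L generalizing d with
  | nil => rfl
  | cons S L ih =>
    have := ih d.opp
    simp only [expandStates] at this
    simp only [expandStates, expandList, List.map_append, map_block, List.map_cons, this]

theorem head?_expandStates {C : Set (Rectangulation (n + 2))}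
    {K : Rectangulation (n + 1) → Dir → List (Rectangulation (n + 2))} {S : State (n + 1)}
    {d : Dir} (hK : KidList C S.R d (K S.R d)) (L : List (State (n + 1))) :
    ∃ b, (expandStates K d (S :: L)).head? = some (innerState d S b) ∧ b ∈ C ∧
      IsParent b S.R ∧ Based d.opp b := by
  obtain ⟨b, c, t, hbc⟩ := hK.exists_cons_cons
  refine ⟨b, by simp [expandStates, expandList, hbc, block], (hK.head?_eq_iff b).1 ?_⟩
  rw [hbc]
  rfl

theorem isChain_expandStates {C : Set (Rectangulation (n + 2))} (hC : IsZigzag C)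
    {K : Rectangulation (n + 1) → Dir → List (Rectangulation (n + 2))} (d : Dir)
    (L : List (State (n + 1))) (hK : ∀ S ∈ L, ∀ d, KidList C S.R d (K S.R d))
    (hL : L.IsChain (ForcedStep (parents C))) :
    (expandStates K d L).IsChain (ForcedStep C) := by
  induction L generalizing d with
  | nil => exact .nil
  | cons S L ih =>
    have hKS := hK S (by simp) d
    have hKL : ∀ S ∈ L, ∀ d, KidList C S.R d (K S.R d) :=
      fun T hT => hK T (List.mem_cons_of_mem _ hT)
    refine List.isChain_append.2 ⟨hKS.isChain_block (u := []) rfl S,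
      ih d.opp hKL hL.tail, fun T hT T' hT' => ?_⟩
    rw [getLast?_block] at hT
    obtain ⟨a, ha, rfl⟩ := Option.map_eq_some_iff.1 hT
    have ha' := (hKS.mem a).1 (List.mem_of_getLast? ha)
    cases L with
    | nil => simp [expandList] at hT'
    | cons S' L =>
      obtain ⟨b, hb, hbC, hbP, hbd⟩ := head?_expandStates (hKL S' (by simp) d.opp) L
      rw [expandStates] at hb
      obtain rfl : innerState d.opp S' b = T' := by
        rw [hb] at hT'
        simpa using hT'
      rw [d.opp_opp] at hbd
      exact forcedStep_lastState hC (List.isChain_cons_cons.1 hL).1 ha'.2 (hKS.last a ha) hbP hbd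
        hbC

/-- Halting is inherited because the last state of a block copies `s_{n+1}` of the parent run into
`s_{n+2}`. -/
theorem getLast?_expandStates {C : Set (Rectangulation (n + 2))}
    {K : Rectangulation (n + 1) → Dir → List (Rectangulation (n + 2))} (d : Dir)
    (L : List (State (n + 1))) (hK : ∀ S ∈ L, ∀ d, KidList C S.R d (K S.R d))
    (hL : ∀ S ∈ L.getLast?, S.Halted) : ∀ S ∈ (expandStates K d L).getLast?, S.Halted := by
  induction L generalizing d with
  | nil => simp [expandStates, expandList]
  | cons S L ih =>
    have hKS := hK S (by simp) d
    have hKL : ∀ S ∈ L, ∀ d, KidList C S.R d (K S.R d) :=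
      fun T hT => hK T (List.mem_cons_of_mem _ hT)
    intro T hT
    cases L with
    | nil =>
      have hT' : T ∈ (block d S (K S.R d)).getLast? := by
        simpa [expandStates, expandList] using hT
      rw [getLast?_block] at hT'
      obtain ⟨a, -, rfl⟩ := Option.map_eq_some_iff.1 hT'
      have := hL S (by simp)
      simpa [State.Halted, lastState] using this
    | cons S' L =>
      refine ih d.opp hKL (fun T hT => hL T (by simpa [List.getLast?_cons] using hT)) T ?_
      obtain ⟨b, hb, -⟩ := head?_expandStates (hKL S' (by simp) d.opp) L
      have hne : expandStates K d.opp (S' :: L) ≠ [] := by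
        intro h
        simp [h] at hb
      rw [← List.getLast?_append_of_ne_nil (block d S (K S.R d)) hne]
      exact hT

/-! ### Complete runs -/

/-- `L` is the sequence of states of a complete run of the memoryless algorithm, which visits
every member of `C` once and in the order of the greedy algorithm. -/
structure IsTrace [NeZero n] (C : Set (Rectangulation n)) (L : List (State n)) : Prop where
  head : L.head? = some (State.init n)
  chain : L.IsChain (ForcedStep C)
  halted : ∀ S ∈ L.getLast?, S.Halted
  nodup : (L.map State.R).Nodup
  mem : ∀ R, R ∈ L.map State.R ↔ R ∈ C
  greedy : ∀ u v R, L.map State.R = u ++ R :: v →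
    ∀ R', GreedyStep C (u ++ [R]) R R' ↔ v.head? = some R'

theorem isTrace_one : IsTrace {idRect 1} [State.init 1] where
  head := rfl
  chain := .singleton _
  halted := by simp [State.Halted, State.init]
  nodup := by simp
  mem := by simp [State.init]
  greedy := by
    intro u v R h R'
    obtain ⟨rfl, rfl⟩ : u = [] ∧ v = [] := by
      have := congrArg List.length h
      simp at this
      constructor <;> apply List.eq_nil_of_length_eq_zero <;> omega
    simp only [List.head?_nil, reduceCtorEq, iff_false]
    rintro ⟨dir, j, h, -⟩
    -- Only rectangles with index at least 2 jump, so a single rectangle cannot.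
    have := h.1.bounds
    omega

theorem exists_isTrace (n : ℕ) (C : Set (Rectangulation (n + 1))) (hC : IsZigzag C) :
    ∃ L, IsTrace C L := by
  induction n with
  | zero =>
    obtain rfl : C = {idRect 1} := hC
    exact ⟨_, isTrace_one⟩
  | succ n ih =>
    obtain ⟨L, hL⟩ := ih _ hC.parents
    choose K hK using fun P => exists_kidList hC P
    have hK' : ∀ P ∈ L.map State.R, ∀ d, KidList C P d (K P d) := fun P hP d =>
      hK P d ((hL.mem P).1 hP)
    have hKS : ∀ S ∈ L, ∀ d, KidList C S.R d (K S.R d) := fun S hS =>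
      hK' _ (List.mem_map_of_mem hS)
    refine ⟨expandStates K .left L, ?_, isChain_expandStates hC _ L hKS hL.chain,
      getLast?_expandStates _ L hKS hL.halted, ?_, fun R => ?_, fun u v R h => ?_⟩
    · have hhead := hL.head
      cases L with
      | nil => simp at hhead
      | cons S L =>
        obtain rfl : S = State.init (n + 1) := by simpa using hhead
        obtain ⟨b, hb, -, hbP, hbd⟩ := head?_expandStates (hKS (State.init (n + 1)) (by simp) .left) L
        rw [hb]
        -- A block in direction left starts with the right-based child, and the strips are the
        -- right-based child of the strips.
        have : b = idRect (n + 2) := hbP.eq_of_based (isParent_idRect n) (d := .right) hbd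
          (rightBased_idRect _)
        subst this
        simp only [innerState, State.init, Option.some.injEq, State.mk.injEq, true_and]
        refine ⟨?_, ?_⟩ <;> funext i <;> simp only [Function.update_apply] <;> split_ifs <;>
          simp_all
    · rw [map_expandStates]
      exact nodup_expandList hK' _ hL.nodup
    · rw [map_expandStates, mem_expandList hK']
      refine ⟨And.left, fun hR => ⟨hR, ?_⟩⟩
      obtain ⟨P, hP⟩ := exists_isParent R
      exact ⟨P, (hL.mem P).2 ⟨R, hR, hP⟩, hP⟩
    · rw [map_expandStates] at h
      have := greedyStep_expandList hC [] (L.map State.R) (by simpa using hL.nodup) hK'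
        (by simpa using hL.greedy) [] (by simp) .left u v R h
      simpa using this

/-! ### Runs of both algorithms as prefixes of the trace. -/

section

variable [NeZero n] {C : Set (Rectangulation n)} {L : List (State n)}

/-- Each step is determined by the prefix visited so far, so the runs are exactly the non-empty
prefixes. -/
theorem IsTrace.greedyRun_iff (h : IsTrace C L) (w : List (Rectangulation n))
    (R : Rectangulation n) :
    GreedyRun C w R ↔ ∃ u v, w = u ++ [R] ∧ L.map State.R = u ++ R :: v := by
  have hhead : (L.map State.R).head? = some (idRect n) := by
    rw [List.head?_map, h.head]
    rfl
  constructor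
  · intro hr
    induction hr with
    | init =>
      cases hl : L.map State.R with
      | nil => simp [hl] at hhead
      | cons a t =>
        obtain rfl : a = idRect n := by simpa [hl] using hhead
        exact ⟨[], t, rfl, rfl⟩
    | step _ hs ih =>
      obtain ⟨u, v, rfl, hl⟩ := ih
      rw [h.greedy _ _ _ hl] at hs
      obtain ⟨v', rfl⟩ := List.head?_eq_some_iff.1 hs
      exact ⟨_, v', rfl, by simpa using hl⟩
  · rintro ⟨u, v, rfl, hl⟩
    induction u using List.reverseRecOn generalizing R v with
    | nil =>
      obtain rfl : R = idRect n := by simpa [hl] using hhead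
      exact .init
    | append_singleton u a ih =>
      have hl' : L.map State.R = u ++ a :: (R :: v) := by simpa using hl
      exact .step (ih _ _ hl') ((h.greedy _ _ _ hl' R).2 rfl)

theorem IsTrace.isGreedySequence_iff (h : IsTrace C L) (l : List (Rectangulation n)) :
    IsGreedySequence C l ↔ l = L.map State.R := by
  simp only [IsGreedySequence, h.greedyRun_iff]
  constructor
  · rintro ⟨R, ⟨u, v, rfl, hl⟩, hend⟩
    simp only [h.greedy _ _ _ hl] at hend
    cases v with
    | nil => exact hl.symm
    | cons b v => exact (hend b rfl).elim
  · rintro rfl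
    rcases List.eq_nil_or_concat (L.map State.R) with hl | ⟨u, R, hl⟩
    · have := h.head
      rw [List.map_eq_nil_iff.1 hl] at this
      simp at this
    · rw [List.concat_eq_append] at hl
      refine ⟨R, ⟨u, [], hl, hl⟩, fun R' hR' => ?_⟩
      rw [hl] at hR'
      simpa using (h.greedy u [] R hl R').1 hR'

theorem IsTrace.memorylessRun_iff (h : IsTrace C L) (w : List (Rectangulation n)) (S : State n) :
    MemorylessRun C w S ↔ ∃ U V, w = (U ++ [S]).map State.R ∧ L = U ++ S :: V := by
  -- A step leads from each state of the trace to its successor only, and from the last state there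
  -- is none since it has halted.
  have hstep : ∀ U V S, L = U ++ S :: V → ∀ S', MemorylessStep C S S' ↔ V.head? = some S' := by
    rintro U V S rfl S'
    cases V with
    | nil =>
      have hh := h.halted S (by simp)
      simp only [List.head?_nil, reduceCtorEq, iff_false]
      exact fun hs => hs.1 hh
    | cons T V =>
      have hc := (List.isChain_append_cons_cons.1 h.chain).2.1
      rw [hc S']
      simp [eq_comm]
  constructor
  · intro hr
    induction hr with
    | init =>
      obtain ⟨V, hV⟩ := List.head?_eq_some_iff.1 h.head
      exact ⟨[], V, rfl, hV⟩
    | @step _ T _ _ hs ih =>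
      obtain ⟨U, V, rfl, hl⟩ := ih
      rw [hstep _ _ _ hl] at hs
      obtain ⟨V', rfl⟩ := List.head?_eq_some_iff.1 hs
      exact ⟨U ++ [T], V', by simp, by simpa using hl⟩
  · rintro ⟨U, V, rfl, hl⟩
    induction U using List.reverseRecOn generalizing S V with
    | nil =>
      obtain rfl : S = State.init n := by simpa [hl] using h.head
      exact .init
    | append_singleton U T ih =>
      have hl' : L = U ++ T :: (S :: V) := by simpa using hl
      have := MemorylessRun.step (ih _ _ hl') ((hstep _ _ _ hl' S).2 rfl)
      simpa using this

end

end Rectangulations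

theorem theorem3 (n : ℕ) [NeZero n] (C : Set (Rectangulations.Rectangulation n))
    (hC : Rectangulations.IsZigzag C) :
    ∃ l : List (Rectangulations.Rectangulation n),
      -- `l` is the sequence visited by the greedy algorithm
      (∀ l', Rectangulations.IsGreedySequence C l' ↔ l' = l) ∧
      -- the memoryless algorithm visits exactly the sequence `l` and then terminates
      (∃ S, Rectangulations.MemorylessRun C l S ∧ S.Halted) ∧
      (∀ l' S, Rectangulations.MemorylessRun C l' S → l' <+: l ∧ (S.Halted → l' = l)) ∧
      -- every member of `C` is visited exactly once, and nothing else is visited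
      l.Nodup ∧ ∀ R, R ∈ l ↔ R ∈ C := by
  obtain ⟨L, hL⟩ : ∃ L, Rectangulations.IsTrace C L := by
    cases n with
    | zero => exact (NeZero.ne 0 rfl).elim
    | succ n => exact Rectangulations.exists_isTrace n C hC
  refine ⟨L.map Rectangulations.State.R, hL.isGreedySequence_iff, ?_, fun l' S hS => ?_,
    hL.nodup, hL.mem⟩
  · rcases List.eq_nil_or_concat L with hl | ⟨U, S, hl⟩
    · have := hL.head
      rw [hl] at this
      simp at this
    · rw [List.concat_eq_append] at hl
      exact ⟨S, (hL.memorylessRun_iff _ _).2 ⟨U, [], by rw [hl], hl⟩,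
        hL.halted S (by simp [hl])⟩
  · obtain ⟨U, V, rfl, rfl⟩ := (hL.memorylessRun_iff _ _).1 hS
    refine ⟨⟨V.map Rectangulations.State.R, by simp⟩, fun hh => ?_⟩
    cases V with
    | nil => rfl
    | cons T V =>
      have hc := (List.isChain_append_cons_cons.1 hL.chain).2.1
      exact (((hc T).2 rfl).1 hh).elim
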